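/- Let $W(R)=(1+R^2/3)^{-1/2}$ and $\mathcal L u=u_{tt}-u_{rr}-\frac2r u_r-u^5$. For $\nu>3$ and $\varepsilon_0\in\mathbb R$ put $$\lambda(t)=t^{-1-\nu}\exp(-\varepsilon_0\sin(\log t)),\qquad \mu(t)=t\lambda(t),\qquad R=\lambda(t)r\qquad(t>0).$$ For every $\nu>3$ there is $\varepsilon_*>0$ such that for every $|\varepsilon_0|<\varepsilon_*$ there is $T>0$ such that for every $0<t_0<T$ there is a real function $u_2(t,r)$ with the following properties. Each $O(\cdot)$ is a bound that is uniform in $(t,r)$ in the indicated region, with a constant that may depend on $\nu,\varepsilon_0,t_0,k,j$. (i) $u_2\in C^2(\{0<t<t_0,\ 0\le r\le t\})$, and, with $e_2:=\mathcal L u_2$, for $0<t<t_0$, $0<r<t$, $$u_2(t,r)=\sqrt{\lambda(t)}\,\bigl(W(R)+\mu(t)^{-2}O(R)\bigr),\qquad t^2\lambda(t)^{-1/2}e_2(t,r)=\mu(t)^{-2}\,O\!\left(\frac{\log(R+2)}{R+1}\right).$$ (ii) $u_2$ is $C^\infty$ on $\{0<t<t_0,\ 0<r<t/2\}$, and there,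 for all integers $k,j\ge0$, $$\partial_t^k\partial_r^j u_2(t,r)=\partial_t^k\partial_r^j\bigl(\sqrt{\lambda(t)}\,W(\lambda(t)r)\bigr)+t^{-k}r^{-j}\sqrt{\lambda(t)}\,\mu(t)^{-2}O(R),$$ $$\partial_t^k\partial_r^j\bigl(t^2\lambda(t)^{-1/2}e_2(t,r)\bigr)=t^{-k}r^{-j}\mu(t)^{-2}\,O\!\left(\frac{\log(R+2)}{R+1}\right).$$ Moreover $e_2$ is $C^2$ on $\{0<t<t_0,\ 0<r<t\}$, and for $k+j\le2$ both bounds hold on this whole region. (iii) $u_2$ has an extension, again denoted $u_2$, to $\{0<t<t_0,\ r\ge0\}$ that is $C^1$ in $(t,r)$ there and is $C^2$ in $r\in[0,\infty)$ for each fixed $t$, such that for every $\delta>0$ and all sufficiently small $t\in(0,t_0)$, $$\int_t^\infty\bigl[(\partial_r u_2)^2+(\partial_t u_2)^2+u_2^6\bigr](t,r)\,r^2\,dr<\delta .$$ -/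

import Mathlib

open Real Set MeasureTheory
open scoped ContDiff

namespace QuinticWave

noncomputable section

/-- The ground state `W(R) = (1 + R²/3)^{-1/2}`. -/
def W (R : ℝ) : ℝ := (1 + R ^ 2 / 3) ^ (-(1 / 2) : ℝ)

/-- The scaling function `λ(t) = t^{-1-ν} exp(-ε₀ sin(log t))`, for `t > 0`. -/
def lam (ν ε₀ t : ℝ) : ℝ := t ^ (-1 - ν) * exp (-ε₀ * sin (log t))

/-- `μ(t) = t λ(t)`. -/
def mu (ν ε₀ t : ℝ) : ℝ := t * lam ν ε₀ t

/-- The partial derivative `∂_t^k ∂_r^j u (t, r)`. It is only used at interior points of regions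
on which `u` is of class `C^{k+j}`. -/
def pderiv (k j : ℕ) (u : ℝ → ℝ → ℝ) (t r : ℝ) : ℝ :=
  iteratedDeriv k (fun s => iteratedDeriv j (fun ρ => u s ρ) r) t

/-- The radial quintic wave operator `u_tt - u_rr - (2/r) u_r - u⁵`. -/
def quinticOp (u : ℝ → ℝ → ℝ) (t r : ℝ) : ℝ :=
  pderiv 2 0 u t r - pderiv 0 2 u t r - 2 / r * pderiv 0 1 u t r - u t r ^ 5

/-- The bulk term `u₀(t, r) = √λ(t) W(λ(t) r)`. -/
def bulk (ν ε₀ t r : ℝ) : ℝ := √(lam ν ε₀ t) * W (lam ν ε₀ t * r)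

/-- The normalized error `t² λ(t)^{-1/2} (u_tt - u_rr - (2/r) u_r - u⁵)(t, r)` of `u`. -/
def normError (ν ε₀ : ℝ) (u : ℝ → ℝ → ℝ) (t r : ℝ) : ℝ :=
  t ^ 2 * lam ν ε₀ t ^ (-(1 / 2) : ℝ) * quinticOp u t r

/-- The truncated light cone `0 < t < t₀`, `0 ≤ r ≤ t`, of points `(t, r)`. -/
def cone (t₀ : ℝ) : Set (ℝ × ℝ) := {p | 0 < p.1 ∧ p.1 < t₀ ∧ 0 ≤ p.2 ∧ p.2 ≤ p.1}

/-- The open set `0 < t < t₀`, `0 < r < c t`. -/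
def openCone (c t₀ : ℝ) : Set (ℝ × ℝ) := {p | 0 < p.1 ∧ p.1 < t₀ ∧ 0 < p.2 ∧ p.2 < c * p.1}

/-- The symbol bound `∂_t^k ∂_r^j (u - u₀) = t^{-k} r^{-j} √λ μ^{-2} O(R)`, `R = λ r`, on a set
of points `(t, r)`, in the form `∂_t^k ∂_r^j u = ∂_t^k ∂_r^j u₀ + …`. -/
def SolutionBound (ν ε₀ : ℝ) (u : ℝ → ℝ → ℝ) (k j : ℕ) (S : Set (ℝ × ℝ)) : Prop :=
  ∃ C : ℝ, ∀ t r : ℝ, (t, r) ∈ S →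
    |pderiv k j u t r - pderiv k j (bulk ν ε₀) t r| ≤
      C * ((t ^ k)⁻¹ * (r ^ j)⁻¹ * √(lam ν ε₀ t) * (mu ν ε₀ t ^ 2)⁻¹ * (lam ν ε₀ t * r))

/-- The symbol bound `∂_t^k ∂_r^j (t² λ^{-1/2} e) = t^{-k} r^{-j} μ^{-2} O(log(R+2)/(R+1))`,
`R = λ r`, on a set of points `(t, r)`, for the error `e` of `u`. -/
def ErrorBound (ν ε₀ : ℝ) (u : ℝ → ℝ → ℝ) (k j : ℕ) (S : Set (ℝ × ℝ)) : Prop :=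
  ∃ C : ℝ, ∀ t r : ℝ, (t, r) ∈ S →
    |pderiv k j (normError ν ε₀ u) t r| ≤
      C * ((t ^ k)⁻¹ * (r ^ j)⁻¹ * (mu ν ε₀ t ^ 2)⁻¹ *
        (log (lam ν ε₀ t * r + 2) / (lam ν ε₀ t * r + 1)))

/-- The integrand `(u_r² + u_t² + u⁶) r²` of the exterior energy. -/
def energyDensity (u : ℝ → ℝ → ℝ) (t r : ℝ) : ℝ :=
  (pderiv 0 1 u t r ^ 2 + pderiv 1 0 u t r ^ 2 + u t r ^ 6) * r ^ 2

end

end QuinticWave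

/-! Write σ = √λ, x = λr/√3 and ℓ = tλ'/λ. At each fixed time the bulk term solves Δu + u⁵ = 0, so
its error is only its second time derivative. Since t∂_t acts on σ f(x) as ℓ σ (1/2 + x d/dx) f,
this error is σ t⁻²(ω₁ s₁(x) + ω₂ s₂(x)), with s₁, s₂ obtained from the ground state by one and two
applications of 1/2 + x d/dx (`iteratedDeriv_two_bulk`). The correction `corr₁` removes it by
solving the elliptic equation linearized at the bulk term, with t as a parameter. The profiles are
explicit (`profile_ode`); they are smooth, vanish at the origin and equal βx + γ + O(log x / x) at
infinity.

The price is ∂_t² of `corr₁`. The part that comes from the growing asymptotics, ∂_t²(A(t) r + B(t)),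
does not decay in R. Choose primitives 𝒜'' = A and ℬ' = B that vanish at zero. By d'Alembert's
formula, (𝒜(t+r) + 𝒜(t-r) - 2𝒜(t) + (ℬ(t+r) - ℬ(t-r))/2)/r has image -2A/r = -Δ(Ar + B) under ∂_t² -
Δ. So Ar + B may be replaced by this function, which removes the bad term and creates no new linear
one; the difference is `corr₂`. What remains (`quinticOp_approx`) is ∂_t² of the decaying remainder
`corrDiff`, the potential times `corr₂`, and terms at least quadratic in the corrections. Each has
the required size (`isSymbol_errorExpr`).

Derivative bounds come from a calculus of symbols: functions whose derivatives along t∂_t and r∂_r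
all obey one weight. For r < t/2, `corr₂` is a combination of Taylor remainders, controlled to all
orders by `isSymbol_taylorRem`. For r comparable to t the arguments t - r may reach zero. There 𝒜 =
O(t^{(1+ν)/2}), extended by zero to negative arguments, is C² because ν > 3 gives (1+ν)/2 > 2
(`PowerSymbol.contDiff`). This yields two derivatives across the light cone. Regularity at r = 0
follows by splitting off the quadratic term of `corr₂` (`contDiffOn_corr₂`). The formula makes sense
for all r > 0, so the extension is a cutoff to r ≤ 2t; its exterior energy is O(μ⁻¹). -/

namespace QuinticWave

/-! ### Calculus of symbols along linear vector fields -/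

noncomputable section Symbols

variable {E ι : Type*} [NormedAddCommGroup E] [NormedSpace ℝ E]

/-- The derivative of `f` along the linear vector field `X`. -/
def lieD (X : E →L[ℝ] E) (f : E → ℝ) (p : E) : ℝ := fderiv ℝ f p (X p)

/-- `f` is of class `C^n` on `S` and all its derivatives of order at most `n` along the vector
fields `X i` are `O(w)` on `S`. -/
def IsSymbol (X : ι → E →L[ℝ] E) (S : Set E) (w : E → ℝ) : ℕ → (E → ℝ) → Prop
  | 0, f => ContDiffOn ℝ 0 f S ∧ ∃ C, 0 ≤ C ∧ ∀ p ∈ S, |f p| ≤ C * w p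
  | n + 1, f => ContDiffOn ℝ (n + 1 : ℕ) f S ∧ (∃ C, 0 ≤ C ∧ ∀ p ∈ S, |f p| ≤ C * w p) ∧
      ∀ i, IsSymbol X S w n (lieD (X i) f)

variable {X : ι → E →L[ℝ] E} {S S' : Set E} {w w₁ w₂ : E → ℝ} {n m : ℕ} {f g : E → ℝ}

theorem IsSymbol.contDiffOn (h : IsSymbol X S w n f) : ContDiffOn ℝ n f S := by
  cases n with
  | zero => exact h.1
  | succ n => exact h.1

theorem IsSymbol.bound (h : IsSymbol X S w n f) : ∃ C, 0 ≤ C ∧ ∀ p ∈ S, |f p| ≤ C * w p := by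
  cases n with
  | zero => exact h.2
  | succ n => exact h.2.1

theorem IsSymbol.lieD (h : IsSymbol X S w (n + 1) f) (i : ι) : IsSymbol X S w n (lieD (X i) f) :=
  h.2.2 i

theorem IsSymbol.of_succ (h : IsSymbol X S w (n + 1) f) : IsSymbol X S w n f := by
  induction n generalizing f with
  | zero => exact ⟨h.contDiffOn.of_le (by simp), h.bound⟩
  | succ n ih =>
    exact ⟨h.contDiffOn.of_le (by exact_mod_cast Nat.le_succ _), h.bound, fun i => ih (h.lieD i)⟩

theorem IsSymbol.of_le (h : IsSymbol X S w n f) (hmn : m ≤ n) : IsSymbol X S w m f := by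
  induction n, hmn using Nat.le_induction with
  | base => exact h
  | succ n _ ih => exact ih h.of_succ

theorem IsSymbol.weight (h : IsSymbol X S w₁ n f) {C : ℝ} (hC0 : 0 ≤ C)
    (hC : ∀ p ∈ S, w₁ p ≤ C * w₂ p) : IsSymbol X S w₂ n f := by
  have key : ∀ f : E → ℝ, (∃ C, 0 ≤ C ∧ ∀ p ∈ S, |f p| ≤ C * w₁ p) →
      ∃ C, 0 ≤ C ∧ ∀ p ∈ S, |f p| ≤ C * w₂ p := by
    rintro f ⟨D, hD, hf⟩
    refine ⟨D * C, mul_nonneg hD hC0, fun p hp => ?_⟩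
    nlinarith [hf p hp, mul_le_mul_of_nonneg_left (hC p hp) hD]
  induction n generalizing f with
  | zero => exact ⟨h.contDiffOn, key f h.bound⟩
  | succ n ih => exact ⟨h.contDiffOn, key f h.bound, fun i => ih (h.lieD i)⟩

theorem IsSymbol.weight_le (h : IsSymbol X S w₁ n f) (hC : ∀ p ∈ S, w₁ p ≤ w₂ p) :
    IsSymbol X S w₂ n f :=
  h.weight zero_le_one (by simpa using hC)

theorem IsSymbol.mono (h : IsSymbol X S w n f) (hS : S' ⊆ S) : IsSymbol X S' w n f := by
  induction n generalizing f with
  | zero =>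
    obtain ⟨C, hC, hf⟩ := h.bound
    exact ⟨h.contDiffOn.mono hS, C, hC, fun p hp => hf p (hS hp)⟩
  | succ n ih =>
    obtain ⟨C, hC, hf⟩ := h.bound
    exact ⟨h.contDiffOn.mono hS, ⟨C, hC, fun p hp => hf p (hS hp)⟩, fun i => ih (h.lieD i)⟩

theorem lieD_congr (hS : IsOpen S) (hfg : EqOn f g S) (Y : E →L[ℝ] E) :
    EqOn (lieD Y f) (lieD Y g) S := fun p hp => by
  have : f =ᶠ[nhds p] g := Filter.eventuallyEq_of_mem (hS.mem_nhds hp) hfg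
  simp [QuinticWave.lieD, this.fderiv_eq]

theorem IsSymbol.congr (h : IsSymbol X S w n f) (hS : IsOpen S) (hfg : EqOn g f S) :
    IsSymbol X S w n g := by
  induction n generalizing f g with
  | zero =>
    obtain ⟨C, hC, hf⟩ := h.bound
    exact ⟨h.contDiffOn.congr hfg, C, hC, fun p hp => by rw [hfg hp]; exact hf p hp⟩
  | succ n ih =>
    obtain ⟨C, hC, hf⟩ := h.bound
    exact ⟨h.contDiffOn.congr hfg, ⟨C, hC, fun p hp => by rw [hfg hp]; exact hf p hp⟩,
      fun i => ih (h.lieD i) (lieD_congr hS hfg _)⟩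

/-- Symbol bounds are pointwise, so different arguments may be used on two overlapping open regions:
near the origin and at infinity for profiles, away from and near the light cone for the second
correction. -/
theorem IsSymbol.union (h : IsSymbol X S w n f) (h' : IsSymbol X S' w n f) (hS : IsOpen S)
    (hS' : IsOpen S') (hw : ∀ p ∈ S ∪ S', 0 ≤ w p) : IsSymbol X (S ∪ S') w n f := by
  have key : ∀ f : E → ℝ, (∃ C, 0 ≤ C ∧ ∀ p ∈ S, |f p| ≤ C * w p) →
      (∃ C, 0 ≤ C ∧ ∀ p ∈ S', |f p| ≤ C * w p) →
      ∃ C, 0 ≤ C ∧ ∀ p ∈ S ∪ S', |f p| ≤ C * w p := by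
    rintro f ⟨C, hC, hf⟩ ⟨C', hC', hf'⟩
    refine ⟨C + C', add_nonneg hC hC', fun p hp => ?_⟩
    have h0 := hw p hp
    rcases hp with hp | hp
    · nlinarith [hf p hp, mul_nonneg hC' h0]
    · nlinarith [hf' p hp, mul_nonneg hC h0]
  induction n generalizing f with
  | zero =>
    exact ⟨h.contDiffOn.union_of_isOpen h'.contDiffOn hS hS', key f h.bound h'.bound⟩
  | succ n ih =>
    exact ⟨h.contDiffOn.union_of_isOpen h'.contDiffOn hS hS', key f h.bound h'.bound,
      fun i => ih (h.lieD i) (h'.lieD i)⟩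

theorem IsSymbol.differentiableAt (h : IsSymbol X S w (n + 1) f) (hS : IsOpen S) {p : E}
    (hp : p ∈ S) : DifferentiableAt ℝ f p :=
  (h.contDiffOn.contDiffAt (hS.mem_nhds hp)).differentiableAt (by simp)

/-- One step of the induction that shows that `f` is a symbol. -/
theorem IsSymbol.succ_of (hf : ContDiffOn ℝ (n + 1 : ℕ) f S)
    {C : ℝ} (hC : ∀ p ∈ S, |f p| ≤ C * w p) (hS : IsOpen S) (hw : ∀ p ∈ S, 0 ≤ w p)
    {g : ι → E → ℝ} (hg : ∀ i, IsSymbol X S w n (g i))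
    (hfg : ∀ i, EqOn (QuinticWave.lieD (X i) f) (g i) S) : IsSymbol X S w (n + 1) f :=
  ⟨hf, ⟨|C|, abs_nonneg _, fun p hp =>
    (hC p hp).trans (mul_le_mul_of_nonneg_right (le_abs_self _) (hw p hp))⟩,
    fun i => (hg i).congr hS (hfg i)⟩

theorem IsSymbol.zero_of (hf : ContDiffOn ℝ 0 f S)
    {C : ℝ} (hC : ∀ p ∈ S, |f p| ≤ C * w p) (hw : ∀ p ∈ S, 0 ≤ w p) : IsSymbol X S w 0 f :=
  ⟨hf, |C|, abs_nonneg _, fun p hp =>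
    (hC p hp).trans (mul_le_mul_of_nonneg_right (le_abs_self _) (hw p hp))⟩

theorem IsSymbol.add (hf : IsSymbol X S w n f) (hg : IsSymbol X S w n g) (hS : IsOpen S) :
    IsSymbol X S w n (fun p => f p + g p) := by
  have key : ∀ f g : E → ℝ, (∃ C, 0 ≤ C ∧ ∀ p ∈ S, |f p| ≤ C * w p) →
      (∃ C, 0 ≤ C ∧ ∀ p ∈ S, |g p| ≤ C * w p) →
      ∃ C, 0 ≤ C ∧ ∀ p ∈ S, |f p + g p| ≤ C * w p := by
    rintro f g ⟨C, hC, hf⟩ ⟨C', hC', hf'⟩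
    refine ⟨C + C', add_nonneg hC hC', fun p hp => (abs_add_le _ _).trans ?_⟩
    linarith [hf p hp, hf' p hp]
  induction n generalizing f g with
  | zero => exact ⟨hf.contDiffOn.add hg.contDiffOn, key f g hf.bound hg.bound⟩
  | succ n ih =>
    refine ⟨hf.contDiffOn.add hg.contDiffOn, key f g hf.bound hg.bound, fun i => ?_⟩
    refine (ih (hf.lieD i) (hg.lieD i)).congr hS fun p hp => ?_
    simp [QuinticWave.lieD, fderiv_fun_add (hf.differentiableAt hS hp) (hg.differentiableAt hS hp)]

theorem IsSymbol.mul (hf : IsSymbol X S w₁ n f) (hg : IsSymbol X S w₂ n g) (hS : IsOpen S) :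
    IsSymbol X S (fun p => w₁ p * w₂ p) n (fun p => f p * g p) := by
  have key : ∀ f g : E → ℝ, (∃ C, 0 ≤ C ∧ ∀ p ∈ S, |f p| ≤ C * w₁ p) →
      (∃ C, 0 ≤ C ∧ ∀ p ∈ S, |g p| ≤ C * w₂ p) →
      ∃ C, 0 ≤ C ∧ ∀ p ∈ S, |f p * g p| ≤ C * (w₁ p * w₂ p) := by
    rintro f g ⟨C, hC, hf⟩ ⟨C', hC', hf'⟩
    refine ⟨C * C', mul_nonneg hC hC', fun p hp => ?_⟩
    rw [abs_mul]
    calc |f p| * |g p| ≤ (C * w₁ p) * (C' * w₂ p) :=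
          mul_le_mul (hf p hp) (hf' p hp) (abs_nonneg _) ((abs_nonneg _).trans (hf p hp))
      _ = _ := by ring
  induction n generalizing f g with
  | zero => exact ⟨hf.contDiffOn.mul hg.contDiffOn, key f g hf.bound hg.bound⟩
  | succ n ih =>
    refine ⟨hf.contDiffOn.mul hg.contDiffOn, key f g hf.bound hg.bound, fun i => ?_⟩
    refine ((ih (hf.lieD i) hg.of_succ).add (ih hf.of_succ (hg.lieD i)) hS).congr hS fun p hp => ?_
    simp [QuinticWave.lieD, fderiv_fun_mul (hf.differentiableAt hS hp) (hg.differentiableAt hS hp)]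
    ring

theorem IsSymbol.const (c : ℝ) : IsSymbol X S (fun _ => 1) n (fun _ => c) := by
  induction n generalizing c with
  | zero => exact ⟨contDiffOn_const, |c|, abs_nonneg _, by simp⟩
  | succ n ih =>
    refine ⟨contDiffOn_const, ⟨|c|, abs_nonneg _, by simp⟩, fun i => ?_⟩
    have : QuinticWave.lieD (X i) (fun _ : E => c) = fun _ => 0 := by
      ext; simp [QuinticWave.lieD]
    rw [this]
    exact ih 0

theorem IsSymbol.const_mul (hf : IsSymbol X S w n f) (hS : IsOpen S) (c : ℝ) :
    IsSymbol X S w n (fun p => c * f p) :=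
  ((IsSymbol.const c).mul hf hS).weight_le (by simp)

theorem IsSymbol.neg (hf : IsSymbol X S w n f) (hS : IsOpen S) :
    IsSymbol X S w n (fun p => - f p) :=
  (hf.const_mul hS (-1)).congr hS (fun p _ => by simp)

theorem IsSymbol.sub (hf : IsSymbol X S w n f) (hg : IsSymbol X S w n g) (hS : IsOpen S) :
    IsSymbol X S w n (fun p => f p - g p) :=
  (hf.add (hg.neg hS) hS).congr hS (fun p _ => by ring)

theorem IsSymbol.pow (hf : IsSymbol X S w n f) (hS : IsOpen S) (k : ℕ) :
    IsSymbol X S (fun p => w p ^ k) n (fun p => f p ^ k) := by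
  induction k with
  | zero => simpa using IsSymbol.const 1
  | succ k ih => simpa [pow_succ] using ih.mul hf hS

/-- A field maps 1/f to -Xf · (1/f)², of weight w · w⁻² = w⁻¹, so the induction closes. The lower
bound by a multiple of w gives the case of order zero. -/
theorem IsSymbol.inv (hf : IsSymbol X S w n f) (hS : IsOpen S) (hw : ∀ p ∈ S, 0 < w p) {c : ℝ}
    (hc : 0 < c) (hfc : ∀ p ∈ S, c * w p ≤ f p) :
    IsSymbol X S (fun p => (w p)⁻¹) n (fun p => (f p)⁻¹) := by
  have hpos : ∀ p ∈ S, 0 < f p := fun p hp => (mul_pos hc (hw p hp)).trans_le (hfc p hp)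
  have hb : ∀ p ∈ S, |(f p)⁻¹| ≤ c⁻¹ * (w p)⁻¹ := fun p hp => by
    rw [abs_of_pos (inv_pos.2 (hpos p hp)), ← mul_inv]
    exact inv_anti₀ (mul_pos hc (hw p hp)) (hfc p hp)
  have hw' : ∀ p ∈ S, 0 ≤ (w p)⁻¹ := fun p hp => (inv_pos.2 (hw p hp)).le
  induction n with
  | zero => exact .zero_of (hf.contDiffOn.inv fun p hp => (hpos p hp).ne') hb hw'
  | succ n ih =>
    refine .succ_of (hf.contDiffOn.inv fun p hp => (hpos p hp).ne') hb hS hw'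
      (g := fun i p => - (QuinticWave.lieD (X i) f p * ((f p)⁻¹ * (f p)⁻¹))) (fun i => ?_)
      (fun i p hp => ?_)
    · refine IsSymbol.neg (((hf.lieD i).mul ((ih hf.of_succ).mul (ih hf.of_succ) hS)
        hS).weight_le fun p hp => ?_) hS
      have := (hw p hp).ne'
      field_simp
      exact le_rfl
    · have h1 : HasFDerivAt (fun p => (f p)⁻¹) (-(f p ^ 2)⁻¹ • fderiv ℝ f p) p := by
        have := (hasDerivAt_inv (hpos p hp).ne').comp_hasFDerivAt p
          (hf.differentiableAt hS hp).hasFDerivAt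
        exact this
      simp only [QuinticWave.lieD, h1.fderiv]
      simp
      ring

/-- The Euler vector field `x d/dx` on the line, as a family with one element. -/
def eulerField : Unit → ℝ →L[ℝ] ℝ := fun _ => ContinuousLinearMap.id ℝ ℝ

theorem lieD_eulerField (i : Unit) (f : ℝ → ℝ) (x : ℝ) :
    QuinticWave.lieD (eulerField i) f x = x * deriv f x := by
  simp only [QuinticWave.lieD, eulerField]
  rw [fderiv_eq_smul_deriv]
  simp

/-- If Xφ = cφ, then X(h ∘ φ) = c · (x h') ∘ φ: the Euler field downstairs is exactly what the chain
rule produces, up to a symbol of weight one. -/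
theorem IsSymbol.comp {I : Set ℝ} {m : ℝ → ℝ} {h : ℝ → ℝ} {φ : E → ℝ} {c : ι → E → ℝ}
    (hh : IsSymbol eulerField I m n h) (hI : IsOpen I) (hS : IsOpen S) (hφ : ContDiffOn ℝ n φ S)
    (hφI : MapsTo φ S I) (hc : ∀ i, IsSymbol X S (fun _ => 1) n (c i))
    (hφc : ∀ i, ∀ p ∈ S, QuinticWave.lieD (X i) φ p = c i p * φ p) :
    IsSymbol X S (fun p => m (φ p)) n (fun p => h (φ p)) := by
  induction n generalizing h with
  | zero =>
    obtain ⟨C, hC, hb⟩ := hh.bound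
    exact ⟨hh.contDiffOn.comp hφ hφI, C, hC, fun p hp => hb _ (hφI hp)⟩
  | succ n ih =>
    obtain ⟨C, hC, hb⟩ := hh.bound
    refine ⟨hh.contDiffOn.comp hφ hφI, ⟨C, hC, fun p hp => hb _ (hφI hp)⟩, fun i => ?_⟩
    have h1 := ih (hh.lieD ()) (hφ.of_le (by exact_mod_cast Nat.le_succ _))
      (fun i => (hc i).of_succ)
    refine ((((hc i).of_succ).mul h1 hS).weight_le fun p hp => by simp).congr hS fun p hp => ?_
    have h2 : HasFDerivAt (fun p => h (φ p)) (deriv h (φ p) • fderiv ℝ φ p) p :=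
      (hh.differentiableAt hI (hφI hp)).hasDerivAt.comp_hasFDerivAt p
        ((hφ.contDiffAt (hS.mem_nhds hp)).differentiableAt (by simp)).hasFDerivAt
    have h3 := hφc i p hp
    change _ = c i p * QuinticWave.lieD (eulerField ()) h (φ p)
    rw [lieD_eulerField]
    simp only [QuinticWave.lieD, h2.fderiv] at h3 ⊢
    simp [h3]
    ring

/-- Smoothness of h' is recovered from that of x h' by dividing by x, which is why the origin must
lie outside I. Inductions over the order then only need x h' as a symbol. -/
theorem IsSymbol.succ_eulerField {I : Set ℝ} {m h h' : ℝ → ℝ} (hI : IsOpen I)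
    (hd : ∀ x ∈ I, HasDerivAt h (h' x) x) {C : ℝ} (hb : ∀ x ∈ I, |h x| ≤ C * m x)
    (hm : ∀ x ∈ I, 0 ≤ m x) (hI0 : ∀ x ∈ I, x ≠ 0)
    (hs : IsSymbol eulerField I m n (fun x => x * h' x)) : IsSymbol eulerField I m (n + 1) h := by
  have hc : ContDiffOn ℝ (n + 1 : ℕ) h I := by
    have h1 : ContDiffOn ℝ n h' I := by
      refine ((contDiffOn_id.inv hI0).mul hs.contDiffOn).congr fun x hx => ?_
      simp [hI0 x hx]
    push_cast
    rw [contDiffOn_succ_iff_deriv_of_isOpen hI]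
    exact ⟨fun x hx => (hd x hx).differentiableAt.differentiableWithinAt, by simp,
      h1.congr fun x hx => (hd x hx).deriv⟩
  refine .succ_of hc hb hI hm (fun _ => hs) fun i x hx => ?_
  rw [lieD_eulerField, (hd x hx).deriv]

theorem IsSymbol.of_contDiff_eulerField {h : ℝ → ℝ} (hh : ContDiff ℝ ∞ h) (a b : ℝ) :
    IsSymbol eulerField (Ioo a b) (fun _ => 1) n h := by
  have hb : ∀ h : ℝ → ℝ, Continuous h → ∃ C, 0 ≤ C ∧ ∀ x ∈ Ioo a b, |h x| ≤ C * 1 := by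
    intro h hh
    obtain ⟨C, hC⟩ := (isCompact_Icc (a := a) (b := b)).exists_bound_of_continuousOn hh.continuousOn
    exact ⟨|C|, abs_nonneg _, fun x hx => by
      rw [mul_one]; exact (hC x (Ioo_subset_Icc_self hx)).trans (le_abs_self _)⟩
  induction n generalizing h with
  | zero => exact ⟨(hh.of_le (by simp)).contDiffOn, hb h hh.continuous⟩
  | succ n ih =>
    refine ⟨(hh.of_le (by exact_mod_cast le_top)).contDiffOn, hb h hh.continuous, fun i => ?_⟩
    have : QuinticWave.lieD (eulerField i) h = fun x => x * deriv h x := by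
      ext x; exact lieD_eulerField i h x
    rw [this]
    exact ih (contDiff_id.mul (contDiff_infty_iff_deriv.1 hh).2)

end Symbols

/-! ### Ground state and elementary functions as symbols -/

noncomputable section Profiles

/-- `(1 + x²)^{-1/2}`, the ground state in the variable `x = R/√3`. -/
def ground (x : ℝ) : ℝ := (√(1 + x ^ 2))⁻¹

theorem ground_pos (x : ℝ) : 0 < ground x := by unfold ground; positivity

theorem ground_sq (x : ℝ) : ground x ^ 2 * (1 + x ^ 2) = 1 := by
  have h : (0 : ℝ) < 1 + x ^ 2 := by positivity
  rw [ground, inv_pow, Real.sq_sqrt h.le, inv_mul_cancel₀ h.ne']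

theorem hasDerivAt_ground (x : ℝ) : HasDerivAt ground (-x * ground x ^ 3) x := by
  have h : (0 : ℝ) < 1 + x ^ 2 := by positivity
  have h1 : HasDerivAt (fun x : ℝ => 1 + x ^ 2) (2 * x) x := by
    simpa using (hasDerivAt_pow 2 x).const_add 1
  have h2 := (h1.sqrt h.ne').inv (Real.sqrt_ne_zero'.2 h)
  refine h2.congr_deriv ?_
  unfold ground
  have : √(1 + x ^ 2) ≠ 0 := Real.sqrt_ne_zero'.2 h
  field_simp

theorem contDiff_ground {n : WithTop ℕ∞} : ContDiff ℝ n ground := by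
  refine ContDiff.inv (ContDiff.sqrt (by fun_prop) fun x => ?_) fun x => ?_
  · positivity
  · exact Real.sqrt_ne_zero'.2 (by positivity)

theorem W_eq_ground (R : ℝ) : W R = ground (R / √3) := by
  have h : (0 : ℝ) ≤ 1 + R ^ 2 / 3 := by positivity
  rw [W, ground, Real.rpow_neg h, ← Real.sqrt_eq_rpow, div_pow, Real.sq_sqrt (by norm_num)]

theorem ground_le (x : ℝ) (hx : 0 ≤ x) : ground x ≤ 2 * (1 + x)⁻¹ := by
  have h : (0 : ℝ) < 1 + x := by positivity
  have h1 : (1 + x) / 2 ≤ √(1 + x ^ 2) := Real.le_sqrt_of_sq_le (by nlinarith [sq_nonneg (x - 1)])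
  calc ground x ≤ ((1 + x) / 2)⁻¹ := inv_anti₀ (by positivity) h1
    _ = _ := by field_simp

variable {n : ℕ}

theorem isSymbol_id : IsSymbol eulerField (Ioi 0) (fun x => x) n (fun x => x) := by
  induction n with
  | zero =>
    exact .zero_of (C := 1) contDiffOn_id (fun x hx => by simp [abs_of_pos (mem_Ioi.1 hx)])
      fun x hx => (mem_Ioi.1 hx).le
  | succ n ih =>
    exact .succ_eulerField isOpen_Ioi (h' := fun _ => 1) (C := 1) (fun x _ => hasDerivAt_id x)
      (fun x hx => by simp [abs_of_pos (mem_Ioi.1 hx)]) (fun x hx => (mem_Ioi.1 hx).le)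
      (fun x hx => (mem_Ioi.1 hx).ne') (by simpa using ih)

theorem isSymbol_inv : IsSymbol eulerField (Ioi 0) (fun x => x⁻¹) n (fun x => x⁻¹) :=
  isSymbol_id.inv isOpen_Ioi (fun _ hx => hx) one_pos (by simp)

/-- The Euler derivative of the ground state g is -x²g³ = (g² - 1) g, a polynomial in g itself, so
the induction on the order closes. -/
theorem isSymbol_ground :
    IsSymbol eulerField (Ioi 0) (fun x => (1 + x)⁻¹) n ground := by
  have hb : ∀ x ∈ Ioi (0 : ℝ), |ground x| ≤ 2 * (1 + x)⁻¹ := fun x hx => by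
    rw [abs_of_pos (ground_pos x)]; exact ground_le x (mem_Ioi.1 hx).le
  have hw : ∀ x ∈ Ioi (0 : ℝ), 0 ≤ (1 + x)⁻¹ := fun x hx => by
    have := mem_Ioi.1 hx; positivity
  induction n with
  | zero => exact .zero_of contDiff_ground.contDiffOn hb hw
  | succ n ih =>
    refine .succ_eulerField isOpen_Ioi (fun x _ => hasDerivAt_ground x) hb hw
      (fun x hx => (mem_Ioi.1 hx).ne') ?_
    have h2 : IsSymbol eulerField (Ioi 0) (fun _ => 1) n (fun x => ground x ^ 2) := by
      refine (ih.pow isOpen_Ioi 2).weight_le fun x hx => ?_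
      have := mem_Ioi.1 hx
      exact pow_le_one₀ (by positivity) (inv_le_one_of_one_le₀ (by linarith))
    refine (((h2.sub (.const 1) isOpen_Ioi).mul ih isOpen_Ioi).weight_le (by simp)).congr isOpen_Ioi
      fun x _ => ?_
    linear_combination (-ground x) * ground_sq x

theorem log_two_le {x : ℝ} (hx : 0 ≤ x) : (1 : ℝ) / 2 ≤ log (x + 2) :=
  (by linarith [Real.log_two_gt_d9] : (1 : ℝ) / 2 ≤ log 2).trans
    (Real.log_le_log (by norm_num) (by linarith))

theorem isSymbol_log :
    IsSymbol eulerField (Ioi 0) (fun x => log (x + 2)) n (fun x => log (1 + x ^ 2)) := by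
  have hb : ∀ x ∈ Ioi (0 : ℝ), |log (1 + x ^ 2)| ≤ 2 * log (x + 2) := fun x hx => by
    have hx := mem_Ioi.1 hx
    rw [abs_of_nonneg (Real.log_nonneg (by nlinarith)), ← Real.log_rpow (by linarith)]
    refine Real.log_le_log (by positivity) ?_
    norm_num
    nlinarith
  have hw : ∀ x ∈ Ioi (0 : ℝ), 0 ≤ log (x + 2) := fun x hx => by
    linarith [log_two_le (mem_Ioi.1 hx).le]
  have hd (x : ℝ) : HasDerivAt (fun x : ℝ => log (1 + x ^ 2)) (2 * x * ground x ^ 2) x := by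
    have h1 : HasDerivAt (fun x : ℝ => 1 + x ^ 2) (2 * x) x := by
      simpa using (hasDerivAt_pow 2 x).const_add 1
    have h : (0 : ℝ) < 1 + x ^ 2 := by positivity
    refine (h1.log h.ne').congr_deriv ?_
    have := ground_sq x
    field_simp
    linear_combination (-x) * this
  cases n with
  | zero => 
    refine .zero_of (fun x _ => ?_) hb hw
    exact (ContDiffAt.log (by fun_prop) (by positivity)).contDiffWithinAt
  | succ n =>
    refine .succ_eulerField isOpen_Ioi (fun x _ => hd x) hb hw (fun x hx => (mem_Ioi.1 hx).ne') ?_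
    have h1 := ((isSymbol_id (n := n)).pow isOpen_Ioi 2).mul (isSymbol_ground.pow isOpen_Ioi 2)
      isOpen_Ioi
    refine ((h1.const_mul isOpen_Ioi 2).weight (C := 2) (by norm_num) fun x hx => ?_).congr
      isOpen_Ioi fun x _ => by ring
    have hx := mem_Ioi.1 hx
    have h2 : x ^ 2 * (1 + x)⁻¹ ^ 2 ≤ 1 := by
      rw [← mul_pow]
      exact pow_le_one₀ (by positivity) (by rw [← div_eq_mul_inv, div_le_one (by positivity)]; linarith)
    linarith [log_two_le hx.le]

/-- The decay comes from π/2 - arctan x = arctan(1/x) ≤ 1/x, and the Euler derivative x/(1 + x²) is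
an explicit symbol of the same size. -/
theorem isSymbol_arctan :
    IsSymbol eulerField (Ioi 0) (fun x => x⁻¹) n (fun x => arctan x - π / 2) := by
  have hb : ∀ x ∈ Ioi (0 : ℝ), |arctan x - π / 2| ≤ 1 * x⁻¹ := fun x hx => by
    have hx := mem_Ioi.1 hx
    have h1 := Real.arctan_inv_of_pos hx
    have h2 : arctan x⁻¹ ≤ x⁻¹ := by
      have := Real.le_tan (Real.arctan_nonneg.2 (inv_pos.2 hx).le) (Real.arctan_lt_pi_div_two _)
      rwa [Real.tan_arctan] at this
    have h3 : 0 < arctan x⁻¹ := Real.arctan_pos.2 (by positivity)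
    rw [abs_sub_comm, ← h1, abs_of_pos h3, one_mul]
    exact h2
  have hw : ∀ x ∈ Ioi (0 : ℝ), 0 ≤ x⁻¹ := fun x hx => (inv_pos.2 (mem_Ioi.1 hx)).le
  cases n with
  | zero => exact .zero_of ((contDiff_arctan.sub contDiff_const).contDiffOn) hb hw
  | succ n =>
    refine .succ_eulerField isOpen_Ioi (fun x _ => ((hasDerivAt_arctan x).sub_const _)) hb hw
      (fun x hx => (mem_Ioi.1 hx).ne') ?_
    have h1 := (isSymbol_id (n := n)).mul (isSymbol_ground.pow isOpen_Ioi 2) isOpen_Ioi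
    refine (h1.weight_le fun x hx => ?_).congr isOpen_Ioi fun x _ => ?_
    · have hx := mem_Ioi.1 hx
      rw [inv_pow, ← div_eq_mul_inv, ← one_div, div_le_div_iff₀ (by positivity) hx]
      nlinarith
    · have := ground_sq x
      field_simp
      linear_combination (-x) * this

/-- `x (1 + x²)^{-1/2}` tends to one quadratically. -/
theorem isSymbol_one_sub :
    IsSymbol eulerField (Ioi 0) (fun x => (1 + x)⁻¹ ^ 2) n (fun x => 1 - x * ground x) := by
  have hw : ∀ x ∈ Ioi (0 : ℝ), 0 ≤ (1 + x)⁻¹ ^ 2 := fun x hx => by positivity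
  have hb : ∀ x ∈ Ioi (0 : ℝ), |1 - x * ground x| ≤ 4 * (1 + x)⁻¹ ^ 2 := fun x hx => by
    have hx := mem_Ioi.1 hx
    have h0 := mul_pos hx (ground_pos x)
    -- This factorization turns the a priori first-order closeness of xg to one into a quadratic
    -- one.
    have h1 : (1 - x * ground x) * (1 + x * ground x) = ground x ^ 2 := by
      linear_combination -ground_sq x
    have h2 : 0 ≤ 1 - x * ground x := by
      by_contra hcon
      push Not at hcon
      nlinarith [sq_nonneg (ground x)]
    rw [abs_of_nonneg h2]
    have h3 : ground x ^ 2 ≤ (2 * (1 + x)⁻¹) ^ 2 :=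
      pow_le_pow_left₀ (ground_pos x).le (ground_le x hx.le) 2
    nlinarith
  have hc : ContDiff ℝ ∞ (fun x => 1 - x * ground x) := by
    have := contDiff_ground (n := ∞)
    fun_prop
  cases n with
  | zero => exact .zero_of (hc.of_le (by simp)).contDiffOn hb hw
  | succ n =>
    refine .succ_eulerField isOpen_Ioi
      (fun x _ => (((hasDerivAt_id x).mul (hasDerivAt_ground x)).const_sub 1)) hb hw
      (fun x hx => (mem_Ioi.1 hx).ne') ?_
    have h1 := ((isSymbol_id (n := n)).mul isSymbol_ground isOpen_Ioi).mul
      (isSymbol_ground.pow isOpen_Ioi 2) isOpen_Ioi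
    refine ((h1.neg isOpen_Ioi).weight_le fun x hx => ?_).congr isOpen_Ioi fun x _ => ?_
    · have hx := mem_Ioi.1 hx
      refine mul_le_of_le_one_left (by positivity) ?_
      rw [← div_eq_mul_inv, div_le_one (by positivity)]; linarith
    · have := ground_sq x
      simp
      linear_combination (x * ground x) * this

/-- The smooth extension of `arctan x / x`. -/
def arctanQuot : ℝ → ℝ := dslope arctan 0

/-- Away from zero it is a quotient of smooth functions. At zero, shifting the power series of an
analytic function gives a power series for its difference quotient. -/
theorem contDiff_arctanQuot : ContDiff ℝ ∞ arctanQuot := by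
  rw [contDiff_iff_contDiffAt]
  intro x
  by_cases hx : x = 0
  · subst hx
    obtain ⟨p, hp⟩ := (contDiff_arctan (n := ω)).contDiffAt (x := 0) |>.analyticAt
    exact (hp.has_fpower_series_dslope_fslope.analyticAt).contDiffAt
  · have h1 : ContDiffAt ℝ ∞ (fun y => arctan y / y) x :=
      contDiff_arctan.contDiffAt.div contDiffAt_id hx
    refine h1.congr_of_eventuallyEq ?_
    filter_upwards [isOpen_ne.mem_nhds hx] with y hy
    rw [arctanQuot, dslope_of_ne _ hy]
    simp [slope, div_eq_inv_mul]

theorem arctanQuot_zero : arctanQuot 0 = 1 := by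
  simp [arctanQuot]

theorem arctanQuot_of_ne {x : ℝ} (hx : x ≠ 0) : arctanQuot x = arctan x / x := by
  rw [arctanQuot, dslope_of_ne _ hx]
  simp [slope, div_eq_inv_mul]

end Profiles

/-! ### Explicit solutions of the linearized profile equation -/

noncomputable section ProfileODE

/-- The solutions of the linearized profile equation that are used in the correction. -/
def profile (a c p₀ p₁ p₂ x : ℝ) : ℝ :=
  ground x ^ 3 * (a * (1 - x ^ 2) * log (1 + x ^ 2) +
    c * (1 - 6 * x ^ 2 + x ^ 4) * arctanQuot x + (p₀ + p₁ * x ^ 2 + p₂ * x ^ 4))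

variable {a c p₀ p₁ p₂ : ℝ} {n : ℕ}

theorem contDiff_profile : ContDiff ℝ ∞ (profile a c p₀ p₁ p₂) := by
  have h1 := contDiff_ground (n := ∞)
  have h2 := contDiff_arctanQuot
  have h3 : ContDiff ℝ ∞ (fun x : ℝ => log (1 + x ^ 2)) :=
    ContDiff.log (by fun_prop) fun x => by positivity
  unfold profile
  fun_prop

theorem profile_zero (h : c + p₀ = 0) : profile a c p₀ p₁ p₂ 0 = 0 := by
  simp [profile, arctanQuot_zero, h]

theorem hasDerivAt_ground_cube (x : ℝ) :
    HasDerivAt (fun x => ground x ^ 3) (-3 * x / (1 + x ^ 2) * ground x ^ 3) x := by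
  refine ((hasDerivAt_ground x).pow 3).congr_deriv ?_
  have h : (0 : ℝ) < 1 + x ^ 2 := by positivity
  have := ground_sq x
  field_simp
  norm_num
  linear_combination (3 * ground x ^ 3 * x) * this

/-- The functions (1 - x²)g³ and (x⁻¹ - 6x + x³)g³ solve the homogeneous equation. They are the
factors of the logarithm and the arctangent, so no such term survives in the source. The proof
writes the profile as g³M and differentiates M twice. -/
theorem profile_ode {x : ℝ} (hx : 0 < x) :
    deriv (deriv (profile a c p₀ p₁ p₂)) x + 2 / x * deriv (profile a c p₀ p₁ p₂) x +
      15 * ground x ^ 4 * profile a c p₀ p₁ p₂ x =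
    ground x ^ 3 / (1 + x ^ 2) ^ 2 * (a * (2 * x ^ 4 - 24 * x ^ 2 + 6) + 32 * c * (x ^ 2 - 1) +
      6 * (p₀ + p₁) * (1 + x ^ 2) + p₂ * (20 * x ^ 2 + 22 * x ^ 4 + 2 * x ^ 6)) := by
  set M : ℝ → ℝ := fun x => a * ((1 - x ^ 2) * log (1 + x ^ 2)) +
    c * ((x⁻¹ - 6 * x + x ^ 3) * arctan x) + (p₀ + p₁ * x ^ 2 + p₂ * x ^ 4) with hM
  set M₁ : ℝ → ℝ := fun x => a * (-2 * x * log (1 + x ^ 2) + (2 * x - 2 * x ^ 3) / (1 + x ^ 2)) +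
    c * ((-(x ^ 2)⁻¹ - 6 + 3 * x ^ 2) * arctan x + (x⁻¹ - 6 * x + x ^ 3) * (1 + x ^ 2)⁻¹) +
    (2 * p₁ * x + 4 * p₂ * x ^ 3) with hM₁
  set M₂ : ℝ → ℝ := fun x => a * (-2 * log (1 + x ^ 2) - 4 * x ^ 2 / (1 + x ^ 2) +
      ((2 - 6 * x ^ 2) * (1 + x ^ 2) - (2 * x - 2 * x ^ 3) * (2 * x)) / (1 + x ^ 2) ^ 2) +
    c * ((2 / x ^ 3 + 6 * x) * arctan x + 2 * ((-(x ^ 2)⁻¹ - 6 + 3 * x ^ 2) * (1 + x ^ 2)⁻¹) -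
      (x⁻¹ - 6 * x + x ^ 3) * (2 * x / (1 + x ^ 2) ^ 2)) + (2 * p₁ + 12 * p₂ * x ^ 2) with hM₂
  have hu (x : ℝ) : HasDerivAt (fun x : ℝ => 1 + x ^ 2) (2 * x) x := by
    simpa using (hasDerivAt_pow 2 x).const_add 1
  have hu0 (x : ℝ) : 1 + x ^ 2 ≠ 0 := by positivity
  have hL (x : ℝ) : HasDerivAt (fun x : ℝ => log (1 + x ^ 2)) (2 * x / (1 + x ^ 2)) x :=
    (hu x).log (hu0 x)
  have hT := hasDerivAt_arctan'
  have hp (k : ℕ) (x : ℝ) := hasDerivAt_pow k x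
  have dM : ∀ y, 0 < y → HasDerivAt M (M₁ y) y := by
    intro y hy
    refine ((((((hp 2 y).const_sub 1).mul (hL y)).const_mul a).add
      (((((hasDerivAt_inv hy.ne').sub ((hasDerivAt_id y).const_mul 6)).add (hp 3 y)).mul
        (hT y)).const_mul c)).add ((((hp 2 y).const_mul p₁).const_add p₀).add
        ((hp 4 y).const_mul p₂))).congr_deriv ?_
    simp only [hM₁, Pi.add_apply, Pi.sub_apply, id_eq]
    have := hu0 y
    field_simp
    norm_num
    ring
  have dM₁ : ∀ y, 0 < y → HasDerivAt M₁ (M₂ y) y := by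
    intro y hy
    refine (((((((hasDerivAt_id y).const_mul (-2)).mul (hL y)).add
      ((((hasDerivAt_id y).const_mul 2).sub ((hp 3 y).const_mul 2)).div (hu y) (hu0 y))).const_mul
        a).add (((((((hp 2 y).inv (pow_pos hy 2).ne').neg.sub_const 6).add
        ((hp 2 y).const_mul 3)).mul (hT y)).add
        ((((hasDerivAt_inv hy.ne').sub ((hasDerivAt_id y).const_mul 6)).add (hp 3 y)).mul
        ((hu y).inv (hu0 y)))).const_mul c)).add
        (((hasDerivAt_id y).const_mul (2 * p₁)).add ((hp 3 y).const_mul (4 * p₂)))).congr_deriv ?_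
    simp only [hM₂, Pi.add_apply, Pi.sub_apply, Pi.inv_apply, Pi.neg_apply, id_eq]
    have := hu0 y
    field_simp
    norm_num
    ring
  have e0 : ∀ y, 0 < y → profile a c p₀ p₁ p₂ y = ground y ^ 3 * M y := by
    intro y hy
    rw [profile, arctanQuot_of_ne hy.ne', hM]
    field_simp
  have d1 : ∀ y, 0 < y → HasDerivAt (profile a c p₀ p₁ p₂)
      (ground y ^ 3 * (M₁ y - 3 * y / (1 + y ^ 2) * M y)) y := by
    intro y hy
    refine (((hasDerivAt_ground_cube y).mul (dM y hy)).congr_of_eventuallyEq ?_).congr_deriv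
      (by ring)
    filter_upwards [lt_mem_nhds hy] with z hz using e0 z hz
  have d2 : HasDerivAt (deriv (profile a c p₀ p₁ p₂))
      (-3 * x / (1 + x ^ 2) * ground x ^ 3 * (M₁ x - 3 * x / (1 + x ^ 2) * M x) +
        ground x ^ 3 * (M₂ x - ((3 * (1 + x ^ 2) - 3 * x * (2 * x)) / (1 + x ^ 2) ^ 2 * M x +
          3 * x / (1 + x ^ 2) * M₁ x))) x := by
    have h3 : HasDerivAt (fun x : ℝ => 3 * x / (1 + x ^ 2))
        ((3 * (1 + x ^ 2) - 3 * x * (2 * x)) / (1 + x ^ 2) ^ 2) x := by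
      exact (((hasDerivAt_id x).const_mul 3).div (hu x) (hu0 x)).congr_deriv (by simp)
    refine ((hasDerivAt_ground_cube x).mul
      ((dM₁ x hx).sub (h3.mul (dM x hx)))).congr_of_eventuallyEq ?_
    filter_upwards [lt_mem_nhds hx] with z hz using (d1 z hz).deriv
  have hg : ground x ^ 4 = ((1 + x ^ 2) ^ 2)⁻¹ := by
    have := hu0 x
    field_simp
    linear_combination (ground x ^ 2 * (1 + x ^ 2) + 1) * ground_sq x
  rw [d2.deriv, (d1 x hx).deriv, e0 x hx, hg]
  simp only [hM₂, hM₁, hM]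
  have := hu0 x
  field_simp
  ring

/-- The weight `log (x + 2) / (x + 1)`. -/
def logWeight (x : ℝ) : ℝ := log (x + 2) / (x + 1)

/-- Since xg = 1 + O(x⁻²), the quartic polynomial term contributes p₂x and the arctangent term
contributes cπ/2. The logarithm is multiplied by (1 - x²)g³ = O(1/x), which dictates the weight
log(x + 2)/(x + 1). -/
theorem isSymbol_profile_sub_Ioi :
    IsSymbol eulerField (Ioi 1) logWeight n
      (fun x => profile a c p₀ p₁ p₂ x - (p₂ * x + c * (π / 2))) := by
  have hO : IsOpen (Ioi (1 : ℝ)) := isOpen_Ioi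
  have hsub : Ioi (1 : ℝ) ⊆ Ioi 0 := Ioi_subset_Ioi zero_le_one
  have hv : IsSymbol eulerField (Ioi 1) (fun x => x⁻¹) n ground :=
    (isSymbol_ground.mono hsub).weight_le fun x hx => by
      have := mem_Ioi.1 hx
      exact inv_anti₀ (by linarith) (by linarith)
  have hi : IsSymbol eulerField (Ioi 1) (fun x => x⁻¹) n (fun x => x⁻¹) := isSymbol_inv.mono hsub
  have hx : IsSymbol eulerField (Ioi 1) (fun x => x) n (fun x => x) := isSymbol_id.mono hsub
  have he1 : IsSymbol eulerField (Ioi 1) (fun x => x⁻¹ ^ 2) n (fun x => 1 - x * ground x) :=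
    (isSymbol_one_sub.mono hsub).weight_le fun x hx => by
      have := mem_Ioi.1 hx
      exact pow_le_pow_left₀ (by positivity) (inv_anti₀ (by linarith) (by linarith)) 2
  have he : IsSymbol eulerField (Ioi 1) (fun _ => 1) n (fun x => x * ground x) :=
    (hx.mul hv hO).weight_le fun x hx => by
      have := mem_Ioi.1 hx
      rw [mul_inv_cancel₀ (by linarith)]
  have hL := (isSymbol_log (n := n)).mono hsub
  have hT := (isSymbol_arctan (n := n)).mono hsub
  have hb : ∀ x ∈ Ioi (1 : ℝ), x⁻¹ ≤ 4 * logWeight x := fun x hx => by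
    have hx := mem_Ioi.1 hx
    rw [logWeight, ← one_div, ← mul_div_assoc, div_le_div_iff₀ (by linarith) (by linarith)]
    nlinarith [log_two_le (show 0 ≤ x by linarith)]
  have hb2 : ∀ x ∈ Ioi (1 : ℝ), x⁻¹ ^ 2 ≤ 4 * logWeight x := fun x hx => by
    have hx' := mem_Ioi.1 hx
    refine le_trans ?_ (hb x hx)
    rw [sq]
    exact mul_le_of_le_one_left (by positivity) (inv_le_one_of_one_le₀ hx'.le)
  have hxv : IsSymbol eulerField (Ioi 1) (fun x => x⁻¹) n (fun x => (x * ground x) ^ 2 * ground x) :=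
    ((he.pow hO 2).mul hv hO).weight_le (by simp)
  have hv3 : IsSymbol eulerField (Ioi 1) (fun x => x⁻¹) n (fun x => ground x ^ 3) :=
    (hv.pow hO 3).weight_le fun x hx => by
      have hx := mem_Ioi.1 hx
      exact pow_le_of_le_one (by positivity) (inv_le_one_of_one_le₀ hx.le) (by norm_num)
  have hN : IsSymbol eulerField (Ioi 1) (fun _ => 1) n (fun x => ground x ^ 3 * x⁻¹ -
      6 * (x * ground x * ground x ^ 2) + (x * ground x) ^ 3) := by
    refine IsSymbol.add (.sub ((hv3.mul hi hO).weight_le fun x hx => ?_)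
      (((he.mul (hv.pow hO 2) hO).weight_le fun x hx => ?_).const_mul hO 6) hO)
      ((he.pow hO 3).weight_le (by simp)) hO
    · have hx := mem_Ioi.1 hx
      exact mul_le_one₀ (inv_le_one_of_one_le₀ hx.le) (by positivity) (inv_le_one_of_one_le₀ hx.le)
    · have hx := mem_Ioi.1 hx
      rw [one_mul]
      exact pow_le_one₀ (by positivity) (inv_le_one_of_one_le₀ hx.le)
  have hce : IsSymbol eulerField (Ioi 1) (fun x => x⁻¹ ^ 2) n (fun x => (x * ground x) ^ 3 - 1) := by
    refine ((he1.mul (IsSymbol.add (w := fun _ => 1) ((he.pow hO 2).weight_le (by simp))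
      (he.add (.const 1) hO) hO) hO).neg hO).weight_le (by simp) |>.congr hO fun x _ => ?_
    ring
  have t1 := ((hv3.sub hxv hO).mul hL hO).const_mul hO a |>.weight_le (w₂ := fun x => 2 * logWeight x)
    fun x hx => by
      have hx := mem_Ioi.1 hx
      rw [logWeight, ← mul_div_assoc, ← div_eq_inv_mul, div_le_div_iff₀ (by linarith) (by linarith)]
      nlinarith [log_two_le (show 0 ≤ x by linarith)]
  have t2 := (hN.mul hT hO).const_mul hO c |>.weight (w₂ := logWeight) (C := 4) (by norm_num)
    (by simpa using hb)
  have t3 : IsSymbol eulerField (Ioi 1) logWeight n (fun x => ground x ^ 3 * x⁻¹ -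
      6 * (x * ground x * ground x ^ 2) + ((x * ground x) ^ 3 - 1)) := by
    refine IsSymbol.weight (w₁ := fun x => x⁻¹ ^ 2) ?_ (by norm_num) hb2
    refine IsSymbol.add (.sub ((hv3.mul hi hO).weight_le fun x hx => (sq _).ge)
      (((he.mul (hv.pow hO 2) hO).weight_le fun x hx => by simp).const_mul hO 6) hO) hce hO
  have t4 : IsSymbol eulerField (Ioi 1) logWeight n (fun x => p₀ * ground x ^ 3 +
      p₁ * ((x * ground x) ^ 2 * ground x) + p₂ * (x * ((x * ground x) ^ 3 - 1))) := by
    refine IsSymbol.weight (w₁ := fun x => x⁻¹) ?_ (by norm_num) hb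
    refine ((hv3.const_mul hO _).add (hxv.const_mul hO _) hO).add
      (((hx.mul hce hO).weight_le fun x hx => ?_).const_mul hO _) hO
    have hx := mem_Ioi.1 hx
    apply le_of_eq
    field_simp
  refine ((((t1.weight (w₂ := logWeight) (C := 2) (by norm_num) fun x _ => le_rfl).add t2 hO).add
    (t3.const_mul hO (c * (π / 2))) hO).add t4 hO).congr hO fun x hx => ?_
  have hx := mem_Ioi.1 hx
  have hx0 : x ≠ 0 := by positivity
  simp only [profile, arctanQuot_of_ne hx0]
  field_simp
  ring

theorem isSymbol_profile_sub :
    IsSymbol eulerField (Ioi 0) logWeight n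
      (fun x => profile a c p₀ p₁ p₂ x - (p₂ * x + c * (π / 2))) := by
  have hw : ∀ x ∈ Ioi (0 : ℝ), 0 ≤ logWeight x := fun x hx => by
    have hx := mem_Ioi.1 hx
    exact div_nonneg (by linarith [log_two_le hx.le]) (by linarith)
  have hU : Ioo (0 : ℝ) 2 ∪ Ioi 1 = Ioi 0 := by ext x; grind
  rw [← hU] at hw ⊢
  refine IsSymbol.union ?_ isSymbol_profile_sub_Ioi isOpen_Ioo isOpen_Ioi hw
  have h1 : ContDiff ℝ ∞ (fun x => profile a c p₀ p₁ p₂ x - (p₂ * x + c * (π / 2))) := by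
    have := contDiff_profile (a := a) (c := c) (p₀ := p₀) (p₁ := p₁) (p₂ := p₂)
    fun_prop
  -- On (0, 2) the logarithm is at least 1/2 and the denominator at most 3, hence the factor 6.
  refine (IsSymbol.of_contDiff_eulerField h1 0 2).weight (C := 6) (by norm_num) fun x hx => ?_
  rw [logWeight, ← mul_div_assoc, le_div_iff₀ (by linarith [hx.1])]
  linarith [log_two_le hx.1.le, hx.2]

/-- The condition makes the profile vanish at the origin, so near zero it is O(x) by the mean value
inequality. For large x it is dominated by its linear growth. -/
theorem isSymbol_profile (h : c + p₀ = 0) :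
    IsSymbol eulerField (Ioi 0) (fun x => x) n (profile a c p₀ p₁ p₂) := by
  have hU : Ioo (0 : ℝ) 2 ∪ Ioi 1 = Ioi 0 := by ext x; grind
  have hw : ∀ x ∈ Ioi (0 : ℝ), 0 ≤ x := fun x hx => (mem_Ioi.1 hx).le
  have hx := isSymbol_id (n := n)
  rw [← hU] at hw hx ⊢
  refine IsSymbol.union ?_ ?_ isOpen_Ioo isOpen_Ioi hw
  · have h1 := contDiff_profile (a := a) (c := c) (p₀ := p₀) (p₁ := p₁) (p₂ := p₂)
    have h2 := (contDiff_infty_iff_deriv.1 h1).2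
    obtain ⟨C, hC⟩ := (isCompact_Icc (a := (0 : ℝ)) (b := 2)).exists_bound_of_continuousOn
      h2.continuous.continuousOn
    have hb : ∀ x ∈ Ioo (0 : ℝ) 2, |profile a c p₀ p₁ p₂ x| ≤ C * x := fun x hx => by
      have := (convex_Icc (0 : ℝ) 2).norm_image_sub_le_of_norm_hasDerivWithin_le
        (fun y _ => ((contDiff_infty_iff_deriv.1 h1).1 y).hasDerivAt.hasDerivWithinAt)
        hC (x := 0) (by simp) (Ioo_subset_Icc_self hx)
      simpa [profile_zero h, abs_of_pos hx.1] using this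
    cases n with
    | zero => exact .zero_of (h1.of_le (by simp)).contDiffOn hb fun x hx => hx.1.le
    | succ n =>
      refine .succ_eulerField isOpen_Ioo
        (fun x _ => ((contDiff_infty_iff_deriv.1 h1).1 x).hasDerivAt) hb
        (fun x hx => hx.1.le) (fun x hx => hx.1.ne') ?_
      exact ((hx.of_succ.mono subset_union_left).mul (IsSymbol.of_contDiff_eulerField h2 0 2)
        isOpen_Ioo).weight_le (by simp)
  · have hO : IsOpen (Ioi (1 : ℝ)) := isOpen_Ioi
    have h1 := hx.mono subset_union_right
    have h2 := isSymbol_profile_sub_Ioi (a := a) (c := c) (p₀ := p₀) (p₁ := p₁) (p₂ := p₂) (n := n)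
    refine ((h2.weight_le fun x hx => ?_).add ((h1.const_mul hO p₂).add
      (((IsSymbol.const (c * (π / 2))).weight_le fun x hx => (mem_Ioi.1 hx).le)) hO) hO).congr hO
      fun x _ => by ring
    have hx := mem_Ioi.1 hx
    rw [logWeight, div_le_iff₀ (by linarith)]
    nlinarith [Real.log_le_sub_one_of_pos (show 0 < x + 2 by linarith)]

/-- `F` solves the linearized profile equation with source `s`, is smooth and vanishes at the
origin, and is `β x + γ` up to a decaying error. -/
structure IsProfile (s F : ℝ → ℝ) (β γ : ℝ) : Prop where
  contDiff : ContDiff ℝ ∞ F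
  isSymbol : ∀ n, IsSymbol eulerField (Ioi 0) (fun x => x) n F
  isSymbol_sub : ∀ n, IsSymbol eulerField (Ioi 0) logWeight n (fun x => F x - (β * x + γ))
  ode : ∀ x, 0 < x → deriv (deriv F) x + 2 / x * deriv F x + 15 * ground x ^ 4 * F x = 3 * s x

/-- `(1/2 + x d/dx)` applied to the ground state. -/
def source₁ (x : ℝ) : ℝ := 1 / 2 * (1 - x ^ 2) * ground x ^ 3

/-- `(1/2 + x d/dx)²` applied to the ground state. -/
def source₂ (x : ℝ) : ℝ := 1 / 4 * (1 - 10 * x ^ 2 + x ^ 4) * ground x ^ 5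

theorem exists_isProfile₁ : ∃ F β γ, IsProfile source₁ F β γ := by
  -- The source must equal (3/2)(1 - x²)(1 + x²)² times g³/(1 + x²)². Comparing coefficients of x⁶
  -- and x⁴ gives p₂ and then a; those of x² and 1 give c and p₀ + p₁; vanishing at the origin fixes
  -- p₀ = -c.
  refine ⟨profile (15 / 2) (15 / 4) (-15 / 4) (33 / 2) (-3 / 4), _, _, contDiff_profile,
    fun n => isSymbol_profile (by norm_num), fun n => isSymbol_profile_sub, fun x hx => ?_⟩
  rw [profile_ode hx, source₁]
  have h : (0 : ℝ) < 1 + x ^ 2 := by positivity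
  field_simp
  ring

theorem exists_isProfile₂ : ∃ F β γ, IsProfile source₂ F β γ := by
  -- The same linear system, now with the polynomial (3/4)(1 - 10x² + x⁴)(1 + x²).
  refine ⟨profile (-15 / 2) (-15 / 4) (15 / 4) (-129 / 8) (3 / 8), _, _, contDiff_profile,
    fun n => isSymbol_profile (by norm_num), fun n => isSymbol_profile_sub, fun x hx => ?_⟩
  have h : (0 : ℝ) < 1 + x ^ 2 := by positivity
  have h5 : ground x ^ 5 = ground x ^ 3 / (1 + x ^ 2) := by
    rw [eq_div_iff h.ne']
    linear_combination ground x ^ 3 * ground_sq x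
  rw [profile_ode hx, source₂, h5]
  field_simp
  ring

end ProfileODE

/-! ### Partial derivatives and symbols in the (t, r)-plane -/

noncomputable section Plane

/-- The vector fields `t ∂_t` and `r ∂_r`. -/
def coneField : Bool → (ℝ × ℝ →L[ℝ] ℝ × ℝ)
  | false => (ContinuousLinearMap.inl ℝ ℝ ℝ).comp (ContinuousLinearMap.fst ℝ ℝ ℝ)
  | true => (ContinuousLinearMap.inr ℝ ℝ ℝ).comp (ContinuousLinearMap.snd ℝ ℝ ℝ)

/-- The partial derivative in the first variable. -/
def dt (f : ℝ × ℝ → ℝ) (p : ℝ × ℝ) : ℝ := fderiv ℝ f p (1, 0)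

/-- The partial derivative in the second variable. -/
def dr (f : ℝ × ℝ → ℝ) (p : ℝ × ℝ) : ℝ := fderiv ℝ f p (0, 1)

/-- The open first quadrant. -/
def quadrant : Set (ℝ × ℝ) := {p | 0 < p.1 ∧ 0 < p.2}

theorem isOpen_quadrant : IsOpen quadrant :=
  (isOpen_lt continuous_const continuous_fst).inter (isOpen_lt continuous_const continuous_snd)

variable {S : Set (ℝ × ℝ)} {w : ℝ × ℝ → ℝ} {n k j : ℕ} {f g : ℝ × ℝ → ℝ} {t r : ℝ}

theorem lieD_false (f : ℝ × ℝ → ℝ) (p : ℝ × ℝ) : lieD (coneField false) f p = p.1 * dt f p := by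
  have : coneField false p = p.1 • ((1, 0) : ℝ × ℝ) := by ext <;> simp [coneField]
  rw [lieD, this, map_smul, dt, smul_eq_mul]

theorem lieD_true (f : ℝ × ℝ → ℝ) (p : ℝ × ℝ) : lieD (coneField true) f p = p.2 * dr f p := by
  have : coneField true p = p.2 • ((0, 1) : ℝ × ℝ) := by ext <;> simp [coneField]
  rw [lieD, this, map_smul, dr, smul_eq_mul]

theorem hasDerivAt_fst (h : DifferentiableAt ℝ f (t, r)) :
    HasDerivAt (fun s => f (s, r)) (dt f (t, r)) t :=
  h.hasFDerivAt.comp_hasDerivAt t ((hasDerivAt_id t).prodMk (hasDerivAt_const t r))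

theorem hasDerivAt_snd (h : DifferentiableAt ℝ f (t, r)) :
    HasDerivAt (fun ρ => f (t, ρ)) (dr f (t, r)) r :=
  h.hasFDerivAt.comp_hasDerivAt r ((hasDerivAt_const r t).prodMk (hasDerivAt_id r))

theorem contDiffOn_dt (hS : IsOpen S) (hf : ContDiffOn ℝ (n + 1 : ℕ) f S) :
    ContDiffOn ℝ n (dt f) S :=
  (hf.fderiv_of_isOpen hS (m := n) (by simp)).clm_apply contDiffOn_const

theorem contDiffOn_dr (hS : IsOpen S) (hf : ContDiffOn ℝ (n + 1 : ℕ) f S) :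
    ContDiffOn ℝ n (dr f) S :=
  (hf.fderiv_of_isOpen hS (m := n) (by simp)).clm_apply contDiffOn_const

theorem contDiffOn_iterate_dt (hS : IsOpen S) (hf : ContDiffOn ℝ (n + k : ℕ) f S) :
    ContDiffOn ℝ n (dt^[k] f) S := by
  induction k generalizing f with
  | zero => simpa using hf
  | succ k ih => exact ih (contDiffOn_dt hS hf)

theorem contDiffOn_iterate_dr (hS : IsOpen S) (hf : ContDiffOn ℝ (n + k : ℕ) f S) :
    ContDiffOn ℝ n (dr^[k] f) S := by
  induction k generalizing f with
  | zero => simpa using hf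
  | succ k ih => exact ih (contDiffOn_dr hS hf)

theorem iteratedDeriv_snd (hS : IsOpen S) (hf : ContDiffOn ℝ j f S) (h : (t, r) ∈ S) :
    iteratedDeriv j (fun ρ => f (t, ρ)) r = (dr^[j] f) (t, r) := by
  induction j generalizing r with
  | zero => simp
  | succ j ih =>
    have h1 : ∀ᶠ ρ in nhds r, (t, ρ) ∈ S :=
      (Continuous.prodMk_right t).continuousAt.eventually_mem (hS.mem_nhds h)
    rw [iteratedDeriv_succ, Function.iterate_succ_apply']
    have h2 : iteratedDeriv j (fun ρ => f (t, ρ)) =ᶠ[nhds r] fun ρ => (dr^[j] f) (t, ρ) := by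
      filter_upwards [h1] with ρ hρ using ih (hf.of_le (by exact_mod_cast Nat.le_succ j)) hρ
    rw [h2.deriv_eq]
    have h3 : ContDiffOn ℝ (1 : ℕ) (dr^[j] f) S :=
      contDiffOn_iterate_dr hS (by rwa [add_comm])
    exact (hasDerivAt_snd ((h3.contDiffAt (hS.mem_nhds h)).differentiableAt (by simp))).deriv

theorem iteratedDeriv_fst (hS : IsOpen S) (hf : ContDiffOn ℝ k f S) (h : (t, r) ∈ S) :
    iteratedDeriv k (fun s => f (s, r)) t = (dt^[k] f) (t, r) := by
  induction k generalizing t with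
  | zero => simp
  | succ k ih =>
    have h1 : ∀ᶠ s in nhds t, (s, r) ∈ S :=
      (Continuous.prodMk_left r).continuousAt.eventually_mem (hS.mem_nhds h)
    rw [iteratedDeriv_succ, Function.iterate_succ_apply']
    have h2 : iteratedDeriv k (fun s => f (s, r)) =ᶠ[nhds t] fun s => (dt^[k] f) (s, r) := by
      filter_upwards [h1] with s hs using ih (hf.of_le (by exact_mod_cast Nat.le_succ k)) hs
    rw [h2.deriv_eq]
    have h3 : ContDiffOn ℝ (1 : ℕ) (dt^[k] f) S :=
      contDiffOn_iterate_dt hS (by rwa [add_comm])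
    exact (hasDerivAt_fst ((h3.contDiffAt (hS.mem_nhds h)).differentiableAt (by simp))).deriv

/-- Bridge between iterated one-variable derivatives and iterated Fréchet partials. On an open set
the identity for the r-derivatives holds at all nearby times, so it may be differentiated in t. -/
theorem pderiv_eq_iterate (hS : IsOpen S) (hf : ContDiffOn ℝ (k + j : ℕ) f S) (h : (t, r) ∈ S) :
    pderiv k j (fun s ρ => f (s, ρ)) t r = (dt^[k] (dr^[j] f)) (t, r) := by
  have h1 : ∀ᶠ s in nhds t, (s, r) ∈ S :=
    (Continuous.prodMk_left r).continuousAt.eventually_mem (hS.mem_nhds h)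
  have h2 : (fun s => iteratedDeriv j (fun ρ => f (s, ρ)) r) =ᶠ[nhds t]
      fun s => (dr^[j] f) (s, r) := by
    filter_upwards [h1] with s hs
    exact iteratedDeriv_snd hS (hf.of_le (by exact_mod_cast Nat.le_add_left j k)) hs
  rw [pderiv, h2.iteratedDeriv_eq]
  exact iteratedDeriv_fst hS (contDiffOn_iterate_dr hS hf) h

theorem dt_congr (hS : IsOpen S) (hfg : EqOn f g S) : EqOn (dt f) (dt g) S := fun p hp => by
  have : f =ᶠ[nhds p] g := Filter.eventuallyEq_of_mem (hS.mem_nhds hp) hfg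
  simp [dt, this.fderiv_eq]

theorem dr_congr (hS : IsOpen S) (hfg : EqOn f g S) : EqOn (dr f) (dr g) S := fun p hp => by
  have : f =ᶠ[nhds p] g := Filter.eventuallyEq_of_mem (hS.mem_nhds hp) hfg
  simp [dr, this.fderiv_eq]

theorem iterate_dt_add (hS : IsOpen S) (hf : ContDiffOn ℝ k f S) (hg : ContDiffOn ℝ k g S) :
    EqOn (dt^[k] (fun p => f p + g p)) (fun p => (dt^[k] f) p + (dt^[k] g) p) S := by
  induction k with
  | zero => intro p _; rfl
  | succ k ih =>
    have hk : ((k : ℕ) : WithTop ℕ∞) ≤ ((k + 1 : ℕ) : WithTop ℕ∞) := by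
      exact_mod_cast Nat.le_succ k
    intro p hp
    have h1 : ContDiffOn ℝ (1 : ℕ) (dt^[k] f) S := contDiffOn_iterate_dt hS (by rwa [add_comm])
    have h2 : ContDiffOn ℝ (1 : ℕ) (dt^[k] g) S := contDiffOn_iterate_dt hS (by rwa [add_comm])
    simp only [Function.iterate_succ_apply']
    rw [dt_congr hS (ih (hf.of_le hk) (hg.of_le hk)) hp]
    simp [dt, fderiv_fun_add ((h1.contDiffAt (hS.mem_nhds hp)).differentiableAt (by simp))
      ((h2.contDiffAt (hS.mem_nhds hp)).differentiableAt (by simp))]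

theorem iterate_dr_add (hS : IsOpen S) (hf : ContDiffOn ℝ k f S) (hg : ContDiffOn ℝ k g S) :
    EqOn (dr^[k] (fun p => f p + g p)) (fun p => (dr^[k] f) p + (dr^[k] g) p) S := by
  induction k with
  | zero => intro p _; rfl
  | succ k ih =>
    have hk : ((k : ℕ) : WithTop ℕ∞) ≤ ((k + 1 : ℕ) : WithTop ℕ∞) := by
      exact_mod_cast Nat.le_succ k
    intro p hp
    have h1 : ContDiffOn ℝ (1 : ℕ) (dr^[k] f) S := contDiffOn_iterate_dr hS (by rwa [add_comm])
    have h2 : ContDiffOn ℝ (1 : ℕ) (dr^[k] g) S := contDiffOn_iterate_dr hS (by rwa [add_comm])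
    simp only [Function.iterate_succ_apply']
    rw [dr_congr hS (ih (hf.of_le hk) (hg.of_le hk)) hp]
    simp [dr, fderiv_fun_add ((h1.contDiffAt (hS.mem_nhds hp)).differentiableAt (by simp))
      ((h2.contDiffAt (hS.mem_nhds hp)).differentiableAt (by simp))]

theorem iterate_dt_congr (hS : IsOpen S) (hfg : EqOn f g S) : EqOn (dt^[k] f) (dt^[k] g) S := by
  induction k generalizing f g with
  | zero => exact hfg
  | succ k ih => exact ih (dt_congr hS hfg)

theorem pderiv_add (hS : IsOpen S) (hf : ContDiffOn ℝ (k + j : ℕ) f S)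
    (hg : ContDiffOn ℝ (k + j : ℕ) g S) (h : (t, r) ∈ S) :
    pderiv k j (fun s ρ => f (s, ρ) + g (s, ρ)) t r =
      pderiv k j (fun s ρ => f (s, ρ)) t r + pderiv k j (fun s ρ => g (s, ρ)) t r := by
  have hj : ((j : ℕ) : WithTop ℕ∞) ≤ ((k + j : ℕ) : WithTop ℕ∞) := by
    exact_mod_cast Nat.le_add_left j k
  rw [pderiv_eq_iterate hS hf h, pderiv_eq_iterate hS hg h,
    pderiv_eq_iterate (f := fun p => f p + g p) hS (hf.add hg) h,
    iterate_dt_congr hS (iterate_dr_add hS (hf.of_le hj) (hg.of_le hj)) h,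
    iterate_dt_add hS (contDiffOn_iterate_dr hS hf) (contDiffOn_iterate_dr hS hg) h]

theorem pderiv_congr {u v : ℝ → ℝ → ℝ} (hS : IsOpen S)
    (huv : ∀ t r, (t, r) ∈ S → u t r = v t r) (h : (t, r) ∈ S) :
    pderiv k j u t r = pderiv k j v t r := by
  have h1 : ∀ᶠ s in nhds t, (s, r) ∈ S :=
    (Continuous.prodMk_left r).continuousAt.eventually_mem (hS.mem_nhds h)
  refine Filter.EventuallyEq.iteratedDeriv_eq k ?_
  filter_upwards [h1] with s hs
  refine Filter.EventuallyEq.iteratedDeriv_eq j ?_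
  have h2 : ∀ᶠ ρ in nhds r, (s, ρ) ∈ S :=
    (Continuous.prodMk_right s).continuousAt.eventually_mem (hS.mem_nhds hs)
  filter_upwards [h2] with ρ hρ using huv s ρ hρ

theorem isSymbol_comp_fst {m h : ℝ → ℝ} (hh : IsSymbol eulerField (Ioi 0) m n h) :
    IsSymbol coneField quadrant (fun p => m p.1) n (fun p => h p.1) := by
  refine hh.comp (c := fun i _ => if i then 0 else 1) isOpen_Ioi isOpen_quadrant contDiff_fst.contDiffOn
    (fun p hp => hp.1) (fun i => .const _) fun i p hp => ?_
  cases i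
  · rw [lieD_false]; simp [dt, fderiv_fst]
  · rw [lieD_true]; simp [dr, fderiv_fst]

theorem isSymbol_comp_snd {m h : ℝ → ℝ} (hh : IsSymbol eulerField (Ioi 0) m n h) :
    IsSymbol coneField quadrant (fun p => m p.2) n (fun p => h p.2) := by
  refine hh.comp (c := fun i _ => if i then 1 else 0) isOpen_Ioi isOpen_quadrant contDiff_snd.contDiffOn
    (fun p hp => hp.2) (fun i => .const _) fun i p hp => ?_
  cases i
  · rw [lieD_false]; simp [dt, fderiv_snd]
  · rw [lieD_true]; simp [dr, fderiv_snd]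

theorem isSymbol_fst : IsSymbol coneField quadrant (fun p => p.1) n (fun p => p.1) :=
  isSymbol_comp_fst isSymbol_id

theorem isSymbol_snd : IsSymbol coneField quadrant (fun p => p.2) n (fun p => p.2) :=
  isSymbol_comp_snd isSymbol_id

theorem IsSymbol.dt (hf : IsSymbol coneField S w (n + 1) f) (hS : IsOpen S) (hQ : S ⊆ quadrant) :
    IsSymbol coneField S (fun p => p.1⁻¹ * w p) n (dt f) := by
  refine (((isSymbol_comp_fst isSymbol_inv).mono hQ).mul (hf.lieD false) hS).congr hS fun p hp => ?_
  have := (hQ hp).1.ne'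
  simp only [lieD_false]
  field_simp

theorem IsSymbol.dr (hf : IsSymbol coneField S w (n + 1) f) (hS : IsOpen S) (hQ : S ⊆ quadrant) :
    IsSymbol coneField S (fun p => p.2⁻¹ * w p) n (dr f) := by
  refine (((isSymbol_comp_snd isSymbol_inv).mono hQ).mul (hf.lieD true) hS).congr hS fun p hp => ?_
  have := (hQ hp).2.ne'
  simp only [lieD_true]
  field_simp

theorem IsSymbol.iterate_dt (hf : IsSymbol coneField S w (n + k) f) (hS : IsOpen S)
    (hQ : S ⊆ quadrant) : IsSymbol coneField S (fun p => (p.1 ^ k)⁻¹ * w p) n (QuinticWave.dt^[k] f) := by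
  induction k generalizing f w with
  | zero => simpa using hf
  | succ k ih =>
    refine (ih (hf.dt hS hQ)).weight_le fun p _ => le_of_eq ?_
    rw [pow_succ, mul_inv]; ring

theorem IsSymbol.iterate_dr (hf : IsSymbol coneField S w (n + k) f) (hS : IsOpen S)
    (hQ : S ⊆ quadrant) : IsSymbol coneField S (fun p => (p.2 ^ k)⁻¹ * w p) n (QuinticWave.dr^[k] f) := by
  induction k generalizing f w with
  | zero => simpa using hf
  | succ k ih =>
    refine (ih (hf.dr hS hQ)).weight_le fun p _ => le_of_eq ?_
    rw [pow_succ, mul_inv]; ring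

/-- Since ∂_t = t⁻¹(t∂_t) and ∂_r = r⁻¹(r∂_r), each derivative of a symbol costs one such factor.
All stated derivative bounds are read off from this. -/
theorem IsSymbol.pderiv_bound (hf : IsSymbol coneField S w (k + j) f) (hS : IsOpen S)
    (hQ : S ⊆ quadrant) : ∃ C, 0 ≤ C ∧ ∀ t r, (t, r) ∈ S →
      |pderiv k j (fun s ρ => f (s, ρ)) t r| ≤ C * ((t ^ k)⁻¹ * ((r ^ j)⁻¹ * w (t, r))) := by
  obtain ⟨C, hC, h⟩ := (IsSymbol.iterate_dt (n := 0) (k := k) (by simpa using hf.iterate_dr hS hQ)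
    hS hQ).bound
  refine ⟨C, hC, fun t r htr => ?_⟩
  rw [pderiv_eq_iterate hS hf.contDiffOn htr]
  exact h (t, r) htr

end Plane

/-! ### Functions with power bounds, extended by zero, and their primitives -/

noncomputable section PowerSymbols

/-- `a` is a symbol of weight `x^p` on `(0, ∞)` and vanishes on `(-∞, 0]`. -/
structure PowerSymbol (p : ℝ) (a : ℝ → ℝ) : Prop where
  isSymbol : ∀ n, IsSymbol eulerField (Ioi 0) (fun x => x ^ p) n a
  eq_zero : ∀ x ≤ 0, a x = 0

variable {p : ℝ} {a : ℝ → ℝ} {n : ℕ}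

theorem PowerSymbol.hasDerivAt (h : PowerSymbol p a) {x : ℝ} (hx : 0 < x) :
    HasDerivAt a (deriv a x) x :=
  ((h.isSymbol 1).differentiableAt isOpen_Ioi hx).hasDerivAt

theorem PowerSymbol.exists_bound (h : PowerSymbol p a) : ∃ C, 0 ≤ C ∧ ∀ x, |a x| ≤ C * |x| ^ p := by
  obtain ⟨C, hC, hb⟩ := (h.isSymbol 0).bound
  refine ⟨C, hC, fun x => ?_⟩
  rcases le_or_gt x 0 with hx | hx
  · rw [h.eq_zero x hx, abs_zero]; positivity
  · rw [abs_of_pos hx]; exact hb x hx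

/-- For p > 1 the bound |x|^p is o(x). -/
theorem PowerSymbol.hasDerivAt_zero (h : PowerSymbol p a) (hp : 1 < p) : HasDerivAt a 0 0 := by
  obtain ⟨C, hC, hb⟩ := h.exists_bound
  rw [hasDerivAt_iff_isLittleO]
  have h1 : (fun x : ℝ => |x| ^ p) =o[nhds 0] fun x => x := by
    rw [Asymptotics.isLittleO_iff_tendsto' (by
      filter_upwards with x hx
      simp [hx, Real.zero_rpow (show p ≠ 0 by linarith)])]
    have h2 : Filter.Tendsto (fun x : ℝ => |x| ^ (p - 1)) (nhds 0) (nhds 0) := by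
      have := (continuous_abs.tendsto (0 : ℝ)).rpow_const (p := p - 1) (Or.inr (by linarith))
      rwa [abs_zero, Real.zero_rpow (by linarith)] at this
    refine squeeze_zero_norm (fun x => ?_) h2
    rcases eq_or_ne x 0 with rfl | hx
    · simp [Real.zero_rpow (show p - 1 ≠ 0 by linarith)]
    · rw [norm_div, Real.norm_eq_abs, Real.norm_eq_abs, abs_of_nonneg (by positivity),
        Real.rpow_sub_one (by positivity)]
  simp only [h.eq_zero 0 le_rfl, sub_zero, smul_zero]
  exact (Asymptotics.IsBigO.of_bound C (by
    filter_upwards with x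
    rw [Real.norm_eq_abs, Real.norm_eq_abs, abs_of_nonneg (show 0 ≤ |x| ^ p by positivity)]
    exact hb x)).trans_isLittleO h1

theorem PowerSymbol.deriv_eq_zero (h : PowerSymbol p a) (hp : 1 < p) {x : ℝ} (hx : x ≤ 0) :
    HasDerivAt a 0 x := by
  rcases hx.lt_or_eq with hx | rfl
  · refine (hasDerivAt_const x (0 : ℝ)).congr_of_eventuallyEq ?_
    filter_upwards [gt_mem_nhds hx] with y hy using h.eq_zero y hy.le
  · exact h.hasDerivAt_zero hp

theorem isSymbol_deriv (h : IsSymbol eulerField (Ioi 0) (fun x => x ^ p) (n + 1) a) :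
    IsSymbol eulerField (Ioi 0) (fun x => x ^ (p - 1)) n (deriv a) := by
  refine ((isSymbol_inv.mul (h.lieD ()) isOpen_Ioi).weight_le fun x hx => ?_).congr isOpen_Ioi
    fun x hx => ?_
  · have hx := mem_Ioi.1 hx
    rw [Real.rpow_sub_one hx.ne', inv_mul_eq_div]
  · have hx := mem_Ioi.1 hx
    simp only [lieD_eulerField]
    field_simp

theorem PowerSymbol.deriv (h : PowerSymbol p a) (hp : 1 < p) : PowerSymbol (p - 1) (deriv a) :=
  ⟨fun n => isSymbol_deriv (h.isSymbol (n + 1)), fun _ hx => (h.deriv_eq_zero hp hx).deriv⟩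

/-- Each derivative lowers the exponent by one. As long as the exponent stays positive the
derivative tends to zero at the origin and fits the zero extension. This decides the regularity
across the light cone. -/
theorem PowerSymbol.contDiff (h : PowerSymbol p a) (hp : (n : ℝ) < p) : ContDiff ℝ n a := by
  induction n generalizing p a with
  | zero =>
    rw [Nat.cast_zero, contDiff_zero, continuous_iff_continuousAt]
    intro x
    rcases lt_trichotomy x 0 with hx | rfl | hx
    · refine (continuousAt_const (y := (0 : ℝ))).congr ?_
      filter_upwards [gt_mem_nhds hx] with y hy using (h.eq_zero y hy.le).symm
    · obtain ⟨C, hC, hb⟩ := h.exists_bound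
      have h2 : Filter.Tendsto (fun x : ℝ => C * |x| ^ p) (nhds 0) (nhds 0) := by
        have hp' : 0 < p := by simpa using hp
        have := ((continuous_abs.tendsto (0 : ℝ)).rpow_const (p := p) (Or.inr hp'.le)).const_mul C
        rwa [abs_zero, Real.zero_rpow hp'.ne', mul_zero] at this
      rw [ContinuousAt, h.eq_zero 0 le_rfl]
      exact squeeze_zero_norm hb h2
    · exact (h.hasDerivAt hx).continuousAt
  | succ n ih =>
    have hp1 : 1 < p := by
      push_cast at hp
      linarith [Nat.cast_nonneg (α := ℝ) n]
    push_cast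
    rw [contDiff_succ_iff_deriv]
    refine ⟨fun x => ?_, by simp, ih (h.deriv hp1) (by push_cast at hp; linarith)⟩
    rcases le_or_gt x 0 with hx | hx
    · exact (h.deriv_eq_zero hp1 hx).differentiableAt
    · exact (h.hasDerivAt hx).differentiableAt

theorem PowerSymbol.continuous (h : PowerSymbol p a) (hp : 0 < p) : Continuous a :=
  contDiff_zero.1 (h.contDiff (n := 0) (by simpa using hp))

/-- The primitive that vanishes at the origin. -/
def prim (a : ℝ → ℝ) (x : ℝ) : ℝ := ∫ s in (0 : ℝ)..x, a s

theorem PowerSymbol.hasDerivAt_prim (h : PowerSymbol p a) (hp : 0 < p) (x : ℝ) :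
    HasDerivAt (prim a) (a x) x :=
  ((h.continuous hp).integral_hasStrictDerivAt 0 x).hasDerivAt

/-- A positive exponent makes the extended function continuous, so the primitive is a true
antiderivative on the whole line. Its Euler derivative x·a(x) already has weight x^{p+1}. -/
theorem PowerSymbol.prim (h : PowerSymbol p a) (hp : 0 < p) : PowerSymbol (p + 1) (prim a) := by
  obtain ⟨C, hC, hb⟩ := h.exists_bound
  have hB : ∀ x ∈ Ioi (0 : ℝ), |QuinticWave.prim a x| ≤ C * x ^ (p + 1) := fun x hx => by
    have hx := mem_Ioi.1 hx
    have := intervalIntegral.norm_integral_le_of_norm_le_const (f := a) (a := 0) (b := x)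
      (C := C * x ^ p) (fun y hy => by
        rw [uIoc_of_le hx.le] at hy
        refine (hb y).trans (mul_le_mul_of_nonneg_left ?_ hC)
        rw [abs_of_pos hy.1]
        exact Real.rpow_le_rpow hy.1.le hy.2 hp.le)
    rw [sub_zero, abs_of_pos hx] at this
    rw [Real.rpow_add_one hx.ne', ← mul_assoc]
    exact this
  have hw : ∀ x ∈ Ioi (0 : ℝ), 0 ≤ x ^ (p + 1) := fun x hx => by
    have hx := mem_Ioi.1 hx
    positivity
  refine ⟨fun n => ?_, fun x hx => ?_⟩
  · have key : IsSymbol eulerField (Ioi 0) (fun x => x ^ (p + 1)) (n + 1) (QuinticWave.prim a) := by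
      refine .succ_eulerField isOpen_Ioi (fun x _ => h.hasDerivAt_prim hp x) hB hw
        (fun x hx => (mem_Ioi.1 hx).ne') ?_
      refine (isSymbol_id.mul (h.isSymbol n) isOpen_Ioi).weight_le fun x hx => ?_
      rw [Real.rpow_add_one (mem_Ioi.1 hx).ne', mul_comm]
    exact key.of_succ
  · refine intervalIntegral.integral_zero_ae (Filter.Eventually.of_forall fun y hy => ?_)
    rw [uIoc_of_ge hx] at hy
    exact h.eq_zero y hy.2

/-- Restriction of a symbol on `(0, ∞)` by zero. -/
theorem powerSymbol_indicator (h : ∀ n, IsSymbol eulerField (Ioi 0) (fun x => x ^ p) n a) :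
    PowerSymbol p ((Ioi 0).indicator a) :=
  ⟨fun n => (h n).congr isOpen_Ioi fun _ hx => indicator_of_mem hx a,
    fun _ hx => indicator_of_notMem (by simpa using hx) a⟩

/-! ### Taylor remainders away from and near the light cone -/

/-- A sequence of functions on `(0, ∞)`, each the derivative of the preceding one, with
`a i = O(t^{p-i})`. -/
structure DerivSeq (p : ℝ) (a : ℕ → ℝ → ℝ) : Prop where
  hasDerivAt : ∀ i t, 0 < t → HasDerivAt (a i) (a (i + 1) t) t
  bound : ∀ i, ∃ C, 0 ≤ C ∧ ∀ t, 0 < t → |a i t| ≤ C * t ^ (p - i)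

theorem derivSeq_iterate (h : ∀ n, IsSymbol eulerField (Ioi 0) (fun x => x ^ p) n a) :
    DerivSeq p (fun i => deriv^[i] a) := by
  have key : ∀ i n : ℕ, IsSymbol eulerField (Ioi 0) (fun x => x ^ (p - i)) n (deriv^[i] a) := by
    intro i
    induction i with
    | zero => simpa using h
    | succ i ih =>
      intro n
      rw [Function.iterate_succ_apply']
      have := isSymbol_deriv (ih (n + 1))
      push_cast
      rwa [sub_sub] at this
  refine ⟨fun i t ht => ?_, fun i => ?_⟩
  · rw [Function.iterate_succ_apply']
    exact ((key i 1).differentiableAt isOpen_Ioi ht).hasDerivAt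
  · obtain ⟨C, hC, hb⟩ := (key i 0).bound
    exact ⟨C, hC, fun t ht => hb t ht⟩

variable {A : ℕ → ℝ → ℝ} {m : ℕ} {c : ℝ}

theorem DerivSeq.shift (h : DerivSeq p A) : DerivSeq (p - 1) (fun i => A (i + 1)) :=
  ⟨fun i t ht => h.hasDerivAt (i + 1) t ht, fun i => by
    obtain ⟨C, hC, hb⟩ := h.bound (i + 1)
    refine ⟨C, hC, fun t ht => ?_⟩
    have := hb t ht
    push_cast at this
    rwa [show p - 1 - (i : ℝ) = p - (i + 1) by ring]⟩

theorem DerivSeq.contDiffOn (h : DerivSeq p A) (i : ℕ) : ContDiffOn ℝ n (A i) (Ioi 0) := by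
  induction n generalizing i with
  | zero =>
    rw [Nat.cast_zero, contDiffOn_zero]
    exact fun t ht => (h.hasDerivAt i t ht).continuousAt.continuousWithinAt
  | succ n ih =>
    push_cast
    rw [contDiffOn_succ_iff_deriv_of_isOpen isOpen_Ioi]
    exact ⟨fun t ht => (h.hasDerivAt i t ht).differentiableAt.differentiableWithinAt, by simp,
      (ih (i + 1)).congr fun t ht => (h.hasDerivAt i t ht).deriv⟩

/-- The remainder of the Taylor polynomial of order `m` of `A 0`, at `t`, evaluated at
`t + c r`. -/
def taylorRem (A : ℕ → ℝ → ℝ) (c : ℝ) (m : ℕ) (q : ℝ × ℝ) : ℝ :=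
  A 0 (q.1 + c * q.2) - ∑ i ∈ Finset.range m, (c * q.2) ^ i / i.factorial * A i q.1

/-- The cone `0 < r < t/2`. -/
def innerCone : Set (ℝ × ℝ) := {q | 0 < q.2 ∧ q.2 < q.1 / 2}

theorem isOpen_innerCone : IsOpen innerCone :=
  (isOpen_lt continuous_const continuous_snd).inter
    (isOpen_lt continuous_snd (continuous_fst.div_const 2))

theorem innerCone_subset : innerCone ⊆ quadrant := fun q hq =>
  ⟨by linarith [hq.1, hq.2], hq.1⟩

theorem abs_mul_lt {t r : ℝ} (hc : |c| ≤ 1) (hr : 0 ≤ r) (hrt : r < t / 2) :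
    t / 2 < t + c * r ∧ t + c * r < 2 * t := by
  have := abs_le.1 hc
  constructor <;> nlinarith

/-- Differentiation in r kills the constant term of the Taylor polynomial and shifts the others,
leaving a remainder of one order less for the derivative sequence. In t the order is kept. -/
theorem hasDerivAt_taylorRem_snd (h : DerivSeq p A) {t r : ℝ} (ht : 0 < t + c * r) :
    HasDerivAt (fun ρ => taylorRem A c (m + 1) (t, ρ))
      (c * taylorRem (fun i => A (i + 1)) c m (t, r)) r := by
  have h1 : HasDerivAt (fun ρ => t + c * ρ) c r := by
    simpa using ((hasDerivAt_id r).const_mul c).const_add t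
  have h2 : HasDerivAt (fun ρ => A 0 (t + c * ρ)) (A 1 (t + c * r) * c) r :=
    (h.hasDerivAt 0 _ ht).comp r h1
  have h3 : HasDerivAt (fun ρ => ∑ i ∈ Finset.range (m + 1), (c * ρ) ^ i / i.factorial * A i t)
      (∑ i ∈ Finset.range m, c * ((c * r) ^ i / i.factorial * A (i + 1) t)) r := by
    have h4 : ∀ i ∈ Finset.range (m + 1), HasDerivAt
        (fun ρ => (c * ρ) ^ i / i.factorial * A i t)
        (i * (c * r) ^ (i - 1) * c / i.factorial * A i t) r := by
      intro i _
      have : HasDerivAt (fun ρ => c * ρ) c r := by simpa using (hasDerivAt_id r).const_mul c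
      exact ((this.pow i).div_const _).mul_const _
    refine (HasDerivAt.fun_sum h4).congr_deriv ?_
    rw [Finset.sum_range_succ']
    simp only [Nat.cast_zero, zero_mul, zero_div, add_zero]
    refine Finset.sum_congr rfl fun i _ => ?_
    rw [Nat.factorial_succ]
    have : (i.factorial : ℝ) ≠ 0 := by positivity
    push_cast
    field_simp
  refine (h2.sub h3).congr_deriv ?_
  rw [taylorRem, mul_sub, Finset.mul_sum]
  simp [mul_comm]

theorem hasDerivAt_taylorRem_fst (h : DerivSeq p A) {t r : ℝ} (ht : 0 < t)
    (htr : 0 < t + c * r) : HasDerivAt (fun s => taylorRem A c m (s, r))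
      (taylorRem (fun i => A (i + 1)) c m (t, r)) t := by
  have h1 : HasDerivAt (fun s => s + c * r) 1 t := (hasDerivAt_id t).add_const _
  have h2 : HasDerivAt (fun s => A 0 (s + c * r)) (A 1 (t + c * r) * 1) t :=
    (h.hasDerivAt 0 _ htr).comp t h1
  have h3 := HasDerivAt.fun_sum (u := Finset.range m) fun i _ =>
    (h.hasDerivAt i t ht).const_mul ((c * r) ^ i / i.factorial)
  refine (h2.sub h3).congr_deriv ?_
  simp [taylorRem]

theorem taylorRem_bound (h : DerivSeq p A) (hc : |c| ≤ 1) (m : ℕ) : ∃ C, 0 ≤ C ∧ ∀ t r,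
    0 ≤ r → r < t / 2 → |taylorRem A c m (t, r)| ≤ C * (r ^ m * t ^ (p - m)) := by
  induction m generalizing p A with
  | zero =>
    obtain ⟨C, hC, hb⟩ := h.bound 0
    -- The ratio (t + cr)/t lies in [1/2, 2], so its p-th power is at most 2^|p| for either sign of
    -- p.
    refine ⟨C * 2 ^ |p|, by positivity, fun t r hr hrt => ?_⟩
    obtain ⟨h1, h2⟩ := abs_mul_lt hc hr hrt
    have ht : 0 < t := by linarith
    have h3 := hb (t + c * r) (by linarith)
    have h4 : (t + c * r) ^ p ≤ 2 ^ |p| * t ^ p := by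
      rw [← div_le_iff₀ (by positivity), ← Real.div_rpow (by linarith) ht.le]
      have h5 : (t + c * r) / t ≤ 2 := by rw [div_le_iff₀ ht]; linarith
      have h6 : 2⁻¹ ≤ (t + c * r) / t := by rw [le_div_iff₀ ht]; linarith
      rcases le_total 0 p with hp | hp
      · rw [abs_of_nonneg hp]
        exact Real.rpow_le_rpow (by linarith) h5 hp
      · rw [abs_of_nonpos hp, Real.rpow_neg (by norm_num), ← Real.inv_rpow (by norm_num)]
        exact Real.rpow_le_rpow_of_nonpos (by norm_num) h6 hp
    simp only [Nat.cast_zero, sub_zero] at h3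
    simp only [taylorRem, Finset.range_zero, Finset.sum_empty, sub_zero, pow_zero, one_mul,
      Nat.cast_zero]
    nlinarith [mul_le_mul_of_nonneg_left h4 hC]
  | succ m ih =>
    obtain ⟨C, hC, hb⟩ := ih h.shift
    refine ⟨C, hC, fun t r hr hrt => ?_⟩
    have ht : 0 < t := by linarith
    -- The remainder vanishes at r = 0, so the bound on its r-derivative gains one factor r.
    have h1 := (convex_Icc (0 : ℝ) r).norm_image_sub_le_of_norm_hasDerivWithin_le
      (f := fun ρ => taylorRem A c (m + 1) (t, ρ)) (C := C * (r ^ m * t ^ (p - 1 - m)))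
      (fun ρ hρ => (hasDerivAt_taylorRem_snd h (by
        linarith [(abs_mul_lt hc hρ.1 (hρ.2.trans_lt hrt)).1])).hasDerivWithinAt)
      (fun ρ hρ => by
        rw [norm_mul, Real.norm_eq_abs, Real.norm_eq_abs]
        have h2 := hb t ρ hρ.1 (hρ.2.trans_lt hrt)
        have h3 : ρ ^ m * t ^ (p - 1 - m) ≤ r ^ m * t ^ (p - 1 - m) :=
          mul_le_mul_of_nonneg_right (pow_le_pow_left₀ hρ.1 hρ.2 m) (by positivity)
        calc _ ≤ 1 * |taylorRem (fun i => A (i + 1)) c m (t, ρ)| :=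
              mul_le_mul_of_nonneg_right hc (abs_nonneg _)
          _ ≤ _ := by rw [one_mul]; exact h2.trans (mul_le_mul_of_nonneg_left h3 hC))
      (left_mem_Icc.2 hr) (right_mem_Icc.2 hr)
    have h0 : taylorRem A c (m + 1) (t, 0) = 0 := by
      simp [taylorRem, Finset.sum_range_succ']
    rw [h0, sub_zero, sub_zero, Real.norm_eq_abs, Real.norm_eq_abs, abs_of_nonneg hr] at h1
    refine h1.trans (le_of_eq ?_)
    rw [show p - 1 - (m : ℝ) = p - (m + 1 : ℕ) by push_cast; ring]
    ring

theorem contDiffOn_taylorRem (h : DerivSeq p A) (hc : |c| ≤ 1) :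
    ContDiffOn ℝ n (taylorRem A c m) innerCone := by
  have h1 : ∀ q ∈ innerCone, q.1 ∈ Ioi (0 : ℝ) := fun q hq => (innerCone_subset hq).1
  have h2 : ∀ q ∈ innerCone, q.1 + c * q.2 ∈ Ioi (0 : ℝ) := fun q hq => by
    have := (abs_mul_lt hc hq.1.le hq.2).1
    have := h1 q hq
    simp at *
    linarith
  refine ContDiffOn.sub ((h.contDiffOn 0).comp (by fun_prop) h2) (ContDiffOn.sum fun i _ => ?_)
  exact ContDiffOn.mul (by fun_prop) ((h.contDiffOn i).comp contDiffOn_fst h1)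

/-- Both fields return remainders of the shifted sequence. For t∂_t the lost power of t is restored
by the factor t; r∂_r lowers both p and m by one, which leaves p - m unchanged, and the factor r
restores r^m. -/
theorem isSymbol_taylorRem (h : DerivSeq p A) (hc : |c| ≤ 1) (m : ℕ) :
    IsSymbol coneField innerCone (fun q => q.2 ^ m * q.1 ^ (p - m)) n (taylorRem A c m) := by
  have hw : ∀ (m : ℕ) (p : ℝ), ∀ q ∈ innerCone, 0 ≤ q.2 ^ m * q.1 ^ (p - m) := fun m p q hq => by
    obtain ⟨h1, h2⟩ := innerCone_subset hq
    positivity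
  induction n generalizing m p A with
  | zero =>
    obtain ⟨C, hC, hb⟩ := taylorRem_bound h hc m
    exact .zero_of (contDiffOn_taylorRem (n := 0) h hc) (fun q hq => hb q.1 q.2 hq.1.le hq.2)
      (hw m p)
  | succ n ih =>
    obtain ⟨C, hC, hb⟩ := taylorRem_bound h hc m
    have hO := isOpen_innerCone
    have hcd := contDiffOn_taylorRem (n := n + 1) (m := m) h hc
    have hd : ∀ q ∈ innerCone, DifferentiableAt ℝ (taylorRem A c m) q := fun q hq =>
      (hcd.contDiffAt (hO.mem_nhds hq)).differentiableAt (by simp)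
    have hpos : ∀ q ∈ innerCone, 0 < q.1 ∧ 0 < q.1 + c * q.2 := fun q hq => by
      have h1 := (innerCone_subset hq).1
      exact ⟨h1, by linarith [(abs_mul_lt hc hq.1.le hq.2).1]⟩
    have hT := (isSymbol_fst (n := n)).mono innerCone_subset
    have hR := (isSymbol_snd (n := n)).mono innerCone_subset
    refine .succ_of hcd (fun q hq => hb q.1 q.2 hq.1.le hq.2) hO (hw m p)
      (g := fun i => match i with
        | false => fun q => q.1 * taylorRem (fun i => A (i + 1)) c m q
        | true => fun q => q.2 * (c * taylorRem (fun i => A (i + 1)) c (m - 1) q)) ?_ ?_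
    · rintro (_ | _)
      · refine (hT.mul (ih h.shift m) hO).weight_le fun q hq => le_of_eq ?_
        have := (hpos q hq).1
        rw [show p - 1 - (m : ℝ) = p - m - 1 by ring, Real.rpow_sub_one this.ne']
        field_simp
      · refine (hR.mul ((ih h.shift (m - 1)).const_mul hO c) hO).weight_le fun q hq => ?_
        have h1 := (hpos q hq).1
        have h2 := hq.1
        cases m with
        | zero =>
          -- With m = 0 the order m - 1 is truncated to zero; the lost power of t is then paid by r
          -- < t/2.
          simp only [Nat.zero_sub, Nat.cast_zero, pow_zero, one_mul, sub_zero]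
          rw [Real.rpow_sub_one h1.ne', ← mul_div_assoc, div_le_iff₀ h1, mul_comm]
          exact mul_le_mul_of_nonneg_left (by linarith [hq.2]) (by positivity)
        | succ m =>
          apply le_of_eq
          rw [Nat.add_sub_cancel, show p - 1 - (m : ℝ) = p - (m + 1 : ℕ) by push_cast; ring]
          ring
    · rintro (_ | _) q hq
      · simp only [lieD_false]
        rw [(hasDerivAt_fst (hd q hq)).unique
          (hasDerivAt_taylorRem_fst h (hpos q hq).1 (hpos q hq).2)]
      · simp only [lieD_true]
        cases m with
        | zero =>
          have h1 : HasDerivAt (fun ρ => taylorRem A c 0 (q.1, ρ))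
              (c * taylorRem (fun i => A (i + 1)) c 0 (q.1, q.2)) q.2 := by
            have h2 : HasDerivAt (fun ρ => q.1 + c * ρ) c q.2 := by
              simpa using ((hasDerivAt_id q.2).const_mul c).const_add q.1
            have h3 := (h.hasDerivAt 0 _ (hpos q hq).2).comp q.2 h2
            simpa [taylorRem, mul_comm, Function.comp_def] using h3
          rw [(hasDerivAt_snd (hd q hq)).unique h1]
        | succ m =>
          rw [(hasDerivAt_snd (hd q hq)).unique
            (hasDerivAt_taylorRem_snd h (hpos q hq).2)]
          simp

/-- The region `t/4 < r < 3t`. -/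
def outerCone : Set (ℝ × ℝ) := {q | q.1 / 4 < q.2 ∧ q.2 < 3 * q.1}

theorem isOpen_outerCone : IsOpen outerCone :=
  (isOpen_lt (continuous_fst.div_const 4) continuous_snd).inter
    (isOpen_lt continuous_snd (continuous_const.mul continuous_fst))

theorem outerCone_subset : outerCone ⊆ quadrant := fun q hq => by
  have h1 := hq.1
  have h2 := hq.2
  exact ⟨by linarith, by linarith⟩

/-- Here t + cr may approach zero or be negative, so only the upper bound |t + cr| ≤ 4t is
available. The exponent must stay positive, which limits the number of derivatives. -/
theorem PowerSymbol.isSymbol_outerCone (h : PowerSymbol p a) (hp : (n : ℝ) < p) (hc : |c| ≤ 1) :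
    IsSymbol coneField outerCone (fun q => q.1 ^ p) n (fun q => a (q.1 + c * q.2)) := by
  have hO := isOpen_outerCone
  have hb : ∀ {p : ℝ} {a : ℝ → ℝ}, PowerSymbol p a → 0 < p →
      ∃ C, ∀ q ∈ outerCone, |a (q.1 + c * q.2)| ≤ C * q.1 ^ p := by
    intro p a h hp
    obtain ⟨C, hC, hb⟩ := h.exists_bound
    refine ⟨C * 4 ^ p, fun q hq => (hb _).trans ?_⟩
    obtain ⟨ht, hr⟩ := outerCone_subset hq
    rw [mul_assoc, ← Real.mul_rpow (by norm_num) ht.le]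
    refine mul_le_mul_of_nonneg_left (Real.rpow_le_rpow (abs_nonneg _) ?_ hp.le) hC
    have h1 := hq.2
    have := abs_le.1 hc
    rw [abs_le]
    constructor <;> nlinarith
  have hw : ∀ (p : ℝ), ∀ q ∈ outerCone, 0 ≤ q.1 ^ p := fun p q hq =>
    Real.rpow_nonneg (outerCone_subset hq).1.le p
  induction n generalizing p a with
  | zero =>
    obtain ⟨C, hC⟩ := hb h (by simpa using hp)
    refine .zero_of ?_ hC (hw p)
    exact ((h.contDiff (n := 0) hp).comp (by fun_prop)).contDiffOn
  | succ n ih =>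
    have hp' : (n : ℝ) + 1 < p := by exact_mod_cast hp
    have hn : (0 : ℝ) ≤ n := Nat.cast_nonneg n
    obtain ⟨C, hC⟩ := hb h (by linarith)
    have hcd : ContDiff ℝ (n + 1 : ℕ) (fun q : ℝ × ℝ => a (q.1 + c * q.2)) :=
      (h.contDiff hp).comp (by fun_prop)
    have hd : ∀ q, DifferentiableAt ℝ (fun q : ℝ × ℝ => a (q.1 + c * q.2)) q := fun q =>
      hcd.contDiffAt.differentiableAt (by simp)
    have ha : ∀ x, HasDerivAt a (_root_.deriv a x) x := fun x =>
      ((h.contDiff hp).contDiffAt.differentiableAt (by simp)).hasDerivAt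
    have h1 := ih (h.deriv (by linarith)) (by linarith)
    have hT := (isSymbol_fst (n := n)).mono outerCone_subset
    have hR := (isSymbol_snd (n := n)).mono outerCone_subset
    refine .succ_of hcd.contDiffOn hC hO (hw p) (g := fun i => match i with
        | false => fun q => q.1 * _root_.deriv a (q.1 + c * q.2)
        | true => fun q => c * (q.2 * _root_.deriv a (q.1 + c * q.2))) ?_ ?_
    · rintro (_ | _)
      · refine (hT.mul h1 hO).weight_le fun q hq => le_of_eq ?_
        have := (outerCone_subset hq).1
        rw [Real.rpow_sub_one this.ne']
        field_simp
      · refine IsSymbol.const_mul ((hR.mul h1 hO).weight (C := 3) (by norm_num) fun q hq => ?_) hO c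
        have := (outerCone_subset hq).1
        rw [Real.rpow_sub_one this.ne', ← mul_div_assoc, div_le_iff₀ this]
        have h3 : 0 ≤ q.1 ^ p := by positivity
        nlinarith [hq.2]
    · rintro (_ | _) q hq
      · simp only [lieD_false]
        have h2 : HasDerivAt (fun s => s + c * q.2) 1 q.1 := (hasDerivAt_id _).add_const _
        rw [(hasDerivAt_fst (hd q)).unique ((ha _).comp q.1 h2), mul_one]
      · simp only [lieD_true]
        have h2 : HasDerivAt (fun ρ => q.1 + c * ρ) c q.2 := by
          simpa using ((hasDerivAt_id q.2).const_mul c).const_add q.1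
        rw [(hasDerivAt_snd (hd q)).unique ((ha _).comp q.2 h2)]
        ring

end PowerSymbols

/-! ### The scaling function and its size -/

noncomputable section Scaling

/-- The logarithmic derivative `t λ'/λ`. -/
def ell (ν ε t : ℝ) : ℝ := -1 - ν - ε * cos (log t)

/-- The square root of the scaling function. -/
def sig (ν ε t : ℝ) : ℝ := √(lam ν ε t)

variable {ν ε t : ℝ} {n : ℕ}

theorem lam_pos (ht : 0 < t) : 0 < lam ν ε t := by unfold lam; positivity

theorem sig_pos (ht : 0 < t) : 0 < sig ν ε t := Real.sqrt_pos.2 (lam_pos ht)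

theorem sig_sq (ht : 0 < t) : sig ν ε t ^ 2 = lam ν ε t := Real.sq_sqrt (lam_pos ht).le

theorem hasDerivAt_lam (ht : 0 < t) : HasDerivAt (lam ν ε) (ell ν ε t / t * lam ν ε t) t := by
  have h1 : HasDerivAt (fun t : ℝ => t ^ (-1 - ν)) ((-1 - ν) * t ^ (-1 - ν - 1)) t :=
    Real.hasDerivAt_rpow_const (Or.inl ht.ne')
  have h2 := ((Real.hasDerivAt_log ht.ne').sin.const_mul (-ε)).exp
  refine (h1.mul h2).congr_deriv ?_
  rw [Real.rpow_sub_one ht.ne', lam, ell]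
  field_simp
  ring

theorem hasDerivAt_sig (ht : 0 < t) :
    HasDerivAt (sig ν ε) (ell ν ε t / (2 * t) * sig ν ε t) t := by
  refine ((hasDerivAt_lam ht).sqrt (lam_pos ht).ne').congr_deriv ?_
  have h1 := sig_pos (ν := ν) (ε := ε) ht
  change _ / (2 * sig ν ε t) = _
  rw [← sig_sq ht]
  field_simp

theorem hasDerivAt_ell (ht : 0 < t) : HasDerivAt (ell ν ε) (ε * sin (log t) / t) t := by
  refine (((Real.hasDerivAt_log ht.ne').cos.const_mul ε).const_sub (-1 - ν)).congr_deriv ?_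
  field_simp

/-- The Euler field rotates cos(log t) and sin(log t) into each other, so both are treated in one
induction. -/
theorem isSymbol_cos_sin : IsSymbol eulerField (Ioi 0) (fun _ => 1) n (fun t => cos (log t)) ∧
    IsSymbol eulerField (Ioi 0) (fun _ => 1) n (fun t => sin (log t)) := by
  have hlog : ∀ n : ℕ, ContDiffOn ℝ n log (Ioi 0) := fun n =>
    (Real.contDiffOn_log).mono fun x hx => (mem_Ioi.1 hx).ne'
  have hc : ∀ t ∈ Ioi (0 : ℝ), |cos (log t)| ≤ 1 * 1 := fun t _ => by
    simpa using Real.abs_cos_le_one _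
  have hs : ∀ t ∈ Ioi (0 : ℝ), |sin (log t)| ≤ 1 * 1 := fun t _ => by
    simpa using Real.abs_sin_le_one _
  have h0 : ∀ t ∈ Ioi (0 : ℝ), t ≠ 0 := fun t ht => (mem_Ioi.1 ht).ne'
  induction n with
  | zero =>
    exact ⟨.zero_of (Real.contDiff_cos.comp_contDiffOn (hlog 0)) hc fun _ _ => zero_le_one,
      .zero_of (Real.contDiff_sin.comp_contDiffOn (hlog 0)) hs fun _ _ => zero_le_one⟩
  | succ n ih =>
    refine ⟨.succ_eulerField isOpen_Ioi (fun t ht => (Real.hasDerivAt_log (h0 t ht)).cos) hc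
      (fun _ _ => zero_le_one) h0 ((ih.2.neg isOpen_Ioi).congr isOpen_Ioi fun t ht => ?_),
      .succ_eulerField isOpen_Ioi (fun t ht => (Real.hasDerivAt_log (h0 t ht)).sin) hs
      (fun _ _ => zero_le_one) h0 (ih.1.congr isOpen_Ioi fun t ht => ?_)⟩
    all_goals
      have := h0 t ht
      field_simp

theorem isSymbol_ell : IsSymbol eulerField (Ioi 0) (fun _ => 1) n (ell ν ε) :=
  (IsSymbol.const (-1 - ν)).sub (isSymbol_cos_sin.1.const_mul isOpen_Ioi ε) isOpen_Ioi

/-- Since tσ' = (ℓ/2)σ with ℓ a bounded symbol, σ serves as its own weight. Hence the oscillating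
factor is kept exact and compared with a power of t only where needed. -/
theorem isSymbol_sig : IsSymbol eulerField (Ioi 0) (sig ν ε) n (sig ν ε) := by
  have hb : ∀ t ∈ Ioi (0 : ℝ), |sig ν ε t| ≤ 1 * sig ν ε t := fun t ht => by
    rw [abs_of_pos (sig_pos ht), one_mul]
  induction n with
  | zero =>
    refine .zero_of ?_ hb fun t ht => (sig_pos ht).le
    exact contDiffOn_zero.2 fun t ht => (hasDerivAt_sig ht).continuousAt.continuousWithinAt
  | succ n ih =>
    refine .succ_eulerField isOpen_Ioi (fun t ht => hasDerivAt_sig ht) hb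
      (fun t ht => (sig_pos ht).le) (fun t ht => (mem_Ioi.1 ht).ne') ?_
    refine (((isSymbol_ell (ν := ν) (ε := ε)).const_mul isOpen_Ioi (1 / 2)).mul ih
      isOpen_Ioi).weight_le (by simp) |>.congr isOpen_Ioi fun t ht => ?_
    have := (mem_Ioi.1 ht).ne'
    field_simp

theorem isSymbol_sig_inv : IsSymbol eulerField (Ioi 0) (fun t => (sig ν ε t)⁻¹) n
    (fun t => (sig ν ε t)⁻¹) :=
  isSymbol_sig.inv isOpen_Ioi (fun _ ht => sig_pos ht) one_pos (by simp)

/-- The coefficient of `∂_t²` of the bulk term in front of `source₁`. -/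
def omega₁ (ν ε t : ℝ) : ℝ := ε * sin (log t) - ell ν ε t

/-- The coefficient of `∂_t²` of the bulk term in front of `source₂`. -/
def omega₂ (ν ε t : ℝ) : ℝ := ell ν ε t ^ 2

theorem isSymbol_omega₁ : IsSymbol eulerField (Ioi 0) (fun _ => 1) n (omega₁ ν ε) :=
  (isSymbol_cos_sin.2.const_mul isOpen_Ioi ε).sub isSymbol_ell isOpen_Ioi

theorem isSymbol_omega₂ : IsSymbol eulerField (Ioi 0) (fun _ => 1) n (omega₂ ν ε) :=
  (isSymbol_ell.pow isOpen_Ioi 2).weight_le (by simp)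

theorem sig_eq (ht : 0 < t) :
    sig ν ε t = t ^ (-(1 + ν) / 2) * exp (-ε * sin (log t) / 2) := by
  rw [sig, lam, Real.sqrt_mul (by positivity), Real.sqrt_eq_rpow, ← Real.rpow_mul ht.le,
    Real.exp_half]
  ring_nf

theorem exp_le_sig_mul (ht : 0 < t) : exp (-|ε|) ≤ sig ν ε t * t ^ ((1 + ν) / 2) := by
  rw [sig_eq ht, mul_right_comm, ← Real.rpow_add ht]
  rw [show -(1 + ν) / 2 + (1 + ν) / 2 = 0 by ring, Real.rpow_zero, one_mul]
  apply Real.exp_le_exp.2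
  have h := abs_mul ε (sin (log t))
  have h1 := abs_le.1 (h.le.trans (mul_le_of_le_one_right (abs_nonneg ε) (Real.abs_sin_le_one _)))
  linarith [h1.1, h1.2, abs_nonneg ε]

theorem sig_mul_le (ht : 0 < t) : sig ν ε t * t ^ ((1 + ν) / 2) ≤ exp |ε| := by
  rw [sig_eq ht, mul_right_comm, ← Real.rpow_add ht]
  rw [show -(1 + ν) / 2 + (1 + ν) / 2 = 0 by ring, Real.rpow_zero, one_mul]
  apply Real.exp_le_exp.2
  have h := abs_mul ε (sin (log t))
  have h1 := abs_le.1 (h.le.trans (mul_le_of_le_one_right (abs_nonneg ε) (Real.abs_sin_le_one _)))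
  linarith [h1.1, h1.2, abs_nonneg ε]

theorem sig_inv_le (ht : 0 < t) : (sig ν ε t)⁻¹ ≤ exp |ε| * t ^ ((1 + ν) / 2) := by
  have h1 := exp_le_sig_mul (ν := ν) (ε := ε) ht
  have h2 := sig_pos (ν := ν) (ε := ε) ht
  rw [Real.exp_neg] at h1
  rw [inv_le_iff_one_le_mul₀ h2]
  rw [inv_le_iff_one_le_mul₀ (Real.exp_pos _)] at h1
  linarith

theorem rpow_le_sig_inv (ht : 0 < t) : t ^ ((1 + ν) / 2) ≤ exp |ε| * (sig ν ε t)⁻¹ := by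
  rw [← div_eq_mul_inv, le_div_iff₀ (sig_pos ht), mul_comm]
  exact sig_mul_le ht

theorem mu_eq (ht : 0 < t) : mu ν ε t = t * sig ν ε t ^ 2 := by rw [mu, sig_sq ht]

theorem exp_rpow_le_mu (ht : 0 < t) : exp (-|ε|) ^ 2 * t ^ (-ν) ≤ mu ν ε t := by
  have h1 : exp (-|ε|) * t ^ (-(1 + ν) / 2) ≤ sig ν ε t := by
    rw [neg_div, Real.rpow_neg ht.le, ← div_eq_mul_inv, div_le_iff₀ (by positivity)]
    exact exp_le_sig_mul ht
  have h2 := pow_le_pow_left₀ (by positivity) h1 2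
  rw [mu_eq ht]
  calc exp (-|ε|) ^ 2 * t ^ (-ν) = t * (exp (-|ε|) * t ^ (-(1 + ν) / 2)) ^ 2 := by
        rw [mul_pow, ← Real.rpow_natCast (t ^ _), ← Real.rpow_mul ht.le]
        rw [show -(1 + ν) / 2 * ((2 : ℕ) : ℝ) = -ν - 1 by push_cast; ring,
          Real.rpow_sub_one ht.ne']
        field_simp
    _ ≤ _ := mul_le_mul_of_nonneg_left h2 ht.le

/-- `μ` is bounded below on `(0, 1)`. -/
theorem exp_le_mu (hν : 0 < ν) (ht : 0 < t) (ht1 : t < 1) : exp (-|ε|) ^ 2 ≤ mu ν ε t := by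
  refine le_trans ?_ (exp_rpow_le_mu ht)
  refine le_mul_of_one_le_right (by positivity) ?_
  exact Real.one_le_rpow_of_pos_of_le_one_of_nonpos ht ht1.le (by linarith)

end Scaling

/-! ### Smooth extension by zero across r = 0 -/

noncomputable section Flat

variable {n : ℕ}

/-- A symbol that vanishes to high order at the edge `r = 0` is extended smoothly by zero. -/
theorem contDiffOn_of_flat {f : ℝ × ℝ → ℝ} {h : ℝ → ℝ} {m : ℕ}
    (hf : IsSymbol coneField innerCone (fun q => q.2 ^ m * h q.1) n f) (hm : n < m)
    (hh : ContinuousOn h (Ioi 0)) (h0 : ∀ q : ℝ × ℝ, 0 < q.1 → q.2 ≤ 0 → f q = 0) :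
    ContDiffOn ℝ n f {q | 0 < q.1 ∧ q.2 < q.1 / 2} := by
  set T : Set (ℝ × ℝ) := {q | 0 < q.1 ∧ q.2 < q.1 / 2} with hT
  have hTo : IsOpen T := (isOpen_lt continuous_const continuous_fst).inter
    (isOpen_lt continuous_snd (continuous_fst.div_const 2))
  have hneg : IsOpen {q : ℝ × ℝ | 0 < q.1 ∧ q.2 < 0} :=
    (isOpen_lt continuous_const continuous_fst).inter
      (isOpen_lt continuous_snd continuous_const)
  have key : ∀ {m : ℕ} {f : ℝ × ℝ → ℝ} {h : ℝ → ℝ},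
      IsSymbol coneField innerCone (fun q => q.2 ^ m * h q.1) 0 f → ContinuousOn h (Ioi 0) →
      (∀ q : ℝ × ℝ, 0 < q.1 → q.2 ≤ 0 → f q = 0) → 0 < m → ∀ t, 0 < t →
      ∃ C, 0 ≤ C ∧ ∀ᶠ q in nhds ((t, 0) : ℝ × ℝ), |f q| ≤ C * |q.2| ^ m := by
    intro m f h hf hh h0 hm t ht
    obtain ⟨C, hC, hb⟩ := hf.bound
    have h1 : ContinuousAt (fun q : ℝ × ℝ => h q.1) (t, 0) :=
      ContinuousAt.comp (f := Prod.fst) (hh.continuousAt (Ioi_mem_nhds ht)) continuousAt_fst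
    have h2 : ∀ᶠ q in nhds ((t, 0) : ℝ × ℝ), h q.1 < h t + 1 :=
      h1.eventually_lt_const (by simp)
    have h3 : ∀ᶠ q in nhds ((t, 0) : ℝ × ℝ), q ∈ T :=
      hTo.mem_nhds (by simp [hT, ht])
    refine ⟨C * (|h t| + 1), by positivity, ?_⟩
    filter_upwards [h2, h3] with q hq2 hq3
    rcases le_or_gt q.2 0 with hq | hq
    · rw [h0 q hq3.1 hq, abs_zero]; positivity
    · refine (hb q ⟨hq, hq3.2⟩).trans ?_
      rw [abs_of_pos hq, mul_assoc, mul_comm (q.2 ^ m)]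
      refine mul_le_mul_of_nonneg_left (mul_le_mul_of_nonneg_right ?_ (by positivity)) hC
      linarith [le_abs_self (h t)]
  induction n generalizing m f h with
  | zero =>
    rw [Nat.cast_zero, contDiffOn_zero]
    rintro ⟨t, r⟩ hq
    refine ContinuousAt.continuousWithinAt ?_
    rcases lt_trichotomy r 0 with hr | rfl | hr
    · refine (continuousAt_const (y := (0 : ℝ))).congr ?_
      filter_upwards [hneg.mem_nhds ⟨hq.1, hr⟩] with q hq using (h0 q hq.1 hq.2.le).symm
    · obtain ⟨C, hC, hb⟩ := key hf hh h0 hm t hq.1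
      rw [ContinuousAt, h0 (t, 0) hq.1 le_rfl]
      refine squeeze_zero_norm' hb ?_
      have h1 : Continuous (fun q : ℝ × ℝ => C * |q.2| ^ m) := by fun_prop
      have h2 := h1.tendsto (t, 0)
      simpa [hm.ne'] using h2
    · exact hf.contDiffOn.continuousOn.continuousAt (isOpen_innerCone.mem_nhds ⟨hr, hq.2⟩)
  | succ n ih =>
    have hneg0 : ∀ q : ℝ × ℝ, 0 < q.1 → q.2 < 0 → HasFDerivAt f (0 : ℝ × ℝ →L[ℝ] ℝ) q := fun q hq1 hq2 => by
      refine (hasFDerivAt_const (0 : ℝ) q).congr_of_eventuallyEq ?_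
      filter_upwards [hneg.mem_nhds ⟨hq1, hq2⟩] with q' hq' using h0 q' hq'.1 hq'.2.le
    have hzero : ∀ q : ℝ × ℝ, 0 < q.1 → q.2 ≤ 0 → HasFDerivAt f (0 : ℝ × ℝ →L[ℝ] ℝ) q := by
      rintro ⟨t, r⟩ ht hr
      rcases hr.lt_or_eq with hr | hr
      · exact hneg0 _ ht hr
      simp only at ht hr
      subst hr
      obtain ⟨C, hC, hb⟩ := key (hf.of_le (Nat.zero_le _)) hh h0 (by omega) t ht
      rw [hasFDerivAt_iff_isLittleO]
      have h1 : f =O[nhds ((t, 0) : ℝ × ℝ)] fun q => ‖q - (t, 0)‖ ^ m := by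
        refine Asymptotics.IsBigO.of_bound C ?_
        filter_upwards [hb] with q hq
        refine hq.trans ?_
        rw [norm_pow, norm_norm]
        refine mul_le_mul_of_nonneg_left (pow_le_pow_left₀ (abs_nonneg _) ?_ m) hC
        have h3 := norm_snd_le (q - (t, 0))
        rwa [Prod.snd_sub, sub_zero, Real.norm_eq_abs] at h3
  
      have h2 := h1.trans_isLittleO (Asymptotics.isLittleO_pow_sub_sub ((t, 0) : ℝ × ℝ)
        (show 1 < m by omega))
      refine h2.congr (fun q => ?_) fun _ => rfl
      rw [h0 (t, 0) ht le_rfl, sub_zero]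
      simp
    -- The induction applies to the two partial derivatives. The t-derivative keeps the power r^m
    -- and absorbs t⁻¹ into h; the r-derivative has power r^{m-1}, in step with the loss of one
    -- order of smoothness.
    have hf' : ∀ q : ℝ × ℝ, fderiv ℝ f q = dt f q • ContinuousLinearMap.fst ℝ ℝ ℝ +
        dr f q • ContinuousLinearMap.snd ℝ ℝ ℝ := fun q => by
      ext <;> simp [dt, dr]
    have h1 : ContDiffOn ℝ n (dt f) T := by
      refine ih (m := m) (h := fun t => t⁻¹ * h t)
        ((hf.dt isOpen_innerCone innerCone_subset).weight_le fun q _ => by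
          apply le_of_eq; ring)
        (by omega) ((continuousOn_id.inv₀ fun t ht => (mem_Ioi.1 ht).ne').mul hh) fun q hq1 hq2 => ?_
      rw [dt, (hzero q hq1 hq2).fderiv]; rfl
    have h2 : ContDiffOn ℝ n (dr f) T := by
      refine ih (m := m - 1) (h := h)
        ((hf.dr isOpen_innerCone innerCone_subset).weight_le fun q hq => by
          apply le_of_eq
          obtain ⟨k, rfl⟩ : ∃ k, m = k + 1 := ⟨m - 1, by omega⟩
          have := hq.1.ne'
          rw [pow_succ, Nat.add_sub_cancel]
          field_simp)
        (by omega) hh fun q hq1 hq2 => ?_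
      rw [dr, (hzero q hq1 hq2).fderiv]; rfl
    push_cast
    rw [contDiffOn_succ_iff_fderiv_of_isOpen hTo]
    refine ⟨fun q hq => ?_, by simp, ?_⟩
    · rcases le_or_gt q.2 0 with hr | hr
      · exact (hzero q hq.1 hr).differentiableAt.differentiableWithinAt
      · exact (hf.differentiableAt isOpen_innerCone ⟨hr, hq.2⟩).differentiableWithinAt
    · exact ((h1.smul contDiffOn_const).add (h2.smul contDiffOn_const)).congr fun q _ => hf' q

end Flat

/-- The two profiles from which the first correction is built. -/
structure ProfileData where
  (F₁ F₂ : ℝ → ℝ)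
  (β₁ γ₁ β₂ γ₂ : ℝ)
  isProfile₁ : IsProfile source₁ F₁ β₁ γ₁
  isProfile₂ : IsProfile source₂ F₂ β₂ γ₂

/-! ### The two corrections and their symbol bounds -/

noncomputable section Corrections

variable (D : ProfileData) (ν ε : ℝ)

/-- The rescaled radius `λ(t) r / √3`. -/
def xi (q : ℝ × ℝ) : ℝ := lam ν ε q.1 * q.2 / √3

/-- The first correction. -/
def corr₁ (q : ℝ × ℝ) : ℝ := (q.1 ^ 2 * sig ν ε q.1 ^ 3)⁻¹ *
  (omega₁ ν ε q.1 * D.F₁ (xi ν ε q) + omega₂ ν ε q.1 * D.F₂ (xi ν ε q))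

/-- The coefficient of `r` in the leading part of the first correction. -/
def leadA (t : ℝ) : ℝ :=
  (t ^ 2 * sig ν ε t)⁻¹ * ((omega₁ ν ε t * D.β₁ + omega₂ ν ε t * D.β₂) / √3)

/-- The coefficient of `1` in the leading part of the first correction. -/
def leadB (t : ℝ) : ℝ :=
  (t ^ 2 * sig ν ε t ^ 3)⁻¹ * (omega₁ ν ε t * D.γ₁ + omega₂ ν ε t * D.γ₂)

/-- The difference of the first correction and its leading part at infinity. -/
def corrDiff (q : ℝ × ℝ) : ℝ := corr₁ D ν ε q - (leadA D ν ε q.1 * q.2 + leadB D ν ε q.1)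

/-- The second primitive of `leadA`. -/
def primA : ℝ → ℝ := prim (prim ((Ioi 0).indicator (leadA D ν ε)))

/-- The primitive of `leadB`. -/
def primB : ℝ → ℝ := prim ((Ioi 0).indicator (leadB D ν ε))

/-- The second correction. -/
def corr₂ (q : ℝ × ℝ) : ℝ :=
  (primA D ν ε (q.1 + q.2) + primA D ν ε (q.1 - q.2) - 2 * primA D ν ε q.1 -
    q.2 ^ 2 * leadA D ν ε q.1 +
    ((primB D ν ε (q.1 + q.2) - primB D ν ε (q.1 - q.2)) / 2 - q.2 * leadB D ν ε q.1)) / q.2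

variable {D ν ε} {n : ℕ} {t : ℝ}

theorem isSymbol_leadA : IsSymbol eulerField (Ioi 0) (fun t => (t ^ 2 * sig ν ε t)⁻¹) n
    (leadA D ν ε) := by
  have hO : IsOpen (Ioi (0 : ℝ)) := isOpen_Ioi
  refine (((isSymbol_inv.pow hO 2).mul (isSymbol_sig_inv (ν := ν) (ε := ε)) hO).mul
    ((((isSymbol_omega₁ (ν := ν) (ε := ε)).const_mul hO D.β₁).add
    ((isSymbol_omega₂ (ν := ν) (ε := ε)).const_mul hO D.β₂) hO).const_mul hO (√3)⁻¹) hO).weight_le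
    (fun t ht => le_of_eq ?_) |>.congr hO fun t ht => ?_
  · rw [mul_inv, inv_pow]; ring
  · simp only [leadA, mul_inv, inv_pow]; ring

theorem isSymbol_leadB : IsSymbol eulerField (Ioi 0) (fun t => (t ^ 2 * sig ν ε t ^ 3)⁻¹) n
    (leadB D ν ε) := by
  have hO : IsOpen (Ioi (0 : ℝ)) := isOpen_Ioi
  refine (((isSymbol_inv.pow hO 2).mul ((isSymbol_sig_inv (ν := ν) (ε := ε)).pow hO 3) hO).mul
    (((isSymbol_omega₁ (ν := ν) (ε := ε)).const_mul hO D.γ₁).add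
    ((isSymbol_omega₂ (ν := ν) (ε := ε)).const_mul hO D.γ₂) hO) hO).weight_le
    (fun t ht => le_of_eq ?_) |>.congr hO fun t ht => ?_
  · rw [mul_inv, inv_pow, inv_pow]; ring
  · simp only [leadB, mul_inv, inv_pow]; ring

theorem powerSymbol_leadA : PowerSymbol ((1 + ν) / 2 - 2) ((Ioi 0).indicator (leadA D ν ε)) := by
  refine powerSymbol_indicator fun n => isSymbol_leadA.weight (C := exp |ε|) (by positivity)
    fun t ht => ?_
  have ht := mem_Ioi.1 ht
  rw [Real.rpow_sub ht, mul_inv, mul_comm, ← mul_div_assoc, div_eq_mul_inv]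
  norm_cast
  exact mul_le_mul_of_nonneg_right (sig_inv_le ht) (by positivity)

theorem sig_inv_cube_le (ht : 0 < t) :
    (sig ν ε t ^ 3)⁻¹ ≤ exp |ε| ^ 3 * t ^ (3 * ((1 + ν) / 2)) := by
  have h := pow_le_pow_left₀ (inv_pos.2 (sig_pos ht)).le (sig_inv_le (ν := ν) (ε := ε) ht) 3
  rw [inv_pow, mul_pow, ← Real.rpow_natCast (t ^ _) 3, ← Real.rpow_mul ht.le] at h
  rwa [mul_comm (3 : ℝ)]

theorem rpow_le_sig_inv_cube (ht : 0 < t) :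
    t ^ (3 * ((1 + ν) / 2)) ≤ exp |ε| ^ 3 * (sig ν ε t ^ 3)⁻¹ := by
  have h := pow_le_pow_left₀ (by positivity) (rpow_le_sig_inv (ν := ν) (ε := ε) ht) 3
  rw [mul_pow, inv_pow, ← Real.rpow_natCast (t ^ _) 3, ← Real.rpow_mul ht.le] at h
  rwa [mul_comm (3 : ℝ)]

theorem powerSymbol_leadB :
    PowerSymbol (3 * ((1 + ν) / 2) - 2) ((Ioi 0).indicator (leadB D ν ε)) := by
  refine powerSymbol_indicator fun n => isSymbol_leadB.weight (C := exp |ε| ^ 3) (by positivity)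
    fun t ht => ?_
  have ht := mem_Ioi.1 ht
  rw [Real.rpow_sub ht, mul_inv, mul_comm, ← mul_div_assoc, div_eq_mul_inv]
  norm_cast
  exact mul_le_mul_of_nonneg_right (sig_inv_cube_le ht) (by positivity)

/-- The exponent (1 + ν)/2 - 2 of A is positive exactly when ν > 3, so A can be integrated from zero
with the calculus above. -/
theorem powerSymbol_prim_leadA (hν : 3 < ν) :
    PowerSymbol ((1 + ν) / 2 - 1) (prim ((Ioi 0).indicator (leadA D ν ε))) := by
  have := (powerSymbol_leadA (D := D) (ν := ν) (ε := ε)).prim (by linarith)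
  rwa [show (1 + ν) / 2 - 2 + 1 = (1 + ν) / 2 - 1 by ring] at this

theorem powerSymbol_primA (hν : 3 < ν) : PowerSymbol ((1 + ν) / 2) (primA D ν ε) := by
  have := (powerSymbol_prim_leadA (D := D) (ε := ε) hν).prim (by linarith)
  rwa [show (1 + ν) / 2 - 1 + 1 = (1 + ν) / 2 by ring] at this

theorem powerSymbol_primB (hν : 3 < ν) :
    PowerSymbol (3 * ((1 + ν) / 2) - 1) (primB D ν ε) := by
  have := (powerSymbol_leadB (D := D) (ν := ν) (ε := ε)).prim (by linarith)
  rwa [show 3 * ((1 + ν) / 2) - 2 + 1 = 3 * ((1 + ν) / 2) - 1 by ring] at this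

theorem contDiff_primA (hν : 3 < ν) : ContDiff ℝ (2 : ℕ) (primA D ν ε) :=
  (powerSymbol_primA hν).contDiff (by push_cast; linarith)

theorem contDiff_primB (hν : 3 < ν) : ContDiff ℝ (2 : ℕ) (primB D ν ε) :=
  (powerSymbol_primB hν).contDiff (by push_cast; linarith)

theorem deriv_primA (hν : 3 < ν) :
    deriv (primA D ν ε) = prim ((Ioi 0).indicator (leadA D ν ε)) :=
  funext fun x => ((powerSymbol_prim_leadA hν).hasDerivAt_prim (by linarith) x).deriv

theorem deriv_deriv_primA (hν : 3 < ν) (ht : 0 < t) :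
    deriv (deriv (primA D ν ε)) t = leadA D ν ε t := by
  rw [deriv_primA hν, (powerSymbol_leadA.hasDerivAt_prim (by linarith) t).deriv,
    indicator_of_mem (mem_Ioi.2 ht)]

theorem deriv_primB (hν : 3 < ν) (ht : 0 < t) : deriv (primB D ν ε) t = leadB D ν ε t := by
  rw [primB, (powerSymbol_leadB.hasDerivAt_prim (by linarith) t).deriv,
    indicator_of_mem (mem_Ioi.2 ht)]

/-- The weight of the second correction. -/
def weight₂ (ν ε : ℝ) (q : ℝ × ℝ) : ℝ :=
  q.2 ^ 2 * (1 + sig ν ε q.1 ^ 2 * q.2) / (q.1 ^ 4 * sig ν ε q.1 ^ 3)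

/-- In the sum over both signs the odd Taylor terms cancel, and the even ones are 2𝒜 and r²𝒜'' =
r²A. Hence this combination is a remainder of order four. -/
theorem taylorRem_primA (hν : 3 < ν) {q : ℝ × ℝ} (hq : 0 < q.1) :
    taylorRem (fun i => deriv^[i] (primA D ν ε)) 1 4 q +
      taylorRem (fun i => deriv^[i] (primA D ν ε)) (-1) 4 q =
    primA D ν ε (q.1 + q.2) + primA D ν ε (q.1 - q.2) - 2 * primA D ν ε q.1 -
      q.2 ^ 2 * leadA D ν ε q.1 := by
  simp only [taylorRem, Finset.sum_range_succ, Finset.range_zero, Finset.sum_empty,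
    Function.iterate_succ_apply', Function.iterate_zero, id_eq, deriv_deriv_primA hν hq]
  norm_num [Nat.factorial]
  ring_nf

theorem taylorRem_primB (hν : 3 < ν) {q : ℝ × ℝ} (hq : 0 < q.1) :
    taylorRem (fun i => deriv^[i] (primB D ν ε)) 1 3 q -
      taylorRem (fun i => deriv^[i] (primB D ν ε)) (-1) 3 q =
    2 * ((primB D ν ε (q.1 + q.2) - primB D ν ε (q.1 - q.2)) / 2 - q.2 * leadB D ν ε q.1) := by
  simp only [taylorRem, Finset.sum_range_succ, Finset.range_zero, Finset.sum_empty,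
    Function.iterate_succ_apply', Function.iterate_zero, id_eq, deriv_primB hν hq]
  norm_num [Nat.factorial]
  ring_nf

/-- After division by r the cubic term becomes a multiple of r², smooth but not flat enough for a C²
extension by zero. It is therefore displayed separately. -/
theorem taylorRem_primB_four (q : ℝ × ℝ) :
    taylorRem (fun i => deriv^[i] (primB D ν ε)) 1 3 q -
      taylorRem (fun i => deriv^[i] (primB D ν ε)) (-1) 3 q =
    taylorRem (fun i => deriv^[i] (primB D ν ε)) 1 4 q -
      taylorRem (fun i => deriv^[i] (primB D ν ε)) (-1) 4 q +
      q.2 ^ 3 / 3 * deriv^[3] (primB D ν ε) q.1 := by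
  simp only [taylorRem, Finset.sum_range_succ, Finset.range_zero, Finset.sum_empty]
  norm_num [Nat.factorial]
  ring_nf

theorem derivSeq_primA (hν : 3 < ν) :
    DerivSeq ((1 + ν) / 2) (fun i => deriv^[i] (primA D ν ε)) :=
  derivSeq_iterate (powerSymbol_primA hν).isSymbol

theorem derivSeq_primB (hν : 3 < ν) :
    DerivSeq (3 * ((1 + ν) / 2) - 1) (fun i => deriv^[i] (primB D ν ε)) :=
  derivSeq_iterate (powerSymbol_primB hν).isSymbol

theorem corr₂_eq (hν : 3 < ν) {q : ℝ × ℝ} (hq : 0 < q.1) : corr₂ D ν ε q =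
    q.2⁻¹ * (taylorRem (fun i => deriv^[i] (primA D ν ε)) 1 4 q +
      taylorRem (fun i => deriv^[i] (primA D ν ε)) (-1) 4 q) +
    q.2⁻¹ * (1 / 2 * (taylorRem (fun i => deriv^[i] (primB D ν ε)) 1 3 q -
      taylorRem (fun i => deriv^[i] (primB D ν ε)) (-1) 3 q)) := by
  rw [taylorRem_primA hν hq, taylorRem_primB hν hq, corr₂]
  ring

/-- The remainders of 𝒜 and ℬ give r³t^{(1+ν)/2-4} and r²t^{3(1+ν)/2-4}. Replacing t^{(1+ν)/2} by a
multiple of σ⁻¹ turns these into the two summands of `weight₂`. -/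
theorem isSymbol_corr₂_innerCone (hν : 3 < ν) :
    IsSymbol coneField innerCone (weight₂ ν ε) n (corr₂ D ν ε) := by
  have hO := isOpen_innerCone
  have hR := (isSymbol_comp_snd (isSymbol_inv (n := n))).mono innerCone_subset
  have hA := fun c hc => isSymbol_taylorRem (n := n) (c := c) (derivSeq_primA (D := D) (ε := ε) hν) hc 4
  have hB := fun c hc => isSymbol_taylorRem (n := n) (c := c) (derivSeq_primB (D := D) (ε := ε) hν) hc 3
  have h1 : |(1 : ℝ)| ≤ 1 := by simp
  have h2 : |(-1 : ℝ)| ≤ 1 := by simp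
  have tA := hR.mul ((hA 1 h1).add (hA (-1) h2) hO) hO
  have tB := hR.mul (((hB 1 h1).sub (hB (-1) h2) hO).const_mul hO (1 / 2)) hO
  refine ((tA.weight (C := exp |ε|) (by positivity) fun q hq => ?_).add
    (tB.weight (C := exp |ε| ^ 3) (by positivity) fun q hq => ?_) hO).congr hO
    fun q hq => corr₂_eq hν (innerCone_subset hq).1
  · obtain ⟨ht, hr⟩ := innerCone_subset hq
    have hs := sig_pos (ν := ν) (ε := ε) ht
    have h3 : q.1 ^ ((1 + ν) / 2 - (4 : ℕ)) ≤ exp |ε| * (sig ν ε q.1)⁻¹ / q.1 ^ 4 := by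
      rw [Real.rpow_sub ht, Real.rpow_natCast]
      gcongr
      exact rpow_le_sig_inv ht
    calc q.2⁻¹ * (q.2 ^ 4 * q.1 ^ ((1 + ν) / 2 - (4 : ℕ)))
        ≤ q.2⁻¹ * (q.2 ^ 4 * (exp |ε| * (sig ν ε q.1)⁻¹ / q.1 ^ 4)) := by gcongr
      _ = exp |ε| * (q.2 ^ 2 * (sig ν ε q.1 ^ 2 * q.2) / (q.1 ^ 4 * sig ν ε q.1 ^ 3)) := by
          field_simp
      _ ≤ exp |ε| * weight₂ ν ε q := by
          unfold weight₂
          gcongr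
          linarith
  · obtain ⟨ht, hr⟩ := innerCone_subset hq
    have hs := sig_pos (ν := ν) (ε := ε) ht
    have h3 : q.1 ^ (3 * ((1 + ν) / 2) - 1 - (3 : ℕ)) ≤
        exp |ε| ^ 3 * (sig ν ε q.1 ^ 3)⁻¹ / q.1 ^ 4 := by
      rw [show 3 * ((1 + ν) / 2) - 1 - ((3 : ℕ) : ℝ) = 3 * ((1 + ν) / 2) - (4 : ℕ) by
        push_cast; ring, Real.rpow_sub ht, Real.rpow_natCast]
      gcongr
      exact rpow_le_sig_inv_cube ht
    calc q.2⁻¹ * (q.2 ^ 3 * q.1 ^ (3 * ((1 + ν) / 2) - 1 - (3 : ℕ)))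
        ≤ q.2⁻¹ * (q.2 ^ 3 * (exp |ε| ^ 3 * (sig ν ε q.1 ^ 3)⁻¹ / q.1 ^ 4)) := by gcongr
      _ = exp |ε| ^ 3 * (q.2 ^ 2 * 1 / (q.1 ^ 4 * sig ν ε q.1 ^ 3)) := by
          field_simp
      _ ≤ exp |ε| ^ 3 * weight₂ ν ε q := by
          unfold weight₂
          gcongr
          have : 0 < sig ν ε q.1 ^ 2 * q.2 := by positivity
          linarith

/-- With r comparable to t no cancellation is needed: every term separately has the right size. Two
derivatives are available because both primitives have exponents above two. -/
theorem isSymbol_corr₂_outerCone (hν : 3 < ν) :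
    IsSymbol coneField outerCone (weight₂ ν ε) 2 (corr₂ D ν ε) := by
  have hO := isOpen_outerCone
  have hR := (isSymbol_comp_snd (isSymbol_inv (n := 2))).mono outerCone_subset
  have hr := (isSymbol_snd (n := 2)).mono outerCone_subset
  have hA := fun c hc => (powerSymbol_primA (D := D) (ε := ε) hν).isSymbol_outerCone
    (n := 2) (c := c) (by push_cast; linarith) hc
  have hB := fun c hc => (powerSymbol_primB (D := D) (ε := ε) hν).isSymbol_outerCone
    (n := 2) (c := c) (by push_cast; linarith) hc
  have hlA := (isSymbol_comp_fst (isSymbol_leadA (D := D) (ν := ν) (ε := ε) (n := 2))).mono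
    outerCone_subset
  have hlB := (isSymbol_comp_fst (isSymbol_leadB (D := D) (ν := ν) (ε := ε) (n := 2))).mono
    outerCone_subset
  have h1 : |(1 : ℝ)| ≤ 1 := by simp
  have h2 : |(-1 : ℝ)| ≤ 1 := by simp
  -- The slope c = 0 treats the middle term 𝒜(t) like the two travelling ones.
  have h0 : |(0 : ℝ)| ≤ 1 := by simp
  have wA : ∀ q ∈ outerCone, q.1 ^ ((1 + ν) / 2) ≤ exp |ε| * (sig ν ε q.1)⁻¹ :=
    fun q hq => rpow_le_sig_inv (outerCone_subset hq).1
  have wB : ∀ q ∈ outerCone, q.1 ^ (3 * ((1 + ν) / 2) - 1) ≤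
      exp |ε| ^ 3 * ((sig ν ε q.1 ^ 3)⁻¹ / q.1) := fun q hq => by
    have ht := (outerCone_subset hq).1
    have h3 := div_le_div_of_nonneg_right (rpow_le_sig_inv_cube (ν := ν) (ε := ε) ht) ht.le
    rw [Real.rpow_sub_one ht.ne']
    rwa [mul_div_assoc (exp |ε| ^ 3)] at h3
  have tA : IsSymbol coneField outerCone (fun q => (sig ν ε q.1)⁻¹) 2 (fun q =>
      primA D ν ε (q.1 + 1 * q.2) + primA D ν ε (q.1 + (-1) * q.2) -
        2 * primA D ν ε (q.1 + 0 * q.2) - q.2 ^ 2 * leadA D ν ε q.1) := by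
    refine ((((hA 1 h1).add (hA (-1) h2) hO).sub ((hA 0 h0).const_mul hO 2) hO).weight
      (by positivity) wA).sub (((hr.pow hO 2).mul hlA hO).weight (C := 9) (by norm_num)
      fun q hq => ?_) hO
    have ht := (outerCone_subset hq).1
    have hs := sig_pos (ν := ν) (ε := ε) ht
    have h3 : q.2 ^ 2 ≤ 9 * q.1 ^ 2 := by
      have := (outerCone_subset hq).2
      nlinarith [hq.2]
    rw [mul_inv, ← mul_assoc, ← div_eq_mul_inv (q.2 ^ 2)]
    refine mul_le_mul_of_nonneg_right ?_ (inv_pos.2 hs).le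
    rwa [div_le_iff₀ (by positivity)]
  have tB : IsSymbol coneField outerCone (fun q => (sig ν ε q.1 ^ 3)⁻¹ / q.1) 2 (fun q =>
      1 / 2 * (primB D ν ε (q.1 + 1 * q.2) - primB D ν ε (q.1 + (-1) * q.2)) -
        q.2 * leadB D ν ε q.1) := by
    refine ((((hB 1 h1).sub (hB (-1) h2) hO).const_mul hO (1 / 2)).weight
      (by positivity) wB).sub ((hr.mul hlB hO).weight (C := 3) (by norm_num)
      fun q hq => ?_) hO
    have ht := (outerCone_subset hq).1
    have hs := sig_pos (ν := ν) (ε := ε) ht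
    calc q.2 * (q.1 ^ 2 * sig ν ε q.1 ^ 3)⁻¹ ≤ (3 * q.1) * (q.1 ^ 2 * sig ν ε q.1 ^ 3)⁻¹ := by
          gcongr
          exact hq.2.le
      _ = _ := by field_simp
  refine (((hR.mul tA hO).weight (C := 256) (by norm_num) fun q hq => ?_).add
    ((hR.mul tB hO).weight (C := 64) (by norm_num) fun q hq => ?_) hO).congr hO fun q hq => ?_
  · obtain ⟨ht, hr⟩ := outerCone_subset hq
    have hs := sig_pos (ν := ν) (ε := ε) ht
    have h3 : q.1 ^ 4 ≤ 256 * q.2 ^ 4 := by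
      have := pow_le_pow_left₀ ht.le (show q.1 ≤ 4 * q.2 by linarith [hq.1]) 4
      linarith [this, mul_pow (4 : ℝ) q.2 4]
    calc q.2⁻¹ * (sig ν ε q.1)⁻¹ = q.1 ^ 4 / (q.2 * sig ν ε q.1 * q.1 ^ 4) := by field_simp
      _ ≤ 256 * q.2 ^ 4 / (q.2 * sig ν ε q.1 * q.1 ^ 4) := by gcongr
      _ = 256 * (q.2 ^ 2 * (sig ν ε q.1 ^ 2 * q.2) / (q.1 ^ 4 * sig ν ε q.1 ^ 3)) := by
          field_simp
      _ ≤ 256 * weight₂ ν ε q := by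
          unfold weight₂
          gcongr
          linarith
  · obtain ⟨ht, hr⟩ := outerCone_subset hq
    have hs := sig_pos (ν := ν) (ε := ε) ht
    have h3 : q.1 ^ 3 ≤ 64 * q.2 ^ 3 := by
      have := pow_le_pow_left₀ ht.le (show q.1 ≤ 4 * q.2 by linarith [hq.1]) 3
      linarith [this, mul_pow (4 : ℝ) q.2 3]
    calc q.2⁻¹ * ((sig ν ε q.1 ^ 3)⁻¹ / q.1) = q.1 ^ 3 / (q.2 * sig ν ε q.1 ^ 3 * q.1 ^ 4) := by
          field_simp
      _ ≤ 64 * q.2 ^ 3 / (q.2 * sig ν ε q.1 ^ 3 * q.1 ^ 4) := by gcongr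
      _ = 64 * (q.2 ^ 2 * 1 / (q.1 ^ 4 * sig ν ε q.1 ^ 3)) := by field_simp
      _ ≤ 64 * weight₂ ν ε q := by
          unfold weight₂
          gcongr
          have : 0 < sig ν ε q.1 ^ 2 * q.2 := by positivity
          linarith
  · have hr := (outerCone_subset hq).2.ne'
    simp only [corr₂, one_mul, zero_mul, add_zero, neg_one_mul, ← sub_eq_add_neg]
    field_simp

/-- The aperture 3 leaves open room around the region r ≤ 2t in which the cutoff extension lives. -/
theorem isSymbol_corr₂ (hν : 3 < ν) {t₀ : ℝ} :
    IsSymbol coneField (openCone 3 t₀) (weight₂ ν ε) 2 (corr₂ D ν ε) := by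
  refine IsSymbol.mono (S := innerCone ∪ outerCone) ?_ fun q hq => ?_
  · refine (isSymbol_corr₂_innerCone hν).union (isSymbol_corr₂_outerCone hν) isOpen_innerCone
      isOpen_outerCone fun q hq => ?_
    have hq' : q ∈ quadrant := hq.elim (fun h => innerCone_subset h) fun h => outerCone_subset h
    have hs := sig_pos (ν := ν) (ε := ε) hq'.1
    have h1 := hq'.1
    have h2 := hq'.2
    unfold weight₂
    positivity
  · obtain ⟨h1, h2, h3, h4⟩ := hq
    by_cases h : q.2 < q.1 / 2
    · exact Or.inl ⟨h3, h⟩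
    · exact Or.inr ⟨by linarith, h4⟩

/-- The rescaled radius is an eigenfunction of r∂_r, and t∂_t multiplies it by the bounded symbol ℓ.
-/
theorem isSymbol_comp_xi {m h : ℝ → ℝ} (hh : IsSymbol eulerField (Ioi 0) m n h) :
    IsSymbol coneField quadrant (fun q => m (xi ν ε q)) n (fun q => h (xi ν ε q)) := by
  have hlam : ContDiffOn ℝ n (lam ν ε) (Ioi 0) := by
    refine (isSymbol_sig.pow isOpen_Ioi 2).contDiffOn.congr fun t ht => (sig_sq ht).symm
  have hxi : ContDiffOn ℝ n (xi ν ε) quadrant :=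
    ((hlam.comp contDiffOn_fst fun q hq => hq.1).mul contDiffOn_snd).div_const _
  refine hh.comp (c := fun i q => if i then 1 else ell ν ε q.1) isOpen_Ioi isOpen_quadrant hxi
    (fun q hq => ?_) (fun i => ?_) fun i q hq => ?_
  · have := lam_pos (ν := ν) (ε := ε) hq.1
    have := hq.2
    change 0 < lam ν ε q.1 * q.2 / √3
    positivity
  · cases i
    · simpa using isSymbol_comp_fst isSymbol_ell
    · simpa using IsSymbol.const 1
  · have h1 := hq.1.ne'
    have hd : DifferentiableAt ℝ (xi ν ε) (q.1, q.2) := by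
      have h2 : DifferentiableAt ℝ (lam ν ε) q.1 := (hasDerivAt_lam hq.1).differentiableAt
      have h3 : DifferentiableAt ℝ (fun q : ℝ × ℝ => lam ν ε q.1) (q.1, q.2) :=
        h2.comp (f := Prod.fst) (q.1, q.2) differentiableAt_fst
      unfold xi
      fun_prop
    cases i
    · rw [lieD_false, (hasDerivAt_fst hd).unique
        (((hasDerivAt_lam hq.1).mul_const q.2).div_const (√3))]
      simp only [xi, Bool.false_eq_true, if_false]
      field_simp
    · rw [lieD_true, (hasDerivAt_snd hd).unique
        (((hasDerivAt_id q.2).const_mul (lam ν ε q.1)).div_const (√3))]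
      simp only [xi, if_true]
      ring

end Corrections

/-! ### The equation satisfied by the approximate solution -/

noncomputable section WaveEquation

theorem iteratedDeriv_two_eq {f f' : ℝ → ℝ} {b x : ℝ} (h : ∀ᶠ y in nhds x, HasDerivAt f (f' y) y)
    (h' : HasDerivAt f' b x) : iteratedDeriv 2 f x = b := by
  rw [iteratedDeriv_succ, iteratedDeriv_one]
  have : deriv f =ᶠ[nhds x] f' := by filter_upwards [h] with y hy using hy.deriv
  rw [this.deriv_eq, h'.deriv]

/-- The radial Laplacian in three dimensions. -/
def radialLap (f : ℝ → ℝ) (r : ℝ) : ℝ := iteratedDeriv 2 f r + 2 / r * iteratedDeriv 1 f r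

theorem radialLap_eq {f f' : ℝ → ℝ} {b r : ℝ} (h : ∀ᶠ y in nhds r, HasDerivAt f (f' y) y)
    (h' : HasDerivAt f' b r) : radialLap f r = b + 2 / r * f' r := by
  rw [radialLap, iteratedDeriv_two_eq h h', iteratedDeriv_one, h.self_of_nhds.deriv]

theorem radialLap_add {f g : ℝ → ℝ} {r : ℝ} (hf : ContDiffAt ℝ 2 f r) (hg : ContDiffAt ℝ 2 g r) :
    radialLap (fun ρ => f ρ + g ρ) r = radialLap f r + radialLap g r := by
  simp only [radialLap]
  rw [iteratedDeriv_fun_add (n := 2) hf hg, iteratedDeriv_fun_add (n := 1) (hf.of_le (by norm_num))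
    (hg.of_le (by norm_num))]
  ring

theorem radialLap_const_mul {f : ℝ → ℝ} {r : ℝ} (c : ℝ) (hf : ContDiffAt ℝ 2 f r) :
    radialLap (fun ρ => c * f ρ) r = c * radialLap f r := by
  simp only [radialLap]
  rw [iteratedDeriv_const_mul (n := 2) c hf,
    iteratedDeriv_const_mul (n := 1) c (hf.of_le (by norm_num))]
  ring

theorem radialLap_comp_mul {f : ℝ → ℝ} {r : ℝ} (k : ℝ) (hk : k ≠ 0) (hr : r ≠ 0)
    (hf : ContDiff ℝ 2 f) :
    radialLap (fun ρ => f (k * ρ)) r =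
      k ^ 2 * (deriv (deriv f) (k * r) + 2 / (k * r) * deriv f (k * r)) := by
  have hk1 (y : ℝ) : HasDerivAt (fun ρ => k * ρ) k y := by
    simpa using (hasDerivAt_id y).const_mul k
  have hf1 (y : ℝ) : HasDerivAt f (deriv f y) y := (hf.differentiable (by norm_num) y).hasDerivAt
  have hf2 (y : ℝ) : HasDerivAt (deriv f) (deriv (deriv f) y) y := by
    have : ContDiff ℝ (1 + 1) f := by simpa [one_add_one_eq_two] using hf
    exact ((contDiff_succ_iff_deriv.1 this).2.2.differentiable (by simp) y).hasDerivAt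
  rw [radialLap_eq (f := fun ρ => f (k * ρ)) (f' := fun ρ => deriv f (k * ρ) * k)
    (Filter.Eventually.of_forall fun y => (hf1 (k * y)).comp y (hk1 y))
    (((hf2 (k * r)).comp r (hk1 r)).mul_const k)]
  field_simp

theorem radialLap_affine (a b : ℝ) {r : ℝ} : radialLap (fun ρ => a * ρ + b) r = 2 * a / r := by
  have h (y : ℝ) : HasDerivAt (fun ρ => a * ρ + b) a y := by
    simpa using ((hasDerivAt_id y).const_mul a).add_const b
  rw [radialLap_eq (f' := fun _ => a) (Filter.Eventually.of_forall h) (hasDerivAt_const r a)]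
  ring

theorem radialLap_div {Y Y' : ℝ → ℝ} {b r : ℝ} (hr : r ≠ 0) (h : ∀ y, HasDerivAt Y (Y' y) y)
    (h' : HasDerivAt Y' b r) : radialLap (fun ρ => Y ρ / ρ) r = b / r := by
  have h1 : ∀ᶠ y in nhds r, HasDerivAt (fun ρ => Y ρ / ρ) (Y' y / y - Y y / y ^ 2) y := by
    filter_upwards [isOpen_ne.mem_nhds hr] with y hy
    refine ((h y).div (hasDerivAt_id y) hy).congr_deriv ?_
    simp only [id_eq]
    field_simp
  have h2 : HasDerivAt (fun y => Y' y / y - Y y / y ^ 2)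
      (b / r - 2 * Y' r / r ^ 2 + 2 * Y r / r ^ 3) r := by
    refine ((h'.div (hasDerivAt_id r) hr).sub
      ((h r).div (hasDerivAt_pow 2 r) (pow_ne_zero 2 hr))).congr_deriv ?_
    simp only [id_eq]
    field_simp
    ring
  rw [radialLap_eq h1 h2]
  field_simp
  ring

theorem radialLap_ground {x : ℝ} (hx : x ≠ 0) :
    deriv (deriv ground) x + 2 / x * deriv ground x = -3 * ground x ^ 5 := by
  have h1 : deriv ground = fun x => -x * ground x ^ 3 := funext fun x => (hasDerivAt_ground x).deriv
  have h2 : HasDerivAt (fun x => -x * ground x ^ 3)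
      (-1 * ground x ^ 3 + -x * (3 * ground x ^ 2 * (-x * ground x ^ 3))) x := by
    have := (hasDerivAt_id x).neg.mul ((hasDerivAt_ground x).pow 3)
    exact this.congr_deriv (by simp)
  rw [h1, h2.deriv]
  field_simp
  linear_combination (3 * ground x ^ 3) * ground_sq x

variable {D : ProfileData} {ν ε : ℝ} {t r : ℝ}

theorem hasDerivAt_xi (ht : 0 < t) :
    HasDerivAt (fun s => xi ν ε (s, r)) (ell ν ε t / t * xi ν ε (t, r)) t := by
  refine (((hasDerivAt_lam ht).mul_const r).div_const (√3)).congr_deriv ?_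
  simp only [xi]
  ring

/-- This is the source of the operator 1/2 + x d/dx: the factor 1/2 comes from σ = √λ, the Euler
derivative from the rescaled radius. -/
theorem hasDerivAt_sig_mul {f : ℝ → ℝ} {f' : ℝ} (ht : 0 < t)
    (hf : HasDerivAt f f' (xi ν ε (t, r))) :
    HasDerivAt (fun s => sig ν ε s * f (xi ν ε (s, r)))
      (ell ν ε t / t * (sig ν ε t * (1 / 2 * f (xi ν ε (t, r)) + xi ν ε (t, r) * f'))) t := by
  refine ((hasDerivAt_sig ht).mul (hf.comp t (hasDerivAt_xi ht))).congr_deriv ?_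
  simp only [Function.comp]
  field_simp

theorem bulk_eq (q : ℝ × ℝ) : bulk ν ε q.1 q.2 = sig ν ε q.1 * ground (xi ν ε q) := by
  rw [bulk, W_eq_ground]; rfl

theorem hasDerivAt_source₁ (x : ℝ) :
    HasDerivAt source₁ (-x * ground x ^ 3 - 3 / 2 * (1 - x ^ 2) * (x * ground x ^ 5)) x := by
  refine ((((hasDerivAt_pow 2 x).const_sub 1).const_mul (1 / 2)).mul
    ((hasDerivAt_ground x).pow 3)).congr_deriv ?_
  simp
  ring

theorem iteratedDeriv_two_bulk (ht : 0 < t) :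
    iteratedDeriv 2 (fun s => bulk ν ε s r) t = sig ν ε t / t ^ 2 *
      (omega₁ ν ε t * source₁ (xi ν ε (t, r)) + omega₂ ν ε t * source₂ (xi ν ε (t, r))) := by
  have h1 : ∀ s, 0 < s → HasDerivAt (fun s => bulk ν ε s r)
      (ell ν ε s / s * (sig ν ε s * source₁ (xi ν ε (s, r)))) s := fun s hs => by
    have h := hasDerivAt_sig_mul hs (hasDerivAt_ground (xi ν ε (s, r)))
    refine (h.congr_of_eventuallyEq (Filter.Eventually.of_forall fun s =>
      bulk_eq (s, r))).congr_deriv ?_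
    rw [source₁]
    linear_combination (-ell ν ε s / s * sig ν ε s * ground (xi ν ε (s, r)) / 2) *
      ground_sq (xi ν ε (s, r))
  have h2 : HasDerivAt (fun s => ell ν ε s / s) (omega₁ ν ε t / t ^ 2) t := by
    refine ((hasDerivAt_ell ht).div (hasDerivAt_id t) ht.ne').congr_deriv ?_
    simp only [omega₁, id_eq]
    field_simp
  rw [iteratedDeriv_two_eq (Filter.eventually_of_mem (Ioi_mem_nhds ht) h1)
    (h2.mul (hasDerivAt_sig_mul ht (hasDerivAt_source₁ _)))]
  simp only [omega₂, source₂, source₁]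
  field_simp
  linear_combination (-4 * sig ν ε t * ell ν ε t ^ 2 * ground (xi ν ε (t, r)) ^ 3 *
    (1 - 5 * xi ν ε (t, r) ^ 2)) * ground_sq (xi ν ε (t, r))

theorem contDiffAt_xi {m : ℕ} {f : ℝ → ℝ} (hf : ContDiff ℝ m f) (ht : 0 < t) :
    ContDiffAt ℝ m (fun s => sig ν ε s * f (xi ν ε (s, r))) t := by
  have h1 : ContDiffAt ℝ m (sig ν ε) t := isSymbol_sig.contDiffOn.contDiffAt (Ioi_mem_nhds ht)
  have h2 : ContDiffAt ℝ m (lam ν ε) t :=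
    ((isSymbol_sig.pow isOpen_Ioi 2).contDiffOn.congr fun t ht => (sig_sq ht).symm).contDiffAt
      (Ioi_mem_nhds ht)
  exact h1.mul (hf.contDiffAt.comp t ((h2.mul contDiffAt_const).div_const _))

/-- The numerator of `wavePart`. -/
def waveNum (D : ProfileData) (ν ε t r : ℝ) : ℝ :=
  primA D ν ε (t + r) + primA D ν ε (t - r) - 2 * primA D ν ε t +
    (primB D ν ε (t + r) - primB D ν ε (t - r)) / 2

theorem hasDerivAt_of_contDiff_two {f : ℝ → ℝ} (hf : ContDiff ℝ (2 : ℕ) f) (x : ℝ) :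
    HasDerivAt f (deriv f x) x ∧ HasDerivAt (deriv f) (deriv (deriv f) x) x := by
  refine ⟨(hf.differentiable (by norm_num) x).hasDerivAt, ?_⟩
  have : ContDiff ℝ (1 + 1) f := by simpa [one_add_one_eq_two] using hf
  exact ((contDiff_succ_iff_deriv.1 this).2.2.differentiable (by simp) x).hasDerivAt

theorem waveNum_snd (hν : 3 < ν) : ∃ Y' : ℝ → ℝ, (∀ y, HasDerivAt (waveNum D ν ε t) (Y' y) y) ∧
    HasDerivAt Y' (deriv (deriv (primA D ν ε)) (t + r) + deriv (deriv (primA D ν ε)) (t - r) +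
      (deriv (deriv (primB D ν ε)) (t + r) - deriv (deriv (primB D ν ε)) (t - r)) / 2) r := by
  have hA := hasDerivAt_of_contDiff_two (contDiff_primA (D := D) (ε := ε) hν)
  have hB := hasDerivAt_of_contDiff_two (contDiff_primB (D := D) (ε := ε) hν)
  have hp (y : ℝ) : HasDerivAt (fun ρ => t + ρ) 1 y := (hasDerivAt_id y).const_add t
  have hm (y : ℝ) : HasDerivAt (fun ρ => t - ρ) (-1) y := (hasDerivAt_id y).const_sub t
  refine ⟨fun ρ => deriv (primA D ν ε) (t + ρ) - deriv (primA D ν ε) (t - ρ) +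
    (deriv (primB D ν ε) (t + ρ) + deriv (primB D ν ε) (t - ρ)) / 2, fun y => ?_, ?_⟩
  · refine (((((hA _).1.comp y (hp y)).add ((hA _).1.comp y (hm y))).sub_const _).add
      ((((hB _).1.comp y (hp y)).sub ((hB _).1.comp y (hm y))).div_const 2)).congr_deriv ?_
    ring
  · refine ((((hA _).2.comp r (hp r)).sub ((hA _).2.comp r (hm r))).add
      ((((hB _).2.comp r (hp r)).add ((hB _).2.comp r (hm r))).div_const 2)).congr_deriv ?_
    ring

theorem iteratedDeriv_two_waveNum (hν : 3 < ν) (ht : 0 < t) :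
    iteratedDeriv 2 (fun s => waveNum D ν ε s r) t =
      deriv (deriv (primA D ν ε)) (t + r) + deriv (deriv (primA D ν ε)) (t - r) +
      (deriv (deriv (primB D ν ε)) (t + r) - deriv (deriv (primB D ν ε)) (t - r)) / 2 -
      2 * leadA D ν ε t := by
  have hA := hasDerivAt_of_contDiff_two (contDiff_primA (D := D) (ε := ε) hν)
  have hB := hasDerivAt_of_contDiff_two (contDiff_primB (D := D) (ε := ε) hν)
  have hp (y : ℝ) : HasDerivAt (fun s => s + r) 1 y := (hasDerivAt_id y).add_const r
  have hm (y : ℝ) : HasDerivAt (fun s => s - r) 1 y := (hasDerivAt_id y).sub_const r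
  refine iteratedDeriv_two_eq (f' := fun s => deriv (primA D ν ε) (s + r) +
    deriv (primA D ν ε) (s - r) - 2 * deriv (primA D ν ε) s +
    (deriv (primB D ν ε) (s + r) - deriv (primB D ν ε) (s - r)) / 2)
    (Filter.Eventually.of_forall fun y => ?_) ?_
  · refine (((((hA _).1.comp y (hp y)).add ((hA _).1.comp y (hm y))).sub
      ((hA y).1.const_mul 2)).add
      ((((hB _).1.comp y (hp y)).sub ((hB _).1.comp y (hm y))).div_const 2)).congr_deriv ?_
    ring
  · refine (((((hA _).2.comp t (hp t)).add ((hA _).2.comp t (hm t))).sub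
      ((hA t).2.const_mul 2)).add
      ((((hB _).2.comp t (hp t)).sub ((hB _).2.comp t (hm t))).div_const 2)).congr_deriv ?_
    rw [deriv_deriv_primA hν ht]
    ring

theorem contDiff_waveNum (hν : 3 < ν) :
    ContDiff ℝ (2 : ℕ) (fun q : ℝ × ℝ => waveNum D ν ε q.1 q.2) := by
  have hA := contDiff_primA (D := D) (ε := ε) hν
  have hB := contDiff_primB (D := D) (ε := ε) hν
  unfold waveNum
  fun_prop

/-- The approximate solution. -/
def approx (D : ProfileData) (ν ε : ℝ) (q : ℝ × ℝ) : ℝ :=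
  bulk ν ε q.1 q.2 + (corr₁ D ν ε q + corr₂ D ν ε q)

/-- Adding Ar + B to `corr₂` gives the d'Alembert quotient, and subtracting it from `corr₁` leaves
the decaying remainder. The operator is evaluated on this splitting, the sizes on the original one.
-/
theorem approx_eq {q : ℝ × ℝ} (hq : q.2 ≠ 0) :
    approx D ν ε q = bulk ν ε q.1 q.2 + corrDiff D ν ε q + waveNum D ν ε q.1 q.2 / q.2 := by
  rw [approx, corrDiff, corr₂, waveNum]
  field_simp
  ring

theorem isSymbol_corrDiff {n : ℕ} : IsSymbol coneField quadrant
    (fun q => (q.1 ^ 2 * sig ν ε q.1 ^ 3)⁻¹ * logWeight (xi ν ε q)) n (corrDiff D ν ε) := by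
  have hO := isOpen_quadrant
  have h1 := isSymbol_comp_xi (ν := ν) (ε := ε) (D.isProfile₁.isSymbol_sub n)
  have h2 := isSymbol_comp_xi (ν := ν) (ε := ε) (D.isProfile₂.isSymbol_sub n)
  have h3 := (isSymbol_comp_fst ((isSymbol_inv (n := n)).pow isOpen_Ioi 2)).mul
    (isSymbol_comp_fst ((isSymbol_sig_inv (ν := ν) (ε := ε)).pow isOpen_Ioi 3)) hO
  have w1 := isSymbol_comp_fst (isSymbol_omega₁ (ν := ν) (ε := ε) (n := n))
  have w2 := isSymbol_comp_fst (isSymbol_omega₂ (ν := ν) (ε := ε) (n := n))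
  refine (h3.mul (((w1.mul h1 hO).weight_le (w₂ := fun q => logWeight (xi ν ε q)) (by simp)).add
    ((w2.mul h2 hO).weight_le (by simp)) hO) hO).weight_le (fun q hq => le_of_eq ?_) |>.congr hO
    fun q hq => ?_
  · rw [mul_inv, inv_pow, inv_pow]
  · have ht := hq.1
    have hs := sig_pos (ν := ν) (ε := ε) ht
    simp only [corrDiff, corr₁, leadA, leadB, xi, ← sig_sq (ν := ν) (ε := ε) ht]
    field_simp
    ring

theorem isSymbol_corr₁ {n : ℕ} : IsSymbol coneField quadrant
    (fun q => (q.1 ^ 2 * sig ν ε q.1 ^ 3)⁻¹ * xi ν ε q) n (corr₁ D ν ε) := by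
  have hO := isOpen_quadrant
  have h1 := isSymbol_comp_xi (ν := ν) (ε := ε) (D.isProfile₁.isSymbol n)
  have h2 := isSymbol_comp_xi (ν := ν) (ε := ε) (D.isProfile₂.isSymbol n)
  have h3 := (isSymbol_comp_fst ((isSymbol_inv (n := n)).pow isOpen_Ioi 2)).mul
    (isSymbol_comp_fst ((isSymbol_sig_inv (ν := ν) (ε := ε)).pow isOpen_Ioi 3)) hO
  have w1 := isSymbol_comp_fst (isSymbol_omega₁ (ν := ν) (ε := ε) (n := n))
  have w2 := isSymbol_comp_fst (isSymbol_omega₂ (ν := ν) (ε := ε) (n := n))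
  refine (h3.mul (((w1.mul h1 hO).weight_le (w₂ := fun q => xi ν ε q) (by simp)).add
    ((w2.mul h2 hO).weight_le (by simp)) hO) hO).weight_le (fun q hq => le_of_eq ?_) |>.congr hO
    fun q hq => ?_
  · rw [mul_inv, inv_pow, inv_pow]
  · simp only [corr₁, mul_inv, inv_pow]

theorem isSymbol_bulk {n : ℕ} : IsSymbol coneField quadrant
    (fun q => sig ν ε q.1 * (1 + xi ν ε q)⁻¹) n (fun q => bulk ν ε q.1 q.2) :=
  ((isSymbol_comp_fst isSymbol_sig).mul (isSymbol_comp_xi isSymbol_ground)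
    isOpen_quadrant).congr isOpen_quadrant fun q _ => bulk_eq q

/-- Three cancellations occur: the ground state equation against the fifth power of the bulk term,
the profile equations against its second time derivative, and the wave operator on the d'Alembert
quotient against Δ(Ar + B) = 2A/r. -/
theorem quinticOp_approx (hν : 3 < ν) (ht : 0 < t) (hr : 0 < r) :
    quinticOp (fun s ρ => approx D ν ε (s, ρ)) t r =
      dt (dt (corrDiff D ν ε)) (t, r) - 5 * bulk ν ε t r ^ 4 * corr₂ D ν ε (t, r) -
      (corr₁ D ν ε (t, r) + corr₂ D ν ε (t, r)) ^ 2 *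
        (10 * bulk ν ε t r ^ 3 + 10 * (bulk ν ε t r ^ 2 * (corr₁ D ν ε (t, r) + corr₂ D ν ε (t, r))) +
        5 * (bulk ν ε t r * (corr₁ D ν ε (t, r) + corr₂ D ν ε (t, r)) ^ 2) +
        (corr₁ D ν ε (t, r) + corr₂ D ν ε (t, r)) ^ 3) := by
  have hmem : ((t, r) : ℝ × ℝ) ∈ quadrant := ⟨ht, hr⟩
  have hs := sig_pos (ν := ν) (ε := ε) ht
  have hx : 0 < xi ν ε (t, r) := by
    have := lam_pos (ν := ν) (ε := ε) ht
    unfold xi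
    positivity
  -- the time derivative
  have e1 : iteratedDeriv 2 (fun s => approx D ν ε (s, r)) t =
      iteratedDeriv 2 (fun s => bulk ν ε s r) t + dt (dt (corrDiff D ν ε)) (t, r) +
      iteratedDeriv 2 (fun s => waveNum D ν ε s r) t / r := by
    have h1 : ContDiffAt ℝ 2 (fun s => bulk ν ε s r) t :=
      (contDiffAt_xi (m := 2) contDiff_ground ht).congr_of_eventuallyEq
        (Filter.Eventually.of_forall fun s => bulk_eq (s, r))
    have h2 : ContDiffAt ℝ 2 (fun s => corrDiff D ν ε (s, r)) t :=
      ((isSymbol_corrDiff (n := 2)).contDiffOn.contDiffAt (isOpen_quadrant.mem_nhds hmem)).comp t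
        (contDiffAt_id.prodMk contDiffAt_const)
    have h3 : ContDiffAt ℝ 2 (fun s => waveNum D ν ε s r) t :=
      ((contDiff_waveNum hν).comp (contDiff_id.prodMk contDiff_const)).contDiffAt
    have e : (fun s => approx D ν ε (s, r)) = fun s => (bulk ν ε s r + corrDiff D ν ε (s, r)) +
        r⁻¹ * waveNum D ν ε s r := by
      ext s
      rw [approx_eq (q := (s, r)) hr.ne']
      ring
    rw [e, iteratedDeriv_fun_add (n := 2) (h1.add h2) (contDiffAt_const.mul h3),
      iteratedDeriv_fun_add (n := 2) h1 h2, iteratedDeriv_const_mul (n := 2) _ h3,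
      iteratedDeriv_fst isOpen_quadrant (isSymbol_corrDiff (n := 2)).contDiffOn hmem]
    simp only [Function.iterate_succ_apply', Function.iterate_zero, id_eq]
    ring
  -- the radial Laplacian
  obtain ⟨Y', hY1, hY2⟩ := waveNum_snd (D := D) (ε := ε) (t := t) (r := r) hν
  set k : ℝ := lam ν ε t / √3 with hk
  have hk0 : k ≠ 0 := by
    have := lam_pos (ν := ν) (ε := ε) ht
    positivity
  have hkx : k * r = xi ν ε (t, r) := by rw [hk, xi]; ring
  set c : ℝ := (t ^ 2 * sig ν ε t ^ 3)⁻¹ with hc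
  have hG : ContDiff ℝ 2 ground := contDiff_ground
  have hF1 : ContDiff ℝ 2 D.F₁ := by
    exact_mod_cast contDiff_infty.1 D.isProfile₁.contDiff 2
  have hF2 : ContDiff ℝ 2 D.F₂ := by
    exact_mod_cast contDiff_infty.1 D.isProfile₂.contDiff 2
  have hcomp : ∀ {f : ℝ → ℝ}, ContDiff ℝ 2 f → ContDiffAt ℝ 2 (fun ρ => f (k * ρ)) r := fun hf =>
    (hf.comp (contDiff_const.mul contDiff_id)).contDiffAt
  have hwave : ContDiffAt ℝ 2 (fun ρ => waveNum D ν ε t ρ / ρ) r :=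
    ContDiffAt.div ((contDiff_waveNum hν).comp (contDiff_const.prodMk contDiff_id)).contDiffAt
      contDiffAt_id hr.ne'
  have e2 : radialLap (fun ρ => approx D ν ε (t, ρ)) r =
      sig ν ε t * (k ^ 2 * (-3 * ground (xi ν ε (t, r)) ^ 5)) +
      (c * omega₁ ν ε t * (k ^ 2 * (3 * source₁ (xi ν ε (t, r)) -
        15 * ground (xi ν ε (t, r)) ^ 4 * D.F₁ (xi ν ε (t, r)))) +
      c * omega₂ ν ε t * (k ^ 2 * (3 * source₂ (xi ν ε (t, r)) -
        15 * ground (xi ν ε (t, r)) ^ 4 * D.F₂ (xi ν ε (t, r))))) +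
      2 * (-leadA D ν ε t) / r + (deriv (deriv (primA D ν ε)) (t + r) +
        deriv (deriv (primA D ν ε)) (t - r) +
        (deriv (deriv (primB D ν ε)) (t + r) - deriv (deriv (primB D ν ε)) (t - r)) / 2) / r := by
    -- At fixed t the function is split into rescaled profiles, an affine part and a quotient by r,
    -- whose radial Laplacians are all known.
    have e : (fun ρ => approx D ν ε (t, ρ)) =ᶠ[nhds r] fun ρ =>
        ((sig ν ε t * ground (k * ρ) +
          (c * omega₁ ν ε t * D.F₁ (k * ρ) + c * omega₂ ν ε t * D.F₂ (k * ρ))) +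
          (-leadA D ν ε t * ρ + -leadB D ν ε t)) + waveNum D ν ε t ρ / ρ := by
      filter_upwards [isOpen_ne.mem_nhds hr.ne'] with ρ hρ
      rw [approx_eq (q := (t, ρ)) hρ, bulk_eq (t, ρ), corrDiff, corr₁]
      have : k * ρ = xi ν ε (t, ρ) := by rw [hk, xi]; ring
      rw [this]
      ring
    have e3 : radialLap (fun ρ => approx D ν ε (t, ρ)) r = radialLap (fun ρ =>
        ((sig ν ε t * ground (k * ρ) +
          (c * omega₁ ν ε t * D.F₁ (k * ρ) + c * omega₂ ν ε t * D.F₂ (k * ρ))) +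
          (-leadA D ν ε t * ρ + -leadB D ν ε t)) + waveNum D ν ε t ρ / ρ) r := by
      rw [radialLap, e.iteratedDeriv_eq, e.iteratedDeriv_eq]; rfl
    have cF1 := contDiffAt_const (c := c * omega₁ ν ε t).mul (hcomp hF1)
    have cF2 := contDiffAt_const (c := c * omega₂ ν ε t).mul (hcomp hF2)
    have cG := contDiffAt_const (c := sig ν ε t).mul (hcomp hG)
    have cL : ContDiffAt ℝ 2 (fun ρ => -leadA D ν ε t * ρ + -leadB D ν ε t) r := by fun_prop
    rw [e3, radialLap_add ((cG.add (cF1.add cF2)).add cL) hwave,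
      radialLap_add (cG.add (cF1.add cF2)) cL, radialLap_add cG (cF1.add cF2),
      radialLap_add cF1 cF2, radialLap_const_mul _ (hcomp hF1), radialLap_const_mul _ (hcomp hF2),
      radialLap_const_mul _ (hcomp hG), radialLap_affine, radialLap_div hr.ne' hY1 hY2,
      radialLap_comp_mul k hk0 hr.ne' hG, radialLap_comp_mul k hk0 hr.ne' hF1,
      radialLap_comp_mul k hk0 hr.ne' hF2, hkx, radialLap_ground hx.ne']
    rw [eq_sub_of_add_eq (D.isProfile₁.ode _ hx), eq_sub_of_add_eq (D.isProfile₂.ode _ hx)]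
  have e4 : quinticOp (fun s ρ => approx D ν ε (s, ρ)) t r =
      iteratedDeriv 2 (fun s => approx D ν ε (s, r)) t -
      radialLap (fun ρ => approx D ν ε (t, ρ)) r - approx D ν ε (t, r) ^ 5 := by
    simp only [quinticOp, pderiv, radialLap, iteratedDeriv_zero]
    ring
  rw [e4, e1, e2, iteratedDeriv_two_bulk ht, iteratedDeriv_two_waveNum hν ht, approx,
    bulk_eq (t, r), corr₁]
  have hk2 : k ^ 2 = sig ν ε t ^ 4 / 3 := by
    rw [hk, div_pow, Real.sq_sqrt (by norm_num), ← sig_sq ht]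
    ring
  rw [hk2, hc]
  generalize corr₂ D ν ε (t, r) = v
  generalize D.F₁ (xi ν ε (t, r)) = f1
  generalize D.F₂ (xi ν ε (t, r)) = f2
  field_simp
  ring

end WaveEquation

/-! ### Size of the corrections and of the error -/

noncomputable section Estimates

variable {D : ProfileData} {ν ε : ℝ} {n : ℕ} {S : Set (ℝ × ℝ)} {t₀ : ℝ}

/-- The weight `√λ μ^{-2} R`. -/
def weightS (ν ε : ℝ) (q : ℝ × ℝ) : ℝ :=
  √(lam ν ε q.1) * (mu ν ε q.1 ^ 2)⁻¹ * (lam ν ε q.1 * q.2)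

/-- The weight `μ^{-2} log (R + 2) / (R + 1)`. -/
def weightE (ν ε : ℝ) (q : ℝ × ℝ) : ℝ :=
  (mu ν ε q.1 ^ 2)⁻¹ * (log (lam ν ε q.1 * q.2 + 2) / (lam ν ε q.1 * q.2 + 1))

theorem weightS_eq {q : ℝ × ℝ} (hq : 0 < q.1) :
    weightS ν ε q = (q.1 ^ 2 * sig ν ε q.1 ^ 3)⁻¹ * (sig ν ε q.1 ^ 2 * q.2) := by
  have hs := sig_pos (ν := ν) (ε := ε) hq
  rw [weightS, mu_eq hq, ← sig_sq hq, Real.sqrt_sq hs.le]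
  field_simp

theorem weightE_eq {q : ℝ × ℝ} (hq : 0 < q.1) :
    weightE ν ε q = (q.1 ^ 2 * sig ν ε q.1 ^ 4)⁻¹ * logWeight (sig ν ε q.1 ^ 2 * q.2) := by
  rw [weightE, mu_eq hq, ← sig_sq hq, logWeight]
  ring

theorem xi_eq {q : ℝ × ℝ} (hq : 0 < q.1) : xi ν ε q = sig ν ε q.1 ^ 2 * q.2 / √3 := by
  rw [xi, sig_sq hq]

theorem div_sqrt_three_bounds {x : ℝ} (hx : 0 ≤ x) : x / 2 ≤ x / √3 ∧ x / √3 ≤ x := by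
  have h1 : √3 ≤ 2 := Real.sqrt_le_iff.2 ⟨by norm_num, by norm_num⟩
  have h2 : 1 ≤ √3 := Real.one_le_sqrt.2 (by norm_num)
  exact ⟨div_le_div_of_nonneg_left hx (by linarith) h1, div_le_self hx h2⟩

/-- The facts about a point of the cone that enter the comparison of weights. -/
theorem cone_facts (hν : 0 < ν) (ht₀ : t₀ ≤ 1) {q : ℝ × ℝ} (hq : q ∈ openCone 3 t₀) :
    0 < q.1 ∧ 0 < q.2 ∧ q.2 < 3 * q.1 ∧ 0 < sig ν ε q.1 ∧
      exp (-|ε|) ^ 2 ≤ q.1 * sig ν ε q.1 ^ 2 := by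
  obtain ⟨h1, h2, h3, h4⟩ := hq
  refine ⟨h1, h3, h4, sig_pos h1, ?_⟩
  rw [← mu_eq h1]
  exact exp_le_mu hν h1 (h2.trans_le ht₀)

theorem weight_corr₂_le (hν : 0 < ν) (ht₀ : t₀ ≤ 1) : ∃ C, 0 ≤ C ∧ ∀ q ∈ openCone 3 t₀,
    weight₂ ν ε q ≤ C * weightS ν ε q := by
  -- With b a lower bound for μ, the inequality r < 3t gives r ≤ 3b⁻¹tμ and λr² ≤ 9tμ.
  refine ⟨3 * (exp (-|ε|) ^ 2)⁻¹ + 9, by positivity, fun q hq => ?_⟩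
  obtain ⟨ht, hr, hrt, hs, hc⟩ := cone_facts (ε := ε) hν ht₀ hq
  rw [weightS_eq ht, weight₂]
  set s := sig ν ε q.1
  set b := exp (-|ε|) ^ 2
  have hb : 0 < b := by positivity
  have h1 : 1 ≤ b⁻¹ * (q.1 * s ^ 2) := by
    rw [inv_mul_eq_div, one_le_div hb]; exact hc
  have h2 : q.2 * (1 + s ^ 2 * q.2) ≤ (3 * b⁻¹ + 9) * (q.1 ^ 2 * s ^ 2) := by
    have h3 : q.2 ≤ 3 * b⁻¹ * (q.1 ^ 2 * s ^ 2) := by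
      calc q.2 ≤ 3 * q.1 * 1 := by linarith
        _ ≤ 3 * q.1 * (b⁻¹ * (q.1 * s ^ 2)) := by gcongr
        _ = _ := by ring
    have h4 : q.2 * (s ^ 2 * q.2) ≤ 9 * (q.1 ^ 2 * s ^ 2) := by
      have : q.2 ^ 2 ≤ (3 * q.1) ^ 2 := pow_le_pow_left₀ hr.le hrt.le 2
      nlinarith [mul_le_mul_of_nonneg_left this (sq_nonneg s)]
    linarith
  calc q.2 ^ 2 * (1 + s ^ 2 * q.2) / (q.1 ^ 4 * s ^ 3)
      = q.2 * (q.2 * (1 + s ^ 2 * q.2)) / (q.1 ^ 4 * s ^ 3) := by ring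
    _ ≤ q.2 * ((3 * b⁻¹ + 9) * (q.1 ^ 2 * s ^ 2)) / (q.1 ^ 4 * s ^ 3) := by gcongr
    _ = _ := by field_simp

theorem isSymbol_corr (hν : 0 < ν) (ht₀ : t₀ ≤ 1) (hS : IsOpen S) (hSt : S ⊆ openCone 3 t₀)
    (h : IsSymbol coneField S (weight₂ ν ε) n (corr₂ D ν ε)) :
    IsSymbol coneField S (weightS ν ε) n (fun q => corr₁ D ν ε q + corr₂ D ν ε q) := by
  have hQ : S ⊆ quadrant := fun q hq => ⟨(hSt hq).1, (hSt hq).2.2.1⟩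
  obtain ⟨C, hC, hw⟩ := weight_corr₂_le (ε := ε) hν ht₀
  refine ((isSymbol_corr₁.mono hQ).weight_le fun q hq => ?_).add
    (h.weight hC fun q hq => hw q (hSt hq)) hS
  obtain ⟨ht, hr, hrt, hs, hc⟩ := cone_facts (ε := ε) hν ht₀ (hSt hq)
  rw [weightS_eq ht, xi_eq ht]
  have := (div_sqrt_three_bounds (show 0 ≤ sig ν ε q.1 ^ 2 * q.2 by positivity)).2
  gcongr

theorem logWeight_ge {x : ℝ} (hx : 0 ≤ x) : (1 + x)⁻¹ ≤ 2 * logWeight x := by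
  rw [logWeight, ← one_div, ← mul_div_assoc, add_comm x 1]
  gcongr
  linarith [log_two_le hx]

/-- The expression of the normalized error through the corrections. -/
def errorExpr (D : ProfileData) (ν ε : ℝ) (q : ℝ × ℝ) : ℝ :=
  q.1 ^ 2 * (sig ν ε q.1)⁻¹ * (dt (dt (corrDiff D ν ε)) q -
    5 * bulk ν ε q.1 q.2 ^ 4 * corr₂ D ν ε q -
    (corr₁ D ν ε q + corr₂ D ν ε q) ^ 2 * (10 * bulk ν ε q.1 q.2 ^ 3 +
      10 * (bulk ν ε q.1 q.2 ^ 2 * (corr₁ D ν ε q + corr₂ D ν ε q)) +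
      5 * (bulk ν ε q.1 q.2 * (corr₁ D ν ε q + corr₂ D ν ε q) ^ 2) +
      (corr₁ D ν ε q + corr₂ D ν ε q) ^ 3))

theorem isSymbol_bulk_cone (hν : 0 < ν) (ht₀ : t₀ ≤ 1) (hSt : S ⊆ openCone 3 t₀) :
    IsSymbol coneField S (fun q => sig ν ε q.1 * (1 + sig ν ε q.1 ^ 2 * q.2)⁻¹) n
      (fun q => bulk ν ε q.1 q.2) := by
  have hQ : S ⊆ quadrant := fun q hq => ⟨(hSt hq).1, (hSt hq).2.2.1⟩
  refine (isSymbol_bulk.mono hQ).weight (C := 2) (by norm_num) fun q hq => ?_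
  obtain ⟨ht, hr, hrt, hs, hc⟩ := cone_facts (ε := ε) hν ht₀ (hSt hq)
  have hx : 0 ≤ sig ν ε q.1 ^ 2 * q.2 := by positivity
  have h1 := (div_sqrt_three_bounds hx).1
  rw [xi_eq ht]
  calc sig ν ε q.1 * (1 + sig ν ε q.1 ^ 2 * q.2 / √3)⁻¹
      ≤ sig ν ε q.1 * ((1 + sig ν ε q.1 ^ 2 * q.2) / 2)⁻¹ := by
        gcongr
        linarith
    _ = _ := by field_simp

/-- The factor t² pays for the two time derivatives of `corrDiff`, whose weight is already the
required one. The potential and nonlinear terms are both μ⁻²O(R²/(1 + R)³), hence μ⁻²O(1/(1 + R)).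
-/
theorem isSymbol_errorExpr (hν : 0 < ν) (ht₀ : t₀ ≤ 1) (hS : IsOpen S) (hSt : S ⊆ openCone 3 t₀)
    (h : IsSymbol coneField S (weight₂ ν ε) n (corr₂ D ν ε)) :
    IsSymbol coneField S (weightE ν ε) n (errorExpr D ν ε) := by
  have hQ : S ⊆ quadrant := fun q hq => ⟨(hSt hq).1, (hSt hq).2.2.1⟩
  have hpre := (((isSymbol_fst (n := n)).pow isOpen_quadrant 2).mul
    (isSymbol_comp_fst (isSymbol_sig_inv (ν := ν) (ε := ε))) isOpen_quadrant).mono hQ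
  have hb := isSymbol_bulk_cone (ν := ν) (ε := ε) (n := n) hν ht₀ hSt
  have hv := isSymbol_corr hν ht₀ hS hSt h
  -- the linear error of the first correction
  have t1 := ((((isSymbol_corrDiff (D := D) (ν := ν) (ε := ε) (n := n + 2)).dt isOpen_quadrant
    Subset.rfl).dt isOpen_quadrant Subset.rfl).mono hQ)
  have e1 := (hpre.mul t1 hS).weight (w₂ := weightE ν ε) (C := 2) (by norm_num) fun q hq => by
    obtain ⟨ht, hr, hrt, hs, hc⟩ := cone_facts (ε := ε) hν ht₀ (hSt hq)
    have hx : 0 ≤ sig ν ε q.1 ^ 2 * q.2 := by positivity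
    rw [weightE_eq ht, xi_eq ht]
    obtain ⟨h1, h2⟩ := div_sqrt_three_bounds hx
    have h3 : logWeight (sig ν ε q.1 ^ 2 * q.2 / √3) ≤ 2 * logWeight (sig ν ε q.1 ^ 2 * q.2) := by
      rw [logWeight, logWeight, ← mul_div_assoc, div_le_div_iff₀ (by linarith) (by linarith)]
      have h4 : log (sig ν ε q.1 ^ 2 * q.2 / √3 + 2) ≤ log (sig ν ε q.1 ^ 2 * q.2 + 2) :=
        Real.log_le_log (by linarith) (by linarith)
      have h5 := log_two_le hx
      nlinarith
    calc _ = (q.1 ^ 2 * sig ν ε q.1 ^ 4)⁻¹ * logWeight (sig ν ε q.1 ^ 2 * q.2 / √3) := by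
          field_simp
      _ ≤ (q.1 ^ 2 * sig ν ε q.1 ^ 4)⁻¹ * (2 * logWeight (sig ν ε q.1 ^ 2 * q.2)) := by gcongr
      _ = _ := by ring
  -- the potential term
  have e2 := (hpre.mul ((hb.pow hS 4).mul h hS) hS).weight (w₂ := weightE ν ε) (C := 2)
    (by norm_num) fun q hq => by
    obtain ⟨ht, hr, hrt, hs, hc⟩ := cone_facts (ε := ε) hν ht₀ (hSt hq)
    have hx : 0 ≤ sig ν ε q.1 ^ 2 * q.2 := by positivity
    rw [weightE_eq ht, weight₂]
    calc _ = (q.1 ^ 2 * sig ν ε q.1 ^ 4)⁻¹ * ((sig ν ε q.1 ^ 2 * q.2) ^ 2 /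
          (1 + sig ν ε q.1 ^ 2 * q.2) ^ 2 * (1 + sig ν ε q.1 ^ 2 * q.2)⁻¹) := by
          field_simp
      _ ≤ (q.1 ^ 2 * sig ν ε q.1 ^ 4)⁻¹ * (1 * (1 + sig ν ε q.1 ^ 2 * q.2)⁻¹) := by
          gcongr
          rw [← div_pow]
          exact pow_le_one₀ (by positivity) (by rw [div_le_one (by positivity)]; linarith)
      _ ≤ (q.1 ^ 2 * sig ν ε q.1 ^ 4)⁻¹ * (2 * logWeight (sig ν ε q.1 ^ 2 * q.2)) := by
          rw [one_mul]
          gcongr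
          exact logWeight_ge hx
      _ = _ := by ring
  -- the nonlinear terms
  have hv1 : IsSymbol coneField S (fun q => sig ν ε q.1 * (1 + sig ν ε q.1 ^ 2 * q.2)⁻¹) n
      (fun q => corr₁ D ν ε q + corr₂ D ν ε q) := by
    -- From R ≤ 3μ and a lower bound b for μ one gets 1 + R ≤ (b⁻¹ + 3)μ. Both factors μ⁻¹ are
    -- traded for (1 + R)⁻¹, so the corrections are no larger than the weight of the bulk term.
    refine hv.weight (C := ((exp (-|ε|) ^ 2)⁻¹ + 3) ^ 2) (by positivity) fun q hq => ?_
    obtain ⟨ht, hr, hrt, hs, hc⟩ := cone_facts (ε := ε) hν ht₀ (hSt hq)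
    rw [weightS_eq ht]
    set s := sig ν ε q.1
    set b := exp (-|ε|) ^ 2
    have hb0 : 0 < b := by positivity
    have h1 : 1 ≤ b⁻¹ * (q.1 * s ^ 2) := by
      rw [inv_mul_eq_div, one_le_div hb0]; exact hc
    have h2 : 1 + s ^ 2 * q.2 ≤ (b⁻¹ + 3) * (q.1 * s ^ 2) := by
      have : s ^ 2 * q.2 ≤ s ^ 2 * (3 * q.1) := by gcongr
      linarith
    calc (q.1 ^ 2 * s ^ 3)⁻¹ * (s ^ 2 * q.2)
        ≤ (q.1 ^ 2 * s ^ 3)⁻¹ * (1 + s ^ 2 * q.2) := by gcongr; linarith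
      _ = (q.1 ^ 2 * s ^ 3)⁻¹ * (1 + s ^ 2 * q.2) ^ 2 * (1 + s ^ 2 * q.2)⁻¹ := by field_simp
      _ ≤ (q.1 ^ 2 * s ^ 3)⁻¹ * ((b⁻¹ + 3) * (q.1 * s ^ 2)) ^ 2 * (1 + s ^ 2 * q.2)⁻¹ := by
          gcongr
      _ = _ := by field_simp
  have hcub : IsSymbol coneField S
      (fun q => (sig ν ε q.1 * (1 + sig ν ε q.1 ^ 2 * q.2)⁻¹) ^ 3) n (fun q =>
      10 * bulk ν ε q.1 q.2 ^ 3 +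
      10 * (bulk ν ε q.1 q.2 ^ 2 * (corr₁ D ν ε q + corr₂ D ν ε q)) +
      5 * (bulk ν ε q.1 q.2 * (corr₁ D ν ε q + corr₂ D ν ε q) ^ 2) +
      (corr₁ D ν ε q + corr₂ D ν ε q) ^ 3) := by
    refine (((((hb.pow hS 3).const_mul hS 10).add ?_ hS).add ?_ hS).add (hv1.pow hS 3) hS)
    · exact (((hb.pow hS 2).mul hv1 hS).weight_le fun q _ => by rw [← pow_succ]).const_mul hS 10
    · exact ((hb.mul (hv1.pow hS 2) hS).weight_le fun q _ => by
        rw [← pow_succ']).const_mul hS 5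
  have e3 := (hpre.mul ((hv.pow hS 2).mul hcub hS) hS).weight (w₂ := weightE ν ε) (C := 2)
    (by norm_num) fun q hq => by
    obtain ⟨ht, hr, hrt, hs, hc⟩ := cone_facts (ε := ε) hν ht₀ (hSt hq)
    have hx : 0 ≤ sig ν ε q.1 ^ 2 * q.2 := by positivity
    rw [weightE_eq ht, weightS_eq ht]
    calc _ = (q.1 ^ 2 * sig ν ε q.1 ^ 4)⁻¹ * ((sig ν ε q.1 ^ 2 * q.2) ^ 2 /
          (1 + sig ν ε q.1 ^ 2 * q.2) ^ 2 * (1 + sig ν ε q.1 ^ 2 * q.2)⁻¹) := by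
          field_simp
      _ ≤ (q.1 ^ 2 * sig ν ε q.1 ^ 4)⁻¹ * (1 * (1 + sig ν ε q.1 ^ 2 * q.2)⁻¹) := by
          gcongr
          rw [← div_pow]
          exact pow_le_one₀ (by positivity) (by rw [div_le_one (by positivity)]; linarith)
      _ ≤ (q.1 ^ 2 * sig ν ε q.1 ^ 4)⁻¹ * (2 * logWeight (sig ν ε q.1 ^ 2 * q.2)) := by
          rw [one_mul]
          gcongr
          exact logWeight_ge hx
      _ = _ := by ring
  refine ((e1.sub (e2.const_mul hS 5) hS).sub e3 hS).congr hS fun q hq => ?_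
  simp only [errorExpr]
  ring

theorem lam_rpow {t : ℝ} (ht : 0 < t) : lam ν ε t ^ (-(1 / 2) : ℝ) = (sig ν ε t)⁻¹ := by
  rw [Real.rpow_neg (lam_pos ht).le, ← Real.sqrt_eq_rpow]; rfl

theorem normError_approx (hν : 3 < ν) {t r : ℝ} (h : ((t, r) : ℝ × ℝ) ∈ quadrant) :
    normError ν ε (fun s ρ => approx D ν ε (s, ρ)) t r = errorExpr D ν ε (t, r) := by
  rw [normError, quinticOp_approx hν h.1 h.2, lam_rpow h.1, errorExpr]

theorem isOpen_openCone (c : ℝ) : IsOpen (openCone c t₀) :=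
  (isOpen_lt continuous_const continuous_fst).inter
    ((isOpen_lt continuous_fst continuous_const).inter
    ((isOpen_lt continuous_const continuous_snd).inter
      (isOpen_lt continuous_snd (continuous_const.mul continuous_fst))))

theorem solutionBound_approx (hν : 0 < ν) (ht₀ : t₀ ≤ 1) (hS : IsOpen S)
    (hSt : S ⊆ openCone 3 t₀) {k j : ℕ}
    (h : IsSymbol coneField S (weight₂ ν ε) (k + j) (corr₂ D ν ε)) :
    SolutionBound ν ε (fun s ρ => approx D ν ε (s, ρ)) k j S := by
  have hQ : S ⊆ quadrant := fun q hq => ⟨(hSt hq).1, (hSt hq).2.2.1⟩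
  have hv := isSymbol_corr hν ht₀ hS hSt h
  obtain ⟨C, hC, hb⟩ := hv.pderiv_bound hS hQ
  refine ⟨C, fun t r htr => ?_⟩
  have e : pderiv k j (fun s ρ => approx D ν ε (s, ρ)) t r = pderiv k j (bulk ν ε) t r +
      pderiv k j (fun s ρ => corr₁ D ν ε (s, ρ) + corr₂ D ν ε (s, ρ)) t r :=
    pderiv_add hS (isSymbol_bulk.mono hQ).contDiffOn hv.contDiffOn htr
  rw [e, add_sub_cancel_left]
  refine (hb t r htr).trans (le_of_eq ?_)
  simp only [weightS]
  ring

theorem errorBound_approx (hν : 3 < ν) (ht₀ : t₀ ≤ 1) (hS : IsOpen S)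
    (hSt : S ⊆ openCone 3 t₀) {k j : ℕ}
    (h : IsSymbol coneField S (weight₂ ν ε) (k + j) (corr₂ D ν ε)) :
    ErrorBound ν ε (fun s ρ => approx D ν ε (s, ρ)) k j S := by
  have hQ : S ⊆ quadrant := fun q hq => ⟨(hSt hq).1, (hSt hq).2.2.1⟩
  have hv := isSymbol_errorExpr (by linarith) ht₀ hS hSt h
  obtain ⟨C, hC, hb⟩ := hv.pderiv_bound hS hQ
  refine ⟨C, fun t r htr => ?_⟩
  rw [pderiv_congr (v := fun s ρ => errorExpr D ν ε (s, ρ)) hS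
    (fun t r htr => normError_approx hν (hQ htr)) htr]
  refine (hb t r htr).trans (le_of_eq ?_)
  simp only [weightE]
  ring

end Estimates

/-! ### Regularity up to the axis r = 0 -/

noncomputable section Regularity

variable {D : ProfileData} {ν ε : ℝ} {n : ℕ}

theorem contDiffOn_comp_fst {h m : ℝ → ℝ} (hh : IsSymbol eulerField (Ioi 0) m n h) :
    ContDiffOn ℝ n (fun q : ℝ × ℝ => h q.1) {q | 0 < q.1} :=
  hh.contDiffOn.comp contDiffOn_fst fun _ hq => hq

theorem contDiffOn_xi : ContDiffOn ℝ n (xi ν ε) {q | 0 < q.1} := by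
  refine ((contDiffOn_comp_fst ((isSymbol_sig (ν := ν) (ε := ε)).pow isOpen_Ioi 2)).mul
    contDiffOn_snd).div_const (√3) |>.congr fun q hq => ?_
  rw [xi_eq hq]

theorem contDiffOn_bulk : ContDiffOn ℝ n (fun q : ℝ × ℝ => bulk ν ε q.1 q.2) {q | 0 < q.1} :=
  ((contDiffOn_comp_fst isSymbol_sig).mul (contDiff_ground.comp_contDiffOn contDiffOn_xi)).congr
    fun q _ => bulk_eq q

theorem contDiffOn_corr₁ : ContDiffOn ℝ n (corr₁ D ν ε) {q | 0 < q.1} := by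
  have h1 := (contDiff_infty.1 D.isProfile₁.contDiff n).comp_contDiffOn
    (contDiffOn_xi (ν := ν) (ε := ε))
  have h2 := (contDiff_infty.1 D.isProfile₂.contDiff n).comp_contDiffOn
    (contDiffOn_xi (ν := ν) (ε := ε))
  have h3 : ContDiffOn ℝ n (fun q : ℝ × ℝ => (q.1 ^ 2 * sig ν ε q.1 ^ 3)⁻¹) {q | 0 < q.1} := by
    refine ContDiffOn.inv (ContDiffOn.mul (by fun_prop)
      ((contDiffOn_comp_fst isSymbol_sig).pow 3)) fun q hq => ?_
    have h1 : 0 < q.1 := hq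
    have := sig_pos (ν := ν) (ε := ε) h1
    positivity
  exact h3.mul (((contDiffOn_comp_fst isSymbol_omega₁).mul h1).add
    ((contDiffOn_comp_fst isSymbol_omega₂).mul h2))

/-- The primitives are C² on the whole line, so nothing happens at r = t, and division by r is
harmless away from the axis. -/
theorem contDiffOn_corr₂_quadrant (hν : 3 < ν) :
    ContDiffOn ℝ (2 : ℕ) (corr₂ D ν ε) quadrant := by
  have h1 := contDiff_waveNum (D := D) (ε := ε) hν
  have h2 : quadrant ⊆ {q : ℝ × ℝ | 0 < q.1} := fun q hq => hq.1
  have hA := (contDiffOn_comp_fst (isSymbol_leadA (D := D) (ν := ν) (ε := ε) (n := 2))).mono h2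
  have hB := (contDiffOn_comp_fst (isSymbol_leadB (D := D) (ν := ν) (ε := ε) (n := 2))).mono h2
  refine ((h1.contDiffOn.sub (((contDiffOn_snd.pow 2).mul hA).add (contDiffOn_snd.mul hB))).div
    contDiffOn_snd fun q hq => hq.2.ne').congr fun q _ => ?_
  simp only [corr₂, waveNum, Pi.div_apply]
  ring

/-- The part of the second correction that vanishes to third order at `r = 0`. -/
def flatPart (D : ProfileData) (ν ε : ℝ) (q : ℝ × ℝ) : ℝ :=
  q.2⁻¹ * (taylorRem (fun i => deriv^[i] (primA D ν ε)) 1 4 q +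
      taylorRem (fun i => deriv^[i] (primA D ν ε)) (-1) 4 q) +
    q.2⁻¹ * (1 / 2 * (taylorRem (fun i => deriv^[i] (primB D ν ε)) 1 4 q -
      taylorRem (fun i => deriv^[i] (primB D ν ε)) (-1) 4 q))

theorem isSymbol_flatPart (hν : 3 < ν) : IsSymbol coneField innerCone
    (fun q => q.2 ^ 3 * (q.1 ^ ((1 + ν) / 2 - 4) + q.1 ^ (3 * ((1 + ν) / 2) - 1 - 4))) n
    (flatPart D ν ε) := by
  have hO := isOpen_innerCone
  have hR := (isSymbol_comp_snd (isSymbol_inv (n := n))).mono innerCone_subset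
  have hA := fun c hc => isSymbol_taylorRem (n := n) (c := c) (derivSeq_primA (D := D) (ε := ε) hν) hc 4
  have hB := fun c hc => isSymbol_taylorRem (n := n) (c := c) (derivSeq_primB (D := D) (ε := ε) hν) hc 4
  have h1 : |(1 : ℝ)| ≤ 1 := by simp
  have h2 : |(-1 : ℝ)| ≤ 1 := by simp
  refine ((hR.mul ((hA 1 h1).add (hA (-1) h2) hO) hO).weight_le fun q hq => ?_).add
    ((hR.mul (((hB 1 h1).sub (hB (-1) h2) hO).const_mul hO (1 / 2)) hO).weight_le fun q hq => ?_) hO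
  all_goals
    obtain ⟨ht, hr⟩ := innerCone_subset hq
    have e (x : ℝ) : q.2⁻¹ * (q.2 ^ 4 * x) = q.2 ^ 3 * x := by field_simp
    rw [e]
    push_cast
    refine mul_le_mul_of_nonneg_left ?_ (by positivity)
  · exact le_add_of_nonneg_right (by positivity)
  · exact le_add_of_nonneg_left (by positivity)

/-- Near the axis `corr₂` is r²ℬ'''(t)/6 plus a part of size r³, which extends by zero to a C²
function on a full neighbourhood of the axis. -/
theorem contDiffOn_corr₂ (hν : 3 < ν) :
    ContDiffOn ℝ (2 : ℕ) (corr₂ D ν ε) {q | 0 < q.1 ∧ 0 ≤ q.2} := by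
  classical
  have hflat : ContDiffOn ℝ (2 : ℕ) (fun q : ℝ × ℝ => if q.2 ≤ 0 then 0 else flatPart D ν ε q)
      {q | 0 < q.1 ∧ q.2 < q.1 / 2} := by
    refine contDiffOn_of_flat (m := 3) (h := fun t => t ^ ((1 + ν) / 2 - 4) +
      t ^ (3 * ((1 + ν) / 2) - 1 - 4)) ?_ (by norm_num) ?_ fun q _ hq => if_pos hq
    · refine (isSymbol_flatPart (D := D) (ε := ε) hν).congr isOpen_innerCone fun q hq => ?_
      exact if_neg (not_le.2 hq.1)
    · exact (continuousOn_id.rpow_const fun t ht => Or.inl (mem_Ioi.1 ht).ne').add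
        (continuousOn_id.rpow_const fun t ht => Or.inl (mem_Ioi.1 ht).ne')
  have hB : ContDiffOn ℝ (2 : ℕ) (fun q : ℝ × ℝ => q.2 ^ 2 / 6 * deriv^[3] (primB D ν ε) q.1)
      {q | 0 < q.1 ∧ q.2 < q.1 / 2} :=
    ContDiffOn.mul (by fun_prop) (((derivSeq_primB (D := D) (ε := ε) hν).contDiffOn 3).comp
      contDiffOn_fst fun q hq => hq.1)
  have hO : IsOpen {q : ℝ × ℝ | 0 < q.1 ∧ q.2 < q.1 / 2} :=
    (isOpen_lt continuous_const continuous_fst).inter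
      (isOpen_lt continuous_snd (continuous_fst.div_const 2))
  rintro ⟨t, r⟩ ⟨ht, hr⟩
  simp only at ht hr
  rcases hr.lt_or_eq with hr | rfl
  · exact ((contDiffOn_corr₂_quadrant hν).contDiffAt
      (isOpen_quadrant.mem_nhds ⟨ht, hr⟩)).contDiffWithinAt
  · have hmem : ((t, 0) : ℝ × ℝ) ∈ {q : ℝ × ℝ | 0 < q.1 ∧ q.2 < q.1 / 2} := ⟨ht, by simpa using ht⟩
    have h1 := ((hflat.add hB).contDiffAt (hO.mem_nhds hmem)).contDiffWithinAt
      (s := {q : ℝ × ℝ | 0 < q.1 ∧ 0 ≤ q.2})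
    refine h1.congr (fun q hq => ?_) ?_
    · rcases hq.2.lt_or_eq with hq2 | hq2
      · rw [corr₂_eq hν hq.1, taylorRem_primB_four, if_neg (not_le.2 hq2), flatPart]
        field_simp
        ring
      -- On the axis both sides vanish; for `corr₂` this is the convention that division by zero
      -- gives zero.
      · simp [corr₂, ← hq2]
    · simp [corr₂]

theorem contDiffOn_approx (hν : 3 < ν) :
    ContDiffOn ℝ (2 : ℕ) (approx D ν ε) {q | 0 < q.1 ∧ 0 ≤ q.2} :=
  (contDiffOn_bulk.mono fun _ hq => hq.1).add
    ((contDiffOn_corr₁.mono fun _ hq => hq.1).add (contDiffOn_corr₂ hν))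

end Regularity

/-! ### Cutoff and energy outside the light cone -/

noncomputable section Exterior

variable {D : ProfileData} {ν ε : ℝ}

/-- The approximate solution, cut off outside the light cone. -/
def cutoffApprox (D : ProfileData) (ν ε : ℝ) (q : ℝ × ℝ) : ℝ :=
  Real.smoothTransition (2 - q.2 / q.1) * approx D ν ε q

theorem contDiffOn_cutoffApprox (hν : 3 < ν) :
    ContDiffOn ℝ (2 : ℕ) (cutoffApprox D ν ε) {q | 0 < q.1 ∧ 0 ≤ q.2} := by
  refine ContDiffOn.mul (Real.smoothTransition.contDiff.comp_contDiffOn ?_) (contDiffOn_approx hν)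
  exact contDiffOn_const.sub (contDiffOn_snd.div contDiffOn_fst fun q hq => (hq.1).ne')

theorem cutoffApprox_eq {q : ℝ × ℝ} (ht : 0 < q.1) (hr : q.2 ≤ q.1) :
    cutoffApprox D ν ε q = approx D ν ε q := by
  rw [cutoffApprox, Real.smoothTransition.one_of_one_le, one_mul]
  have := (div_le_one ht).2 hr
  linarith

theorem cutoffApprox_eq_zero {q : ℝ × ℝ} (ht : 0 < q.1) (hr : 2 * q.1 ≤ q.2) :
    cutoffApprox D ν ε q = 0 := by
  rw [cutoffApprox, Real.smoothTransition.zero_of_nonpos, zero_mul]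
  have := (le_div_iff₀ ht).2 hr
  linarith

/-- The region near the light cone that carries the exterior energy. -/
def rim : Set (ℝ × ℝ) := {q | 0 < q.1 ∧ q.1 < 1 ∧ q.1 / 2 < q.2 ∧ q.2 < 3 * q.1}

theorem isOpen_rim : IsOpen rim :=
  (isOpen_lt continuous_const continuous_fst).inter
    ((isOpen_lt continuous_fst continuous_const).inter
    ((isOpen_lt (continuous_fst.div_const 2) continuous_snd).inter
      (isOpen_lt continuous_snd (continuous_const.mul continuous_fst))))

theorem rim_subset : rim ⊆ openCone 3 1 := fun q hq =>
  ⟨hq.1, hq.2.1, by linarith [hq.1, hq.2.2.1], hq.2.2.2⟩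

/-- The cutoff depends only on r/t, an eigenfunction of both fields. Where r is comparable to t,
bulk term and corrections are both O(1/(tσ)), as R is comparable to μ. -/
theorem isSymbol_cutoffApprox (hν : 3 < ν) :
    IsSymbol coneField rim (fun q => (q.1 * sig ν ε q.1)⁻¹) 1 (cutoffApprox D ν ε) := by
  have hO := isOpen_rim
  have hQ : rim ⊆ quadrant := fun q hq => ⟨hq.1, by linarith [hq.1, hq.2.2.1]⟩
  have hχ : IsSymbol eulerField (Ioo (0 : ℝ) 3) (fun _ => 1) 1
      (fun a => Real.smoothTransition (2 - a)) :=
    IsSymbol.of_contDiff_eulerField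
      (Real.smoothTransition.contDiff.comp (contDiff_const.sub contDiff_id)) 0 3
  have hφ : ContDiffOn ℝ (1 : ℕ) (fun q : ℝ × ℝ => q.2 / q.1) rim :=
    contDiffOn_snd.div contDiffOn_fst fun q hq => hq.1.ne'
  have h1 : IsSymbol coneField rim (fun _ => 1) 1
      (fun q => Real.smoothTransition (2 - q.2 / q.1)) := by
    refine hχ.comp (φ := fun q => q.2 / q.1) (c := fun (i : Bool) _ => if i then 1 else -1) isOpen_Ioo hO
      hφ (fun q hq => ?_) (fun i => .const _) fun i q hq => ?_
    · exact ⟨div_pos (hQ hq).2 hq.1, (div_lt_iff₀ hq.1).2 hq.2.2.2⟩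
    · have hd : DifferentiableAt ℝ (fun q : ℝ × ℝ => q.2 / q.1) (q.1, q.2) :=
        (hφ.contDiffAt (hO.mem_nhds hq)).differentiableAt (by simp)
      have h0 := hq.1.ne'
      cases i
      · rw [lieD_false, (hasDerivAt_fst hd).unique
          ((hasDerivAt_const q.1 q.2).div (hasDerivAt_id q.1) h0)]
        simp only [Bool.false_eq_true, if_false]
        field_simp
        simp
      · rw [lieD_true, (hasDerivAt_snd hd).unique ((hasDerivAt_id q.2).div_const q.1)]
        simp only [if_true]
        ring
  have h2 : IsSymbol coneField rim (fun q => (q.1 * sig ν ε q.1)⁻¹) 1 (approx D ν ε) := by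
    have hb := isSymbol_bulk_cone (ν := ν) (ε := ε) (n := 1) (by linarith) le_rfl rim_subset
    have hv := isSymbol_corr (by linarith) le_rfl hO rim_subset
      (((isSymbol_corr₂ (D := D) (ε := ε) hν).mono rim_subset).of_le one_le_two)
    refine (hb.weight (C := 2) (by norm_num) fun q hq => ?_).add
      (hv.weight (C := 3) (by norm_num) fun q hq => ?_) hO
    · have ht := hq.1
      have hr := (hQ hq).2
      have hs := sig_pos (ν := ν) (ε := ε) ht
      calc sig ν ε q.1 * (1 + sig ν ε q.1 ^ 2 * q.2)⁻¹
          ≤ sig ν ε q.1 * (sig ν ε q.1 ^ 2 * (q.1 / 2))⁻¹ := by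
            gcongr
            have : sig ν ε q.1 ^ 2 * (q.1 / 2) ≤ sig ν ε q.1 ^ 2 * q.2 := by
              gcongr
              exact hq.2.2.1.le
            linarith
        _ = _ := by field_simp
    · have ht := hq.1
      have hr := (hQ hq).2
      have hs := sig_pos (ν := ν) (ε := ε) ht
      rw [weightS_eq ht]
      calc (q.1 ^ 2 * sig ν ε q.1 ^ 3)⁻¹ * (sig ν ε q.1 ^ 2 * q.2)
          ≤ (q.1 ^ 2 * sig ν ε q.1 ^ 3)⁻¹ * (sig ν ε q.1 ^ 2 * (3 * q.1)) := by
            gcongr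
            exact hq.2.2.2.le
        _ = _ := by field_simp
  exact (h1.mul h2 hO).weight_le (by simp)

theorem pderiv_cutoffApprox (hν : 3 < ν) {t r : ℝ} (h : ((t, r) : ℝ × ℝ) ∈ quadrant) :
    pderiv 0 1 (fun s ρ => cutoffApprox D ν ε (s, ρ)) t r = dr (cutoffApprox D ν ε) (t, r) ∧
      pderiv 1 0 (fun s ρ => cutoffApprox D ν ε (s, ρ)) t r = dt (cutoffApprox D ν ε) (t, r) := by
  have hc : ContDiffOn ℝ (1 : ℕ) (cutoffApprox D ν ε) quadrant :=
    ((contDiffOn_cutoffApprox hν).mono fun q hq => ⟨hq.1, hq.2.le⟩).of_le (by norm_num)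
  exact ⟨pderiv_eq_iterate (k := 0) (j := 1) isOpen_quadrant hc h,
    pderiv_eq_iterate (k := 1) (j := 0) isOpen_quadrant hc h⟩

theorem continuousOn_energyDensity (hν : 3 < ν) {t : ℝ} (ht : 0 < t) :
    ContinuousOn (energyDensity (fun s ρ => cutoffApprox D ν ε (s, ρ)) t) (Ici t) := by
  have hc : ContDiffOn ℝ (1 : ℕ) (cutoffApprox D ν ε) quadrant :=
    ((contDiffOn_cutoffApprox hν).mono fun q hq => ⟨hq.1, hq.2.le⟩).of_le (by norm_num)
  have h1 := (contDiffOn_dt (n := 0) isOpen_quadrant hc).continuousOn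
  have h2 := (contDiffOn_dr (n := 0) isOpen_quadrant hc).continuousOn
  have h3 := hc.continuousOn
  have hm : MapsTo (fun r : ℝ => ((t, r) : ℝ × ℝ)) (Ici t) quadrant := fun r hr =>
    ⟨ht, ht.trans_le hr⟩
  have hi : ContinuousOn (fun r : ℝ => ((t, r) : ℝ × ℝ)) (Ici t) := by fun_prop
  refine (((((h2.comp hi hm).pow 2).add ((h1.comp hi hm).pow 2)).add
    ((h3.comp hi hm).pow 6)).mul (continuousOn_id.pow 2)).congr fun r hr => ?_
  obtain ⟨e1, e2⟩ := pderiv_cutoffApprox (D := D) (ε := ε) hν (hm hr)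
  rw [energyDensity, e1, e2]
  rfl

theorem energyDensity_eq_zero (hν : 3 < ν) {t r : ℝ} (ht : 0 < t) (hr : 2 * t < r) :
    energyDensity (fun s ρ => cutoffApprox D ν ε (s, ρ)) t r = 0 := by
  have hO : IsOpen {q : ℝ × ℝ | 0 < q.1 ∧ 2 * q.1 < q.2} :=
    (isOpen_lt continuous_const continuous_fst).inter
      (isOpen_lt (continuous_const.mul continuous_fst) continuous_snd)
  have hz : EqOn (cutoffApprox D ν ε) (fun _ => 0) {q : ℝ × ℝ | 0 < q.1 ∧ 2 * q.1 < q.2} :=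
    fun q hq => cutoffApprox_eq_zero hq.1 hq.2.le
  have hm : ((t, r) : ℝ × ℝ) ∈ {q : ℝ × ℝ | 0 < q.1 ∧ 2 * q.1 < q.2} := ⟨ht, hr⟩
  obtain ⟨e1, e2⟩ := pderiv_cutoffApprox (D := D) (ε := ε) (t := t) (r := r) hν
    ⟨ht, by linarith⟩
  rw [energyDensity, e1, e2, dt_congr hO hz hm, dr_congr hO hz hm, hz hm]
  simp [dt, dr]

theorem exists_energyDensity_le (hν : 3 < ν) : ∃ C, ∀ t r, 0 < t → t < 1 → t ≤ r →
    r ≤ 2 * t → |energyDensity (fun s ρ => cutoffApprox D ν ε (s, ρ)) t r| ≤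
      (2 * (C * (t * (t * sig ν ε t))⁻¹) ^ 2 + (C * (t * sig ν ε t)⁻¹) ^ 6) * (2 * t) ^ 2 := by
  have hQ : rim ⊆ quadrant := fun q hq => ⟨hq.1, by linarith [hq.1, hq.2.2.1]⟩
  have h := isSymbol_cutoffApprox (D := D) (ε := ε) hν
  obtain ⟨C₀, hC₀, h0⟩ := IsSymbol.pderiv_bound (k := 0) (j := 0) (h.of_le zero_le_one) isOpen_rim hQ
  obtain ⟨C₁, hC₁, h1⟩ := IsSymbol.pderiv_bound (k := 1) (j := 0) h isOpen_rim hQ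
  obtain ⟨C₂, hC₂, h2⟩ := IsSymbol.pderiv_bound (k := 0) (j := 1) h isOpen_rim hQ
  refine ⟨C₀ + C₁ + C₂, fun t r ht ht1 hr hr2 => ?_⟩
  have hm : ((t, r) : ℝ × ℝ) ∈ rim := ⟨ht, ht1, by simp only; linarith, by simp only; linarith⟩
  have hs := sig_pos (ν := ν) (ε := ε) ht
  have b0 := h0 t r hm
  have b1 := h1 t r hm
  have b2 := h2 t r hm
  have hr0 : 0 < r := ht.trans_le hr
  set w := (t * sig ν ε t)⁻¹ with hw
  have hw0 : 0 < w := by positivity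
  simp only [pow_zero, pow_one, inv_one, one_mul] at b0 b1 b2
  have b0' : |cutoffApprox D ν ε (t, r)| ≤ (C₀ + C₁ + C₂) * w := by
    refine (le_trans (by simp [pderiv]) b0).trans ?_
    gcongr
    linarith
  have b1' := b1.trans (show C₁ * (t⁻¹ * w) ≤ (C₀ + C₁ + C₂) * (t * (t * sig ν ε t))⁻¹ by
    rw [mul_inv]; gcongr; linarith)
  have b2' := b2.trans (show C₂ * (r⁻¹ * w) ≤ (C₀ + C₁ + C₂) * (t * (t * sig ν ε t))⁻¹ by
    rw [mul_inv]; gcongr; linarith)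
  have c0 := pow_le_pow_left₀ (abs_nonneg _) b0' 6
  have c1 := pow_le_pow_left₀ (abs_nonneg _) b1' 2
  have c2 := pow_le_pow_left₀ (abs_nonneg _) b2' 2
  rw [Even.pow_abs (by decide)] at c0
  rw [sq_abs] at c1 c2
  rw [energyDensity, abs_of_nonneg (mul_nonneg (by positivity) (by positivity))]
  gcongr
  linarith

/-- The density lives on t ≤ r ≤ 2t. With u = O(1/(tσ)) and one factor t⁻¹ per derivative, the
gradient terms integrate to O(μ⁻¹) and the sixth power to O(μ⁻³). The lower bound μ ≥ b/t on (0, 1)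
makes both O(t). -/
theorem exists_exterior_energy_le (hν : 3 < ν) : ∃ K, 0 ≤ K ∧ ∀ t, 0 < t → t < 1 →
    IntegrableOn (energyDensity (fun s ρ => cutoffApprox D ν ε (s, ρ)) t) (Ici t) ∧
    ∫ r in Ici t, energyDensity (fun s ρ => cutoffApprox D ν ε (s, ρ)) t r ≤ K * t := by
  obtain ⟨C, hC⟩ := exists_energyDensity_le (D := D) (ε := ε) hν
  set b := exp (-|ε|) ^ 2 with hb
  have hb0 : 0 < b := by positivity
  refine ⟨8 * C ^ 2 * b⁻¹ + 4 * C ^ 6 * b⁻¹ ^ 3, by positivity, fun t ht ht1 => ?_⟩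
  have hz : ∀ r ∈ Ici t \ Icc t (2 * t),
      energyDensity (fun s ρ => cutoffApprox D ν ε (s, ρ)) t r = 0 := fun r hr =>
    energyDensity_eq_zero hν ht (not_le.1 fun h => hr.2 ⟨hr.1, h⟩)
  have hi : IntegrableOn (energyDensity (fun s ρ => cutoffApprox D ν ε (s, ρ)) t)
      (Icc t (2 * t)) :=
    ((continuousOn_energyDensity hν ht).mono Icc_subset_Ici_self).integrableOn_compact isCompact_Icc
  refine ⟨hi.of_forall_sdiff_eq_zero measurableSet_Ici hz, ?_⟩
  rw [setIntegral_eq_of_subset_of_forall_sdiff_eq_zero measurableSet_Ici Icc_subset_Ici_self hz]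
  have hs := sig_pos (ν := ν) (ε := ε) ht
  have hμ : b * t⁻¹ ≤ mu ν ε t := by
    refine le_trans ?_ (exp_rpow_le_mu ht)
    rw [← Real.rpow_neg_one]
    exact mul_le_mul_of_nonneg_left
      (Real.rpow_le_rpow_of_exponent_ge ht ht1.le (by linarith)) hb0.le
  have hμi : (mu ν ε t)⁻¹ ≤ b⁻¹ * t := by
    refine (inv_anti₀ (by positivity) hμ).trans_eq ?_
    rw [mul_inv, inv_inv]
  have hμ0 : 0 < mu ν ε t := lt_of_lt_of_le (by positivity) hμ
  have hμ3 : (mu ν ε t)⁻¹ ^ 3 ≤ b⁻¹ ^ 3 * t := by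
    refine (pow_le_pow_left₀ (by positivity) hμi 3).trans ?_
    rw [mul_pow]
    gcongr
    exact pow_le_of_le_one ht.le ht1.le (by norm_num)
  have hn := norm_setIntegral_le_of_norm_le_const (μ := volume) (s := Icc t (2 * t))
    (f := energyDensity (fun s ρ => cutoffApprox D ν ε (s, ρ)) t) (by simp) fun r hr => hC t r ht ht1 hr.1 hr.2
  refine (le_abs_self _).trans (hn.trans ?_)
  rw [Real.volume_real_Icc_of_le (by linarith)]
  calc _ = 8 * C ^ 2 * (mu ν ε t)⁻¹ + 4 * C ^ 6 * (mu ν ε t)⁻¹ ^ 3 := by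
        rw [mu_eq ht]
        field_simp
        ring
    _ ≤ 8 * C ^ 2 * (b⁻¹ * t) + 4 * C ^ 6 * (b⁻¹ ^ 3 * t) := by gcongr
    _ = _ := by ring

end Exterior

end QuinticWave

/-! ### Assembly of the main theorem -/

theorem proposition2p1 (ν : ℝ) (hν : 3 < ν) :
    ∃ εmax : ℝ, 0 < εmax ∧ ∀ ε₀ : ℝ, |ε₀| < εmax →
    ∃ T : ℝ, 0 < T ∧ ∀ t₀ : ℝ, 0 < t₀ → t₀ < T →
    ∃ u₂ : ℝ → ℝ → ℝ,
      -- (i) regularity, size, and size of the error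
      (ContDiffOn ℝ 2 (fun p : ℝ × ℝ => u₂ p.1 p.2) (QuinticWave.cone t₀) ∧
        (∃ C : ℝ, ∀ t r : ℝ, 0 < t → t < t₀ → 0 < r → r < t →
          |u₂ t r - √(QuinticWave.lam ν ε₀ t) * QuinticWave.W (QuinticWave.lam ν ε₀ t * r)| ≤
            C * (√(QuinticWave.lam ν ε₀ t) * (QuinticWave.mu ν ε₀ t ^ 2)⁻¹ *
              (QuinticWave.lam ν ε₀ t * r))) ∧
        (∃ C : ℝ, ∀ t r : ℝ, 0 < t → t < t₀ → 0 < r → r < t →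
          |t ^ 2 * QuinticWave.lam ν ε₀ t ^ (-(1 / 2) : ℝ) * QuinticWave.quinticOp u₂ t r| ≤
            C * ((QuinticWave.mu ν ε₀ t ^ 2)⁻¹ *
              (log (QuinticWave.lam ν ε₀ t * r + 2) / (QuinticWave.lam ν ε₀ t * r + 1))))) ∧
      -- (ii) symbol bounds of all orders for `r < t/2`
      (ContDiffOn ℝ ∞ (fun p : ℝ × ℝ => u₂ p.1 p.2) (QuinticWave.openCone (1 / 2) t₀) ∧
        (∀ k j : ℕ,
          QuinticWave.SolutionBound ν ε₀ u₂ k j (QuinticWave.openCone (1 / 2) t₀) ∧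
          QuinticWave.ErrorBound ν ε₀ u₂ k j (QuinticWave.openCone (1 / 2) t₀))) ∧
      -- (ii) symbol bounds of order at most two for `r < t`
      (ContDiffOn ℝ 2 (fun p : ℝ × ℝ => QuinticWave.normError ν ε₀ u₂ p.1 p.2)
          (QuinticWave.openCone 1 t₀) ∧
        (∀ k j : ℕ, k + j ≤ 2 →
          QuinticWave.SolutionBound ν ε₀ u₂ k j (QuinticWave.openCone 1 t₀) ∧
          QuinticWave.ErrorBound ν ε₀ u₂ k j (QuinticWave.openCone 1 t₀))) ∧
      -- (iii) extension beyond the light cone with small exterior energy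
      (∃ U : ℝ → ℝ → ℝ,
        (∀ t r : ℝ, 0 < t → t < t₀ → 0 ≤ r → r ≤ t → U t r = u₂ t r) ∧
        (∀ t : ℝ, 0 < t → t < t₀ → ContDiffOn ℝ 2 (U t) (Ici 0)) ∧
        ContDiffOn ℝ 1 (fun p : ℝ × ℝ => U p.1 p.2) (Ioo 0 t₀ ×ˢ Ici 0) ∧
        ∀ δ : ℝ, 0 < δ → ∃ t₁ : ℝ, 0 < t₁ ∧ ∀ t : ℝ, 0 < t → t < t₀ → t < t₁ →
          IntegrableOn (QuinticWave.energyDensity U t) (Ici t) ∧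
          ∫ r in Ici t, QuinticWave.energyDensity U t r < δ) := by
  obtain ⟨F₁, β₁, γ₁, h₁⟩ := QuinticWave.exists_isProfile₁
  obtain ⟨F₂, β₂, γ₂, h₂⟩ := QuinticWave.exists_isProfile₂
  let D : QuinticWave.ProfileData :=
    { F₁ := F₁, F₂ := F₂, β₁ := β₁, γ₁ := γ₁, β₂ := β₂, γ₂ := γ₂
      isProfile₁ := h₁, isProfile₂ := h₂ }
  have hν0 : 0 < ν := by linarith
  -- T = 1 keeps t in (0, 1), where μ has the lower bound used to compare weights.
  refine ⟨1, one_pos, fun ε _ => ⟨1, one_pos, fun t₀ ht₀ ht₁ =>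
    ⟨fun t r => QuinticWave.approx D ν ε (t, r), ?_⟩⟩⟩
  have hO₁ := QuinticWave.isOpen_openCone (t₀ := t₀) 1
  have hO₂ := QuinticWave.isOpen_openCone (t₀ := t₀) (1 / 2)
  have hS₁ : QuinticWave.openCone 1 t₀ ⊆ QuinticWave.openCone 3 t₀ := fun q hq =>
    ⟨hq.1, hq.2.1, hq.2.2.1, by linarith [hq.1, hq.2.2.2]⟩
  have hS₂ : QuinticWave.openCone (1 / 2) t₀ ⊆ QuinticWave.openCone 3 t₀ := fun q hq =>
    ⟨hq.1, hq.2.1, hq.2.2.1, by linarith [hq.1, hq.2.2.2]⟩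
  have hI : QuinticWave.openCone (1 / 2) t₀ ⊆ QuinticWave.innerCone := fun q hq =>
    ⟨hq.2.2.1, by linarith [hq.2.2.2]⟩
  have hc₁ := (QuinticWave.isSymbol_corr₂ (D := D) (ε := ε) hν (t₀ := t₀)).mono hS₁
  have hc₂ (n : ℕ) :=
    (QuinticWave.isSymbol_corr₂_innerCone (D := D) (ε := ε) (n := n) hν).mono hI
  have hsol (k j : ℕ) (hkj : k + j ≤ 2) :=
    QuinticWave.solutionBound_approx hν0 ht₁.le hO₁ hS₁ (hc₁.of_le hkj)
  have herr (k j : ℕ) (hkj : k + j ≤ 2) :=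
    QuinticWave.errorBound_approx hν ht₁.le hO₁ hS₁ (hc₁.of_le hkj)
  have hQ₁ : QuinticWave.openCone 1 t₀ ⊆ QuinticWave.quadrant := fun q hq => ⟨hq.1, hq.2.2.1⟩
  have hQ₂ : QuinticWave.openCone (1 / 2) t₀ ⊆ QuinticWave.quadrant := fun q hq =>
    ⟨hq.1, hq.2.2.1⟩
  have hcut := QuinticWave.contDiffOn_cutoffApprox (D := D) (ε := ε) hν
  refine ⟨⟨?_, ?_, ?_⟩, ⟨?_, fun k j => ⟨?_, ?_⟩⟩, ⟨?_, fun k j hkj => ⟨hsol k j hkj, herr k j hkj⟩⟩,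
    fun t r => QuinticWave.cutoffApprox D ν ε (t, r), ?_, ?_, ?_, ?_⟩
  · exact (QuinticWave.contDiffOn_approx hν).mono fun q hq => ⟨hq.1, hq.2.2.1⟩
  · obtain ⟨C, hC⟩ := hsol 0 0 (by norm_num)
    refine ⟨C, fun t r h1 h2 h3 h4 => ?_⟩
    simpa [QuinticWave.pderiv, QuinticWave.bulk] using hC t r ⟨h1, h2, h3, by simpa using h4⟩
  · obtain ⟨C, hC⟩ := herr 0 0 (by norm_num)
    refine ⟨C, fun t r h1 h2 h3 h4 => ?_⟩
    have h := hC t r ⟨h1, h2, h3, by simpa using h4⟩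
    simp only [pow_zero, inv_one, one_mul] at h
    exact h
  · refine contDiffOn_infty.2 fun n => ?_
    exact (QuinticWave.isSymbol_bulk.mono hQ₂).contDiffOn.add
      (QuinticWave.isSymbol_corr hν0 ht₁.le hO₂ hS₂ (hc₂ n)).contDiffOn
  · exact QuinticWave.solutionBound_approx hν0 ht₁.le hO₂ hS₂ (hc₂ _)
  · exact QuinticWave.errorBound_approx hν ht₁.le hO₂ hS₂ (hc₂ _)
  · exact (QuinticWave.isSymbol_errorExpr hν0 ht₁.le hO₁ hS₁ hc₁).contDiffOn.congr fun q hq =>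
      QuinticWave.normError_approx hν (hQ₁ hq)
  · exact fun t r ht _ _ hr => QuinticWave.cutoffApprox_eq ht hr
  · intro t ht _
    exact hcut.comp (f := fun r : ℝ => ((t, r) : ℝ × ℝ)) (by fun_prop) fun r hr => ⟨ht, hr⟩
  · exact (hcut.of_le (by norm_num)).mono fun q hq => ⟨hq.1.1, hq.2⟩
  · intro δ hδ
    obtain ⟨K, hK, h⟩ := QuinticWave.exists_exterior_energy_le (D := D) (ε := ε) hν
    -- K + 1 instead of K keeps the denominator positive when K = 0.
    refine ⟨δ / (K + 1), by positivity, fun t ht htt₀ htt₁ => ?_⟩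
    obtain ⟨h1, h2⟩ := h t ht (htt₀.trans ht₁)
    refine ⟨h1, h2.trans_lt ?_⟩
    rw [lt_div_iff₀ (by positivity)] at htt₁
    linarith
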